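/- **Conventions.** A *length space* is a metric space $U$ (with finite distances) such that for all $x,y\in U$ and every $\varepsilon>0$ there is a path from $x$ to $y$ of length less than $|x-y|_U+\varepsilon$. A metric space is *proper* if all its closed bounded subsets are compact. A *model triangle* of points $p,x,y$ of a metric space is a triple $\tilde p,\tilde x,\tilde y$ in the Euclidean plane $\mathbb E^2$ with the same pairwise distances. A *spherical model triangle* is a triple in the unit sphere $\mathbb S^2$ with its angle metric and with the same pairwise distances; it is defined only if $|p-x|+|x-y|+|y-p|<2\pi$. A metric space $X$ is *CAT(0)* if for all $p,q,x,y\in X$, all model triangles $\tilde p,\tilde x,\tilde y$ of $p,x,y$ and $\tilde q,\tilde x,\tilde y$ of $q,x,y$ with the common side $[\tilde x\tilde y]$, and all $\tilde z\in[\tilde x\tilde y]$, $$|p-q|_X\le|\tilde p-\tilde z|+|\tilde z-\tilde q|.$$ It is *CAT(1)* if the same holds with spherical model triangles and spherical distances, for all $p,q,x,y$ such that both spherical model triangles are defined. A metric space is *locally CAT($\kappa$)*, $\kappa\in\{0,1\}$, if each of its points is the center of a closed ball of positive radius which is CAT($\kappa$) with the restricted metric. **Globalization theorem.** Let $U$ be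 a proper length space. 1. If $U$ is simply connected and locally CAT(0), then $U$ is CAT(0). 2. Suppose that $U$ is locally CAT(1) and that every closed curve $\gamma\colon\mathbb S^1\to U$ of length less than $2\pi$ is null-homotopic in the class of closed curves of length less than $2\pi$; that is, there is a homotopy $H\colon[0,1]\times\mathbb S^1\to U$ with $H(0,\cdot)=\gamma$ and $H(1,\cdot)$ constant such that every closed curve $H(s,\cdot)$ has length less than $2\pi$. Then $U$ is CAT(1). -/

import Mathlib

/-- A length space: any two points are joined by a path (a continuous map from `[0,1]`) whose
length, the supremum of the lengths of its inscribed polygonal lines, is less than their distance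
plus a prescribed `ε > 0`. -/
def IsLengthSpace (X : Type*) [MetricSpace X] : Prop :=
  ∀ x y : X, ∀ ε : ℝ, 0 < ε →
    ∃ α : Path x y, eVariationOn (α : unitInterval → X) Set.univ < ENNReal.ofReal (dist x y + ε)

/-- `a, b, c` are the vertices of a Euclidean model triangle of the triple `p, q, r`. Such a triple
in the plane always exists, and it is unique up to a motion of the plane. -/
def IsEuclideanModel {X : Type*} [MetricSpace X] (p q r : X)
    (a b c : EuclideanSpace ℝ (Fin 2)) : Prop :=
  dist a b = dist p q ∧ dist b c = dist q r ∧ dist c a = dist r p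

/-- `CAT(0)` comparison for the quadruple `p, q, x, y`: for the model triangles `p' x' y'` and
`q' x' y'` with common side `[x' y']` and for every point `z'` of that side,
`|p q| ≤ |p' z'| + |z' q'|`. -/
def CATZeroComparison {X : Type*} [MetricSpace X] (p q x y : X) : Prop :=
  ∀ p' q' x' y' : EuclideanSpace ℝ (Fin 2),
    IsEuclideanModel p x y p' x' y' → IsEuclideanModel q x y q' x' y' →
      ∀ z' ∈ segment ℝ x' y', dist p q ≤ dist p' z' + dist z' q'

/-- A metric space is `CAT(0)` if all its quadruples satisfy `CAT(0)` comparison. -/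
def IsCATZero (X : Type*) [MetricSpace X] : Prop :=
  ∀ p q x y : X, CATZeroComparison p q x y

/-- The unit sphere in Euclidean 3-space. -/
abbrev UnitTwoSphere : Type := Metric.sphere (0 : EuclideanSpace ℝ (Fin 3)) 1

/-- The intrinsic (angle) distance on the unit sphere. -/
noncomputable def sphericalDist (a b : UnitTwoSphere) : ℝ :=
  InnerProductGeometry.angle (a : EuclideanSpace ℝ (Fin 3)) (b : EuclideanSpace ℝ (Fin 3))

/-- `a, b, c` are the vertices of a spherical model triangle of the triple `p, q, r`; the model
triangle is defined only if the perimeter is less than `2π`. In that case such a triple in the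
sphere exists, and it is unique up to a motion of the sphere. -/
def IsSphericalModel {X : Type*} [MetricSpace X] (p q r : X) (a b c : UnitTwoSphere) : Prop :=
  dist p q + dist q r + dist r p < 2 * Real.pi ∧
    sphericalDist a b = dist p q ∧ sphericalDist b c = dist q r ∧ sphericalDist c a = dist r p

/-- The spherical geodesic `[a b]` (the shorter great-circle arc), for points at distance
less than `π`. -/
def sphericalSegment (a b : UnitTwoSphere) : Set UnitTwoSphere :=
  {z | sphericalDist a z + sphericalDist z b = sphericalDist a b}

/-- `CAT(1)` comparison for the quadruple `p, q, x, y`. It holds automatically if one of the two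
spherical model triangles is undefined. -/
def CATOneComparison {X : Type*} [MetricSpace X] (p q x y : X) : Prop :=
  ∀ p' q' x' y' : UnitTwoSphere,
    IsSphericalModel p x y p' x' y' → IsSphericalModel q x y q' x' y' →
      ∀ z' ∈ sphericalSegment x' y', dist p q ≤ sphericalDist p' z' + sphericalDist z' q'

/-- A metric space is `CAT(1)` if all its quadruples satisfy `CAT(1)` comparison. -/
def IsCATOne (X : Type*) [MetricSpace X] : Prop :=
  ∀ p q x y : X, CATOneComparison p q x y

/-- Every point is the center of a closed ball of positive radius that, with the restricted metric,
is a `CAT(0)` space. All smaller balls are then `CAT(0)` too, since the comparison is a condition on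
quadruples of points. -/
def IsLocallyCATZero (X : Type*) [MetricSpace X] : Prop :=
  ∀ p : X, ∃ r : ℝ, 0 < r ∧ IsCATZero (Metric.closedBall p r)

/-- Every point is the center of a closed ball of positive radius that, with the restricted metric,
is a `CAT(1)` space. -/
def IsLocallyCATOne (X : Type*) [MetricSpace X] : Prop :=
  ∀ p : X, ∃ r : ℝ, 0 < r ∧ IsCATOne (Metric.closedBall p r)

/-- The length of a closed curve, the circle being `ℝ / ℤ`. -/
noncomputable def closedCurveLength {X : Type*} [MetricSpace X] (γ : UnitAddCircle → X) : ENNReal :=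
  eVariationOn (fun t : ℝ => γ (t : UnitAddCircle)) (Set.Icc 0 1)

/-- The closed curve `γ` is null-homotopic in the class of closed curves of length less than `ℓ`:
some (free) homotopy through such curves ends in a constant curve. -/
def NullHomotopicThroughShorter {X : Type*} [MetricSpace X] (ℓ : ℝ) (γ : C(UnitAddCircle, X)) :
    Prop :=
  ∃ (c : X) (H : ContinuousMap.Homotopy γ (ContinuousMap.const UnitAddCircle c)),
    ∀ s : unitInterval, closedCurveLength (fun θ => H (s, θ)) < ENNReal.ofReal ℓ

open Filter Topology Set

/-! The proof has two halves: geodesics are shown to be unique (in part 2, those of length less than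
`π`), and then the local comparison is patched together along the resulting continuous families of
geodesics.

Uniqueness is a discrete form of the Cartan–Hadamard lifting argument, with harmonic chains in place
of local geodesics. Local comparison makes midpoints contract (`UniformlyCATZero.dist_mid_le`,
`UniformlyCATOne.sin_mid_le`). A maximum principle with cosine weights then shows that close
harmonic chains of length at most `L` are controlled by their endpoints
(`ChainScale.dist_le_of_ends`); here `L` is arbitrary for CAT(0) and below `π` for CAT(1), since the
weights must stay positive. When one endpoint moves a little, energy minimization supplies a new
harmonic chain nearby (`ChainScale.exists_harmonic`). Thus a polygon lifts to a sequence of chains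
issuing from its first vertex, hardly longer than the part of the polygon already traversed
(`ChainScale.exists_isLift`).

A closed polygon of perimeter `2 * l`, with `l < L`, need not lift completely, but it can be lifted
from both ends up to a common vertex near the middle. Agreement of the two lifts there does not
depend on the vertex, survives small deformations of the polygon, and holds for constant polygons
(`ChainScale.agree_of_family`). In a bigon the two lifts run along its two sides, so a bigon
contractible through curves of admissible length has equal sides (`IsGeodesic.eq_of_family`,
`IsGeodesic.eq_of_homotopy`).

Uniqueness and properness make geodesics from `p` vary continuously. For CAT(0), take a geodesic `γ`
and join `p` to `γ (t - ε)` and `γ (t + ε)`; subdivide both geodesics into `N` parts and join the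
midpoints of corresponding points. A local quadrilateral inequality
(`UniformlyCATZero.dist_mid_sq_le`), summed with Cauchy–Schwarz, bounds `dist p (γ t)` and yields
the sharp convexity of the squared distance for small `ε` (`IsLocallyCATZero.dist_sq_local`). A
maximum principle along `γ` (`nonpos_of_local`) turns it into comparison for the whole triangle. For
CAT(1) the same argument runs in the Euclidean cone over the space, where local CAT(1) comparison
becomes CAT(0) comparison (`CATOneComparison.coneSq_le`, `IsLocallyCATOne.cos_dist_local`). -/

/-- `m` is a midpoint of `a` and `b`. -/
def IsMid {U : Type*} [MetricSpace U] (a b m : U) : Prop :=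
  dist a m = dist a b / 2 ∧ dist m b = dist a b / 2

/-- Any two points have a point between them at every admissible distance from the first one. -/
def HasBetween (U : Type*) [MetricSpace U] : Prop :=
  ∀ (x y : U) (s : ℝ), 0 ≤ s → s ≤ dist x y → ∃ z, dist x z = s ∧ dist z y = dist x y - s

/-- `γ`, restricted to `[0, dist x y]`, is a unit-speed geodesic from `x` to `y`. -/
structure IsGeodesic {U : Type*} [MetricSpace U] (γ : ℝ → U) (x y : U) : Prop where
  left : γ 0 = x
  right : γ (dist x y) = y
  dist_eq : ∀ s t, 0 ≤ s → s ≤ t → t ≤ dist x y → dist (γ s) (γ t) = t - s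

/-- Insert between consecutive vertices of a polygonal line their chosen midpoints. -/
def subdivide {U : Type*} (mid : U → U → U) (p : ℕ → U) (k : ℕ) : U :=
  if k % 2 = 0 then p (k / 2) else mid (p (k / 2)) (p (k / 2 + 1))

theorem subdivide_two_mul {U : Type*} (mid : U → U → U) (p : ℕ → U) (k : ℕ) :
    subdivide mid p (2 * k) = p k := by
  simp [subdivide]

theorem subdivide_two_mul_add_one {U : Type*} (mid : U → U → U) (p : ℕ → U) (k : ℕ) :
    subdivide mid p (2 * k + 1) = mid (p k) (p (k + 1)) := by
  have h1 : (2 * k + 1) % 2 = 1 := by omega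
  have h2 : (2 * k + 1) / 2 = k := by omega
  simp [subdivide, h1, h2]

theorem iterate_subdivide_two_pow_mul {U : Type*} (mid : U → U → U) (p : ℕ → U) (q k : ℕ) :
    (subdivide mid)^[q] p (2 ^ q * k) = p k := by
  induction q generalizing k with
  | zero => simp
  | succ q ih => rw [Function.iterate_succ_apply', pow_succ', mul_assoc, subdivide_two_mul, ih]

/-! ### Geodesics in proper length spaces -/

section Geodesics

variable {U : Type*} [MetricSpace U]

theorem IsMid.symm {a b m : U} (h : IsMid a b m) : IsMid b a m :=
  ⟨by rw [dist_comm b m, dist_comm b a]; exact h.2, by rw [dist_comm m a, dist_comm b a]; exact h.1⟩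

theorem HasBetween.exists_mid (h : HasBetween U) (a b : U) : ∃ m, IsMid a b m := by
  obtain ⟨m, h1, h2⟩ := h a b (dist a b / 2) (by positivity) (by linarith [dist_nonneg (x := a) (y := b)])
  exact ⟨m, h1, by rw [h2]; ring⟩

theorem dist_add_dist_le_eVariationOn {x y : U} (α : Path x y) (t : unitInterval) :
    ENNReal.ofReal (dist x (α t) + dist (α t) y) ≤ eVariationOn (α : unitInterval → U) univ := by
  -- The path is sampled at `0`, `t`, `1`; only the first two steps enter the sum.
  have hu : Monotone (fun i : ℕ => if i = 0 then (0 : unitInterval) else if i = 1 then t else 1) := by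
    refine monotone_nat_of_le_succ fun n => ?_
    rcases n with _ | _ | n
    · simp
    · simpa using unitInterval.le_one'
    · simp
  have := eVariationOn.sum_le (f := (α : unitInterval → U)) (s := univ) (n := 2) hu (fun i => mem_univ _)
  simp only [Finset.sum_range_succ, Finset.sum_range_zero] at this
  simp only [zero_add, one_ne_zero, if_true, if_false, OfNat.ofNat_ne_one, Nat.reduceAdd,
    OfNat.ofNat_ne_zero, α.source, α.target] at this
  rw [ENNReal.ofReal_add dist_nonneg dist_nonneg, ← edist_dist, ← edist_dist, edist_comm x,
    edist_comm _ y]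
  exact this

/-- A nearly shortest path crosses the sphere of radius `s` about `x` in a point that is almost
between `x` and `y`. Balls are compact, so such points accumulate at an exact one. -/
theorem IsLengthSpace.hasBetween [ProperSpace U] (hU : IsLengthSpace U) : HasBetween U := by
  intro x y s hs hsd
  have key : ∀ n : ℕ, ∃ z, dist x z = s ∧ dist z y ≤ dist x y - s + 1 / ((n : ℝ) + 1) := by
    intro n
    have hn : (0 : ℝ) < 1 / ((n : ℝ) + 1) := by positivity
    obtain ⟨α, hα⟩ := hU x y _ hn
    have hc : Continuous fun t : unitInterval => dist x (α t) := by fun_prop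
    obtain ⟨t, ht⟩ : s ∈ range fun t : unitInterval => dist x (α t) := by
      apply mem_range_of_exists_le_of_exists_ge hc
      · exact ⟨0, by simpa using hs⟩
      · exact ⟨1, by simpa using hsd⟩
    refine ⟨α t, ht, ?_⟩
    have h1 := (dist_add_dist_le_eVariationOn α t).trans hα.le
    rw [ENNReal.ofReal_le_ofReal_iff (by positivity)] at h1
    simp only at ht
    linarith
  choose z hz1 hz2 using key
  obtain ⟨w, -, φ, hφ, hw⟩ := (isCompact_closedBall x s).tendsto_subseq
    (x := z) (fun n => by rw [Metric.mem_closedBall, dist_comm, hz1])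
  have h1 : dist x w = s := by
    refine tendsto_nhds_unique ((tendsto_const_nhds (x := x)).dist hw) ?_
    simp [hz1]
  have h2 : dist w y ≤ dist x y - s := by
    have hl : Tendsto (fun n => dist x y - s + 1 / (((φ n : ℕ) : ℝ) + 1)) atTop (𝓝 (dist x y - s + 0)) :=
      tendsto_const_nhds.add (tendsto_one_div_add_atTop_nhds_zero_nat.comp hφ.tendsto_atTop)
    rw [add_zero] at hl
    exact le_of_tendsto_of_tendsto (hw.dist tendsto_const_nhds) hl
      (Eventually.of_forall fun n => hz2 (φ n))
  exact ⟨w, h1, le_antisymm h2 (by linarith [dist_triangle x w y])⟩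

theorem dist_subdivide {mid : U → U → U} (hmid : ∀ a b, IsMid a b (mid a b)) (p : ℕ → U) (k : ℕ) :
    dist (subdivide mid p k) (subdivide mid p (k + 1)) = dist (p (k / 2)) (p (k / 2 + 1)) / 2 := by
  rcases Nat.even_or_odd' k with ⟨j, rfl | rfl⟩
  · rw [subdivide_two_mul, subdivide_two_mul_add_one, (hmid _ _).1, Nat.mul_div_cancel_left j two_pos]
  · rw [subdivide_two_mul_add_one, show 2 * j + 1 + 1 = 2 * (j + 1) by ring, subdivide_two_mul,
      (hmid _ _).2, show (2 * j + 1) / 2 = j by omega]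

theorem dist_iterate_subdivide {mid : U → U → U} (hmid : ∀ a b, IsMid a b (mid a b)) (p : ℕ → U)
    (q k : ℕ) : dist ((subdivide mid)^[q] p k) ((subdivide mid)^[q] p (k + 1)) =
      dist (p (k / 2 ^ q)) (p (k / 2 ^ q + 1)) / 2 ^ q := by
  induction q generalizing k with
  | zero => simp
  | succ q ih =>
    rw [Function.iterate_succ_apply', dist_subdivide hmid, ih, Nat.div_div_eq_div_mul, ← pow_succ',
      div_div, ← pow_succ]

theorem dist_le_mul_of_steps {p : ℕ → U} {e : ℝ} {m n : ℕ} (hmn : m ≤ n)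
    (h : ∀ k, dist (p k) (p (k + 1)) ≤ e) : dist (p m) (p n) ≤ ((n : ℝ) - m) * e := by
  induction n, hmn using Nat.le_induction with
  | base => simp
  | succ n hn ih =>
    have := dist_triangle (p m) (p n) (p (n + 1))
    have := h n
    push_cast
    linarith

/-- Upper bounds suffice: if some pair were closer than its parameters, the triangle inequality
would bring the endpoints too close together. -/
theorem IsGeodesic.of_le {γ : ℝ → U} {x y : U} (h0 : γ 0 = x) (h1 : γ (dist x y) = y)
    (h : ∀ s t, 0 ≤ s → s ≤ t → t ≤ dist x y → dist (γ s) (γ t) ≤ t - s) : IsGeodesic γ x y := by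
  refine ⟨h0, h1, fun s t hs hst ht => le_antisymm (h s t hs hst ht) ?_⟩
  have a1 := h 0 s le_rfl hs (hst.trans ht)
  have a2 := h t _ (hs.trans hst) ht le_rfl
  rw [h0] at a1
  rw [h1] at a2
  have := dist_triangle4 x (γ s) (γ t) y
  linarith

theorem HasBetween.exists_geodesic [CompleteSpace U] (hB : HasBetween U) (x y : U) :
    ∃ γ, IsGeodesic γ x y := by
  classical
  rcases eq_or_ne x y with rfl | hxy
  · refine ⟨fun _ => x, IsGeodesic.of_le rfl rfl ?_⟩
    intro s t hs hst ht
    simp [hst]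
  choose mid hmid using hB.exists_mid
  have hd : 0 < dist x y := dist_pos.2 hxy
  set d := dist x y with hdd
  -- The polygon stays at `y` after its first edge, so the bound on edges of its subdivisions needs
  -- no restriction on the index.
  set p : ℕ → U := fun k => if k = 0 then x else y with hp
  set P : ℕ → ℕ → U := fun q => (subdivide mid)^[q] p with hP
  have hedge : ∀ q k, dist (P q k) (P q (k + 1)) ≤ d / 2 ^ q := by
    intro q k
    rw [hP]
    simp only
    rw [dist_iterate_subdivide hmid]
    gcongr
    rcases Nat.eq_zero_or_pos (k / 2 ^ q) with h | h
    · simp [hp, h, hdd]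
    · simp [hp, h.ne', hd.le]
  set F : ℝ → ℕ → U := fun t q => P q ⌊t * 2 ^ q⌋₊ with hF
  have hstep : ∀ t, 0 ≤ t → ∀ q, dist (F t q) (F t (q + 1)) ≤ d / 2 / 2 ^ q := by
    intro t ht q
    -- Vertices persist under subdivision with doubled index, and the new floor is the doubled old
    -- one or one more; so the approximation moves along at most one edge of the finer polygon.
    have e1 : P q ⌊t * 2 ^ q⌋₊ = P (q + 1) (2 * ⌊t * 2 ^ q⌋₊) := by
      simp only [hP, Function.iterate_succ_apply']
      rw [subdivide_two_mul]
    have h0 : 0 ≤ t * 2 ^ q := by positivity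
    have h1 := Nat.floor_le h0
    have h2 := Nat.lt_floor_add_one (t * 2 ^ q)
    have h3 : 2 * ⌊t * 2 ^ q⌋₊ ≤ ⌊t * 2 ^ (q + 1)⌋₊ := by
      apply Nat.le_floor
      push_cast
      rw [pow_succ]; linarith
    have h4 : ⌊t * 2 ^ (q + 1)⌋₊ < 2 * ⌊t * 2 ^ q⌋₊ + 2 := by
      rw [Nat.floor_lt (by positivity)]
      push_cast
      rw [pow_succ]; linarith
    have h5 : ⌊t * 2 ^ (q + 1)⌋₊ = 2 * ⌊t * 2 ^ q⌋₊ ∨ ⌊t * 2 ^ (q + 1)⌋₊ = 2 * ⌊t * 2 ^ q⌋₊ + 1 := by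
      omega
    simp only [hF]
    rw [e1]
    rcases h5 with h | h
    · rw [h, dist_self]; positivity
    · rw [h]
      refine (hedge _ _).trans (le_of_eq ?_)
      rw [pow_succ']; field_simp
  have hlim : ∀ t, ∃ z, 0 ≤ t → Tendsto (F t) atTop (𝓝 z) := by
    intro t
    by_cases ht : 0 ≤ t
    · obtain ⟨z, hz⟩ := cauchySeq_tendsto_of_complete
        (cauchySeq_of_le_geometric_two (C := d) (fun q => hstep t ht q))
      exact ⟨z, fun _ => hz⟩
    · exact ⟨x, fun h => absurd h ht⟩
  choose g hg using hlim
  have g0 : g 0 = x := by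
    refine tendsto_nhds_unique (hg 0 le_rfl) ?_
    have : F 0 = fun _ => x := by
      funext q
      have := iterate_subdivide_two_pow_mul mid p q 0
      rw [mul_zero] at this
      simp only [hF, hP, zero_mul, Nat.floor_zero, this]
      simp [hp]
    rw [this]; exact tendsto_const_nhds
  have g1 : g 1 = y := by
    refine tendsto_nhds_unique (hg 1 zero_le_one) ?_
    have : F 1 = fun _ => y := by
      funext q
      have := iterate_subdivide_two_pow_mul mid p q 1
      simp only [mul_one] at this
      have h2 : ⌊(1 : ℝ) * 2 ^ q⌋₊ = 2 ^ q := by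
        rw [one_mul]; exact_mod_cast Nat.floor_natCast (R := ℝ) (2 ^ q)
      simp only [hF, h2, hP, this]; simp [hp]
    rw [this]; exact tendsto_const_nhds
  have glip : ∀ s t, 0 ≤ s → s ≤ t → dist (g s) (g t) ≤ (t - s) * d := by
    intro s t hs hst
    have ht := hs.trans hst
    have hr : Tendsto (fun q : ℕ => (t - s) * d + d * (1 / 2) ^ q) atTop (𝓝 ((t - s) * d + d * 0)) :=
      tendsto_const_nhds.add (tendsto_const_nhds.mul
        (tendsto_pow_atTop_nhds_zero_of_lt_one (by norm_num) (by norm_num)))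
    rw [mul_zero, add_zero] at hr
    refine le_of_tendsto_of_tendsto ((hg s hs).dist (hg t ht)) hr (Eventually.of_forall fun q => ?_)
    have h2q : (0 : ℝ) < 2 ^ q := by positivity
    have hfl : ⌊s * 2 ^ q⌋₊ ≤ ⌊t * 2 ^ q⌋₊ := Nat.floor_le_floor (by gcongr)
    refine (dist_le_mul_of_steps hfl (hedge q)).trans ?_
    have h1 := Nat.floor_le (show 0 ≤ t * 2 ^ q by positivity)
    have h2 := Nat.lt_floor_add_one (s * 2 ^ q)
    have h3 : ((⌊t * 2 ^ q⌋₊ : ℝ) - ⌊s * 2 ^ q⌋₊) ≤ (t - s) * 2 ^ q + 1 := by linarith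
    calc _ ≤ ((t - s) * 2 ^ q + 1) * (d / 2 ^ q) := by gcongr
      _ = _ := by simp only [one_div, inv_pow]; field_simp
  refine ⟨fun t => g (t / d), IsGeodesic.of_le (by simpa using g0) ?_ ?_⟩
  · rw [← hdd, div_self hd.ne', g1]
  · intro s t hs hst _
    refine (glip _ _ (by positivity) (by gcongr)).trans (le_of_eq ?_)
    field_simp

theorem IsGeodesic.concat {x z y : U} {γ₁ γ₂ : ℝ → U} (h1 : IsGeodesic γ₁ x z)
    (h2 : IsGeodesic γ₂ z y) (h : dist x z + dist z y = dist x y) :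
    IsGeodesic (fun t => if t ≤ dist x z then γ₁ t else γ₂ (t - dist x z)) x y := by
  have hxz := dist_nonneg (x := x) (y := z)
  have hzy := dist_nonneg (x := z) (y := y)
  refine IsGeodesic.of_le ?_ ?_ ?_
  · simp [h1.left]
  · by_cases hc : dist x y ≤ dist x z
    · have h0 : dist z y = 0 := by linarith
      have : z = y := dist_eq_zero.1 h0
      subst this
      simp [h1.right]
    · simp only [hc, if_false]
      rw [← h, add_sub_cancel_left, h2.right]
  · intro s t hs hst ht
    split_ifs with a b b
    · exact (h1.dist_eq s t hs hst b).le
    · have e1 := h1.dist_eq s _ hs a le_rfl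
      have e2 := h2.dist_eq 0 (t - dist x z) le_rfl (by linarith) (by linarith)
      rw [h1.right] at e1
      rw [h2.left] at e2
      refine (dist_triangle _ z _).trans ?_
      linarith
    · linarith
    · rw [h2.dist_eq _ _ (by linarith) (by linarith) (by linarith)]
      linarith

theorem IsGeodesic.dist_eq_abs {γ : ℝ → U} {x y : U} (h : IsGeodesic γ x y) {s t : ℝ}
    (hs : s ∈ Icc 0 (dist x y)) (ht : t ∈ Icc 0 (dist x y)) : dist (γ s) (γ t) = |s - t| := by
  rcases le_total s t with hst | hst
  · rw [h.dist_eq s t hs.1 hst ht.2, abs_sub_comm, abs_of_nonneg (by linarith)]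
  · rw [dist_comm, h.dist_eq t s ht.1 hst hs.2, abs_of_nonneg (by linarith)]

theorem IsGeodesic.dist_left {γ : ℝ → U} {x y : U} (h : IsGeodesic γ x y) {t : ℝ}
    (h0 : 0 ≤ t) (h1 : t ≤ dist x y) : dist x (γ t) = t := by
  have := h.dist_eq 0 t le_rfl h0 h1
  rwa [h.left, sub_zero] at this

theorem IsGeodesic.dist_right {γ : ℝ → U} {x y : U} (h : IsGeodesic γ x y) {t : ℝ}
    (h0 : 0 ≤ t) (h1 : t ≤ dist x y) : dist (γ t) y = dist x y - t := by
  have := h.dist_eq t _ h0 h1 le_rfl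
  rwa [h.right] at this

theorem IsGeodesic.continuousOn {γ : ℝ → U} {x y : U} (h : IsGeodesic γ x y) :
    ContinuousOn γ (Icc 0 (dist x y)) := by
  have : LipschitzOnWith 1 γ (Icc 0 (dist x y)) :=
    LipschitzOnWith.of_dist_le_mul fun s hs t ht => by
      rw [h.dist_eq_abs hs ht, Real.dist_eq]; simp
  exact this.continuousOn

end Geodesics

/-! ### Harmonic chains and their dependence on endpoints -/

/-- Every inner vertex of the chain `c 0, …, c N` is a midpoint of its two neighbours. -/
def IsHarmonic {U : Type*} [MetricSpace U] (N : ℕ) (c : ℕ → U) : Prop :=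
  ∀ i, i + 2 ≤ N → IsMid (c i) (c (i + 2)) (c (i + 1))

/-- Constants for which midpoints near a ball contract well enough that harmonic chains of `N` edges
and of length at most `L` depend uniquely and continuously on their endpoints. -/
structure ChainScale (U : Type*) [MetricSpace U] where
  o : U
  R : ℝ
  N : ℕ
  L : ℝ
  ρ : ℝ
  k : ℝ
  M : ℝ
  f : ℕ → ℝ
  two_le : 2 ≤ N
  L_nonneg : 0 ≤ L
  ρ_pos : 0 < ρ
  k_pos : 0 < k
  M_pos : 0 < M
  f_le : ∀ i ≤ N, f i ≤ 1
  le_f : ∀ i ≤ N, 1 ≤ M * f i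
  f_lt : ∀ i, i + 2 ≤ N → f i + f (i + 2) < k * f (i + 1)
  contract : ∀ a b b' m m', dist o a ≤ R → dist a b ≤ 2 * (L / N) + 2 * ρ →
    dist a b' ≤ 2 * (L / N) + 2 * ρ → dist b b' ≤ ρ → IsMid a b m → IsMid a b' m' →
    k * dist m m' ≤ dist b b'

section Chains

variable {U : Type*} [MetricSpace U]

theorem IsHarmonic.edge {N : ℕ} {c : ℕ → U} (h : IsHarmonic N c) {i : ℕ} (hi : i + 1 ≤ N) :
    dist (c i) (c (i + 1)) = dist (c 0) (c 1) := by
  induction i with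
  | zero => rfl
  | succ i ih => rw [← ih (by omega), (h i (by omega)).1, (h i (by omega)).2]

theorem IsHarmonic.dist_two {N : ℕ} {c : ℕ → U} (h : IsHarmonic N c) {i : ℕ} (hi : i + 2 ≤ N) :
    dist (c i) (c (i + 2)) = 2 * dist (c 0) (c 1) := by
  rw [← h.edge (i := i) (by omega), (h i hi).1]; ring

theorem IsHarmonic.dist_zero_le {N : ℕ} {c : ℕ → U} (h : IsHarmonic N c) {i : ℕ} (hi : i ≤ N) :
    dist (c 0) (c i) ≤ N * dist (c 0) (c 1) := by
  have : dist (c 0) (c i) ≤ i * dist (c 0) (c 1) := by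
    induction i with
    | zero => simp
    | succ i ih =>
      have h1 := ih (by omega)
      have h2 := dist_triangle (c 0) (c i) (c (i + 1))
      rw [h.edge hi] at h2
      push_cast; linarith
  exact this.trans (by gcongr)

theorem isHarmonic_const (N : ℕ) (x : U) : IsHarmonic N (fun _ => x) := fun _ _ => by
  simp [IsMid]

namespace ChainScale

variable (S : ChainScale U)

theorem N_pos : (0 : ℝ) < S.N := by exact_mod_cast (show 0 < S.N by have := S.two_le; omega)

theorem f_pos {i : ℕ} (hi : i ≤ S.N) : 0 < S.f i :=
  pos_of_mul_pos_right (by linarith [S.le_f i hi]) S.M_pos.le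

theorem one_le_M : 1 ≤ S.M := by
  have h1 := S.le_f 0 (Nat.zero_le _)
  have h2 := S.f_le 0 (Nat.zero_le _)
  nlinarith [S.M_pos]

theorem edge_le {c : ℕ → U} (h : S.N * dist (c 0) (c 1) ≤ S.L) : dist (c 0) (c 1) ≤ S.L / S.N := by
  rw [le_div_iff₀ S.N_pos]; linarith

/-- The midpoint of the diagonal from `a` to `b'` is compared with both midpoints; each comparison
moves only one endpoint. -/
theorem contract_mid (hB : HasBetween U) {a b a' b' m m' : U} (ha : dist S.o a ≤ S.R)
    (hb' : dist S.o b' ≤ S.R) (hab : dist a b ≤ 2 * (S.L / S.N) + 2 * S.ρ)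
    (hab' : dist a b' ≤ 2 * (S.L / S.N) + 2 * S.ρ)
    (hab'' : dist a' b' ≤ 2 * (S.L / S.N) + 2 * S.ρ)
    (h1 : dist a a' ≤ S.ρ) (h2 : dist b b' ≤ S.ρ) (hm : IsMid a b m) (hm' : IsMid a' b' m') :
    S.k * dist m m' ≤ dist a a' + dist b b' := by
  obtain ⟨n, hn⟩ := hB.exists_mid a b'
  have e1 := S.contract a b b' m n ha hab hab' h2 hm hn
  have e2 := S.contract b' a a' n m' hb' (by rwa [dist_comm]) (by rwa [dist_comm]) h1 hn.symm hm'.symm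
  have := dist_triangle m n m'
  nlinarith [S.k_pos]

/-- Maximum principle: let `τ` be the largest ratio `dist (u i) (w i) / f i`. At an inner index the
contraction of midpoints bounds `k * τ * f (i + 1)` by `τ * (f i + f (i + 2))`, which is smaller by
`f_lt` when `τ > 0`. So a ratio above `σ` could only be attained at an end, where it is excluded. -/
theorem dist_le_of_ends (hB : HasBetween U) {u w : ℕ → U} (hu : IsHarmonic S.N u)
    (hw : IsHarmonic S.N w) (hul : S.N * dist (u 0) (u 1) ≤ S.L)
    (hwl : S.N * dist (w 0) (w 1) ≤ S.L) (huR : ∀ i ≤ S.N, dist S.o (u i) ≤ S.R)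
    (hwR : ∀ i ≤ S.N, dist S.o (w i) ≤ S.R) (hd : ∀ i ≤ S.N, dist (u i) (w i) ≤ S.ρ)
    {σ : ℝ} (hσ : 0 ≤ σ) (h0 : dist (u 0) (w 0) ≤ σ * S.f 0)
    (hN : dist (u S.N) (w S.N) ≤ σ * S.f S.N) : ∀ i ≤ S.N, dist (u i) (w i) ≤ σ * S.f i := by
  obtain ⟨j, hj, hmax⟩ := Finset.exists_max_image (Finset.range (S.N + 1))
    (fun i => dist (u i) (w i) / S.f i) ⟨0, by simp⟩
  have hj : j ≤ S.N := by simpa [Nat.lt_succ_iff] using hj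
  have hmax : ∀ i ≤ S.N, dist (u i) (w i) / S.f i ≤ dist (u j) (w j) / S.f j := fun i hi =>
    hmax i (by simpa [Nat.lt_succ_iff] using hi)
  set τ := dist (u j) (w j) / S.f j with hτ
  have hle : ∀ i ≤ S.N, dist (u i) (w i) ≤ τ * S.f i := fun i hi =>
    (div_le_iff₀ (S.f_pos hi)).1 (hmax i hi)
  suffices τ ≤ σ from fun i hi => (hle i hi).trans (by have := S.f_pos hi; gcongr)
  by_contra! hlt
  have hτj : dist (u j) (w j) = τ * S.f j := by rw [hτ, div_mul_cancel₀ _ (S.f_pos hj).ne']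
  rcases Nat.eq_zero_or_pos j with hj0 | hj0
  · subst hj0
    have := S.f_pos hj
    nlinarith
  rcases hj.eq_or_lt with hjN | hjN
  · rw [hjN] at hτj
    have := S.f_pos (le_refl S.N)
    nlinarith
  obtain ⟨i, rfl⟩ : ∃ i, j = i + 1 := ⟨j - 1, by omega⟩
  have hρ := S.ρ_pos
  have e1 := S.edge_le hul
  have e2 := S.edge_le hwl
  have a1 := hu.dist_two (i := i) (by omega)
  have a2 := hw.dist_two (i := i) (by omega)
  have key := S.contract_mid hB (huR i (by omega)) (hwR (i + 2) (by omega)) (by linarith)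
    (by linarith [dist_triangle (u i) (u (i + 2)) (w (i + 2)), hd (i + 2) (by omega)]) (by linarith)
    (hd i (by omega)) (hd (i + 2) (by omega)) (hu i (by omega)) (hw i (by omega))
  have b1 := hle i (by omega)
  have b2 := hle (i + 2) (by omega)
  have b3 := S.f_lt i (by omega)
  rw [hτj] at key
  nlinarith

theorem eq_of_ends (hB : HasBetween U) {u w : ℕ → U} (hu : IsHarmonic S.N u)
    (hw : IsHarmonic S.N w) (hul : S.N * dist (u 0) (u 1) ≤ S.L)
    (hwl : S.N * dist (w 0) (w 1) ≤ S.L) (huR : ∀ i ≤ S.N, dist S.o (u i) ≤ S.R)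
    (hwR : ∀ i ≤ S.N, dist S.o (w i) ≤ S.R) (hd : ∀ i ≤ S.N, dist (u i) (w i) ≤ S.ρ)
    (h0 : u 0 = w 0) (hN : u S.N = w S.N) : ∀ i ≤ S.N, u i = w i := fun i hi => by
  have := S.dist_le_of_ends hB hu hw hul hwl huR hwR hd le_rfl (by simp [h0]) (by simp [hN]) i hi
  rw [zero_mul] at this
  exact dist_le_zero.1 this

end ChainScale

/-- Twice the defect is `(a - b) ^ 2 + (a + b - D) * (a + b + D)`, which vanishes only if both steps
are half of `D`. Hence minimizers of the energy have midpoints as inner vertices. -/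
theorem two_steps_sq_lt {a b D : ℝ} (h : D ≤ a + b) (hD : 0 ≤ D) (hne : ¬ (a = D / 2 ∧ b = D / 2)) :
    (D / 2) ^ 2 + (D / 2) ^ 2 < a ^ 2 + b ^ 2 := by
  by_contra! hle
  have h1 : (a - b) ^ 2 + (a + b - D) * (a + b + D) ≤ 0 := by nlinarith
  have h2 : 0 ≤ (a + b - D) * (a + b + D) := by apply mul_nonneg <;> linarith
  have h3 : a - b = 0 := by
    have : (a - b) ^ 2 = 0 := le_antisymm (by linarith) (sq_nonneg _)
    exact pow_eq_zero_iff two_ne_zero |>.1 this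
  apply hne
  have h4 : a = b := by linarith
  subst h4
  have h5 : (a + a - D) * (a + a + D) ≤ 0 := by nlinarith
  have h6 : a + a - D ≤ 0 := by
    by_contra! h7
    nlinarith
  constructor <;> linarith

/-- The discrete energy of a chain. -/
noncomputable def chainEnergy (N : ℕ) (c : ℕ → U) : ℝ :=
  ∑ i ∈ Finset.range N, dist (c i) (c (i + 1)) ^ 2

theorem continuous_chainEnergy (N : ℕ) : Continuous (chainEnergy N : (ℕ → U) → ℝ) := by
  unfold chainEnergy
  fun_prop

theorem IsHarmonic.chainEnergy_eq {N : ℕ} {c : ℕ → U} (h : IsHarmonic N c) :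
    chainEnergy N c = N * dist (c 0) (c 1) ^ 2 := by
  rw [chainEnergy, Finset.sum_congr rfl (g := fun _ => dist (c 0) (c 1) ^ 2)]
  · simp
  · intro i hi
    rw [h.edge (by simpa using hi)]

theorem chainEnergy_update_lt {N : ℕ} {c : ℕ → U} {i : ℕ} (hi : i + 2 ≤ N) {m : U}
    (hm : IsMid (c i) (c (i + 2)) m) (hne : ¬ IsMid (c i) (c (i + 2)) (c (i + 1))) :
    chainEnergy N (Function.update c (i + 1) m) < chainEnergy N c := by
  set c' := Function.update c (i + 1) m with hc'
  have h1 : i ∈ Finset.range N := by simp; omega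
  have h2 : i + 1 ∈ (Finset.range N).erase i := by simp; omega
  unfold chainEnergy
  rw [← Finset.add_sum_erase _ _ h1, ← Finset.add_sum_erase _ _ h2,
    ← Finset.add_sum_erase (Finset.range N) _ h1, ← Finset.add_sum_erase ((Finset.range N).erase i) _ h2]
  have hrest : ∑ x ∈ ((Finset.range N).erase i).erase (i + 1), dist (c' x) (c' (x + 1)) ^ 2 =
      ∑ x ∈ ((Finset.range N).erase i).erase (i + 1), dist (c x) (c (x + 1)) ^ 2 := by
    refine Finset.sum_congr rfl fun j hj => ?_
    simp only [Finset.mem_erase] at hj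
    rw [hc', Function.update_of_ne hj.1, Function.update_of_ne (by omega)]
  have e1 : c' i = c i := by rw [hc', Function.update_of_ne (by omega)]
  have e2 : c' (i + 1) = m := by rw [hc', Function.update_self]
  have e3 : c' (i + 1 + 1) = c (i + 2) := by rw [hc', Function.update_of_ne (by omega)]
  rw [hrest, e1, e2, e3, hm.1, hm.2]
  have := two_steps_sq_lt (dist_triangle (c i) (c (i + 1)) (c (i + 2))) dist_nonneg hne
  simp only [show i + 1 + 1 = i + 2 by ring]
  linarith

namespace ChainScale

variable (S : ChainScale U)

/-- The new chain minimizes energy among chains with the prescribed ends whose inner vertices lie in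
balls about `v i` with radii proportional to `f i`. By the strict inequality for the weights, the
midpoint of two admissible neighbours is again admissible, so the constraint is harmless and the
minimizer is harmonic. -/
theorem exists_harmonic [ProperSpace U] (hB : HasBetween U) {v : ℕ → U} (hv : IsHarmonic S.N v)
    (hvl : S.N * dist (v 0) (v 1) ≤ S.L) (hvR : ∀ i ≤ S.N, dist S.o (v i) + S.ρ ≤ S.R)
    {y : U} (hy : S.M * dist (v S.N) y ≤ S.ρ) :
    ∃ u, IsHarmonic S.N u ∧ u 0 = v 0 ∧ u S.N = y ∧
      (∀ i ≤ S.N, dist (u i) (v i) ≤ S.M * dist (v S.N) y) ∧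
      (S.N * dist (u 0) (u 1)) ^ 2 ≤ (S.N * dist (v 0) (v 1)) ^ 2 +
        2 * (S.N * dist (v 0) (v 1)) * dist (v S.N) y + S.N * dist (v S.N) y ^ 2 := by
  classical
  have hN := S.two_le
  set d := dist (v S.N) y with hd
  set σ := S.M * d with hσ
  have hd0 : 0 ≤ d := dist_nonneg
  have hσ0 : 0 ≤ σ := mul_nonneg S.M_pos.le hd0
  have hσf : ∀ i ≤ S.N, 0 ≤ σ * S.f i := fun i hi => mul_nonneg hσ0 (S.f_pos hi).le
  have hσf' : ∀ i ≤ S.N, σ * S.f i ≤ S.ρ := fun i hi => by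
    have := S.f_le i hi
    nlinarith
  -- Chains are indexed by all of `ℕ`; fixing the vertices beyond `N` keeps the product compact.
  set T : ℕ → Set U := fun i => if i = 0 then {v 0} else if i = S.N then {y} else
    if i < S.N then Metric.closedBall (v i) (σ * S.f i) else {v i} with hT
  have hTc : IsCompact (Set.pi univ T) := by
    refine isCompact_univ_pi fun i => ?_
    simp only [hT]
    split_ifs
    · exact isCompact_singleton
    · exact isCompact_singleton
    · exact isCompact_closedBall _ _
    · exact isCompact_singleton
  set v' := Function.update v S.N y with hv'
  have hv'T : v' ∈ Set.pi univ T := by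
    intro i _
    simp only [hT]
    split_ifs with h1 h2 h3
    · subst h1; rw [hv', Function.update_of_ne (by omega)]; rfl
    · subst h2; simp [hv']
    · rw [hv', Function.update_of_ne h2]; exact Metric.mem_closedBall_self (hσf i h3.le)
    · rw [hv', Function.update_of_ne h2]; rfl
  obtain ⟨u, huT, humin⟩ := hTc.exists_isMinOn ⟨v', hv'T⟩ (continuous_chainEnergy S.N).continuousOn
  have hu0 : u 0 = v 0 := by simpa [hT] using huT 0 (mem_univ _)
  have huN : u S.N = y := by simpa [hT, show S.N ≠ 0 by omega] using huT S.N (mem_univ _)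
  have hud : ∀ i ≤ S.N, dist (u i) (v i) ≤ σ * S.f i := by
    intro i hi
    rcases Nat.eq_zero_or_pos i with h | h
    · subst h; rw [hu0, dist_self]; exact hσf 0 hi
    rcases hi.eq_or_lt with h' | h'
    · rw [h', huN, dist_comm, ← hd]
      have := S.le_f S.N le_rfl
      rw [hσ]; nlinarith
    · have := huT i (mem_univ _)
      simpa [hT, h.ne', h'.ne, h'] using this
  have hharm : IsHarmonic S.N u := by
    intro i hi
    by_contra hne
    obtain ⟨m, hm⟩ := hB.exists_mid (u i) (u (i + 2))
    have hlt := chainEnergy_update_lt hi hm hne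
    refine absurd (humin (a := Function.update u (i + 1) m) ?_) (not_le.2 hlt)
    intro j _
    by_cases hj : j = i + 1
    · subst hj
      simp only [hT, Function.update_self]
      rw [if_neg (by omega), if_neg (by omega), if_pos (by omega), Metric.mem_closedBall]
      have c0 := hud i (by omega)
      have c2 := hud (i + 2) (by omega)
      have r0 := hσf' i (by omega)
      have r2 := hσf' (i + 2) (by omega)
      have e1 := S.edge_le hvl
      have a1 := hv.dist_two hi
      have t1 := dist_triangle4 (u i) (v i) (v (i + 2)) (u (i + 2))
      have t2 := dist_triangle (u i) (v i) (v (i + 2))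
      have t3 := dist_triangle_left S.o (u i) (v i)
      rw [dist_comm (v (i + 2)) (u (i + 2))] at t1
      have hρ := S.ρ_pos
      have key := S.contract_mid hB (a := u i) (b := u (i + 2)) (a' := v i) (b' := v (i + 2))
        (m := m) (m' := v (i + 1))
        (by linarith [dist_triangle S.o (v i) (u i), hvR i (by omega), dist_comm (u i) (v i)])
        (by linarith [hvR (i + 2) hi])
        (by linarith) (by linarith) (by linarith)
        (by linarith) (by linarith) hm (hv i hi)
      have f3 := S.f_lt i hi
      have hk := S.k_pos
      have : S.k * dist m (v (i + 1)) ≤ S.k * (σ * S.f (i + 1)) := by nlinarith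
      exact le_of_mul_le_mul_left this hk
    · rw [Function.update_of_ne hj]
      exact huT j (mem_univ _)
  refine ⟨u, hharm, hu0, huN, fun i hi => (hud i hi).trans ?_, ?_⟩
  · have := S.f_le i hi
    nlinarith
  -- The length bound comes from the competitor `v'`, in which only the last vertex of `v` is moved
  -- and so only the last edge gets longer.
  · have hE : chainEnergy S.N u ≤ chainEnergy S.N v' := humin hv'T
    rw [hharm.chainEnergy_eq] at hE
    obtain ⟨n, hn⟩ : ∃ n, S.N = n + 1 := ⟨S.N - 1, by omega⟩
    have hE' : chainEnergy S.N v' ≤ n * dist (v 0) (v 1) ^ 2 + (dist (v 0) (v 1) + d) ^ 2 := by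
      rw [chainEnergy, hn, Finset.sum_range_succ]
      gcongr
      · rw [Finset.sum_congr rfl (g := fun _ => dist (v 0) (v 1) ^ 2)]
        · simp
        · intro i hi
          have hi : i < n := by simpa using hi
          rw [hv', Function.update_of_ne (by omega), Function.update_of_ne (by omega),
            hv.edge (by omega)]
      · have e1 : v' n = v n := by rw [hv', Function.update_of_ne (by omega)]
        have e2 : v' (n + 1) = y := by rw [hv', ← hn, Function.update_self]
        rw [e1, e2, ← hv.edge (i := n) (by omega), hd, hn]
        exact dist_triangle _ _ _
    have hNn : (S.N : ℝ) = n + 1 := by rw [hn]; push_cast; ring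
    have hNp := S.N_pos
    calc (S.N * dist (u 0) (u 1)) ^ 2 = S.N * (S.N * dist (u 0) (u 1) ^ 2) := by ring
      _ ≤ S.N * (n * dist (v 0) (v 1) ^ 2 + (dist (v 0) (v 1) + d) ^ 2) := by
        gcongr; exact hE.trans hE'
      _ = _ := by rw [hNn]; ring

/-- Harmonic chains `c j` from `p 0` to `p j`, `j ≤ n`, that start with a constant chain and move
little from each `j` to the next. -/
structure IsLift (p : ℕ → U) (n : ℕ) (c : ℕ → ℕ → U) : Prop where
  zero : ∀ i ≤ S.N, c 0 i = p 0
  harm : ∀ j ≤ n, IsHarmonic S.N (c j)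
  left : ∀ j ≤ n, c j 0 = p 0
  right : ∀ j ≤ n, c j S.N = p j
  len : ∀ j ≤ n, S.N * dist (c j 0) (c j 1) ≤ S.L
  step : ∀ j < n, ∀ i ≤ S.N, dist (c j i) (c (j + 1) i) ≤ S.ρ / 4

variable {S}

theorem IsLift.mono {p : ℕ → U} {n n' : ℕ} {c : ℕ → ℕ → U} (h : S.IsLift p n c) (hn : n' ≤ n) :
    S.IsLift p n' c :=
  ⟨h.zero, fun j hj => h.harm j (hj.trans hn), fun j hj => h.left j (hj.trans hn),
    fun j hj => h.right j (hj.trans hn), fun j hj => h.len j (hj.trans hn),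
    fun j hj => h.step j (hj.trans_le hn)⟩

theorem IsLift.dist_center_le {p : ℕ → U} {n : ℕ} {c : ℕ → ℕ → U} (h : S.IsLift p n c) {r : ℝ}
    (hp : dist S.o (p 0) + S.L + r ≤ S.R) {j i : ℕ} (hj : j ≤ n) (hi : i ≤ S.N) :
    dist S.o (c j i) + r ≤ S.R := by
  have h1 := (h.harm j hj).dist_zero_le hi
  have h2 := h.len j hj
  have h3 := dist_triangle S.o (c j 0) (c j i)
  have h4 := h.left j hj
  rw [h4] at h3 h1 h2
  linarith

/-- The chain is extended one polygon vertex at a time by `exists_harmonic`. Each step adds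
essentially the edge length to the chain length; the quadratic error is absorbed by `η` and `τ`
because the edges are short compared with `1 / N`. -/
theorem exists_isLift [ProperSpace U] (hB : HasBetween U) {p : ℕ → U} {n : ℕ} {η τ d₀ : ℝ}
    (hη : 0 < η) (hτ : 0 < τ) (hd1 : S.M * d₀ ≤ S.ρ / 4) (hd2 : S.N * d₀ ≤ 2 * η * τ)
    (hstep : ∀ j < n, dist (p j) (p (j + 1)) ≤ d₀)
    (hlen : η + (1 + τ) * ∑ j ∈ Finset.range n, dist (p j) (p (j + 1)) ≤ S.L)
    (hp : dist S.o (p 0) + S.L + S.ρ ≤ S.R) : ∃ c, S.IsLift p n c ∧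
      S.N * dist (c n 0) (c n 1) ≤ η + (1 + τ) * ∑ j ∈ Finset.range n, dist (p j) (p (j + 1)) := by
  classical
  induction n with
  | zero =>
    refine ⟨fun _ _ => p 0, ⟨fun _ _ => rfl, fun _ _ => isHarmonic_const _ _, fun _ _ => rfl, ?_, ?_,
      ?_⟩, ?_⟩
    · intro j hj
      rw [Nat.le_zero.1 hj]
    · intro j hj
      simpa using S.L_nonneg
    · intro j hj
      omega
    · simpa using hη.le
  | succ n ih =>
    set d := dist (p n) (p (n + 1)) with hd
    have hd0 : 0 ≤ d := dist_nonneg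
    have hdd : d ≤ d₀ := hstep n (by omega)
    rw [Finset.sum_range_succ, ← hd] at hlen ⊢
    set s := ∑ j ∈ Finset.range n, dist (p j) (p (j + 1)) with hs
    have hs0 : 0 ≤ s := Finset.sum_nonneg fun _ _ => dist_nonneg
    obtain ⟨c, hc, hcl⟩ := ih (fun j hj => hstep j (by omega)) (by nlinarith)
    have hM := S.M_pos
    have hMd : S.M * d ≤ S.ρ / 4 := le_trans (by gcongr) hd1
    obtain ⟨u, hu, hu0, huN, hud, hul⟩ := S.exists_harmonic hB (hc.harm n le_rfl) (hc.len n le_rfl)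
      (fun i hi => hc.dist_center_le hp le_rfl hi) (y := p (n + 1))
      (by rw [hc.right n le_rfl]; linarith [S.ρ_pos])
    rw [hc.right n le_rfl, ← hd] at hud hul
    have hlu : S.N * dist (u 0) (u 1) ≤ η + (1 + τ) * (s + d) := by
      have hN := S.N_pos
      set ℓ := S.N * dist (c n 0) (c n 1) with hℓ
      have hℓ0 : 0 ≤ ℓ := by positivity
      refine abs_le_of_sq_le_sq' ?_ (by positivity) |>.2
      -- The error `N * d ^ 2` is at most `2 * η * τ * d`, hence at most `2 * B * τ * d`. This is
      -- what the initial allowance `η` is for: the chain itself starts with length zero, but `B` is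
      -- at least `η`.
      have hb : S.N * d ^ 2 ≤ 2 * η * τ * d := by
        nlinarith [mul_le_mul_of_nonneg_left hdd hN.le]
      set B := η + (1 + τ) * s with hBdef
      have hBη : η ≤ B := by rw [hBdef]; nlinarith
      have e : η + (1 + τ) * (s + d) = B + (1 + τ) * d := by rw [hBdef]; ring
      rw [e]
      have g1 : ℓ ^ 2 ≤ B ^ 2 := by gcongr
      have g2 : 2 * ℓ * d ≤ 2 * B * d := by gcongr
      have g3 : 2 * η * τ * d ≤ 2 * B * τ * d := by gcongr
      have g4 : 0 ≤ ((1 + τ) * d) ^ 2 := sq_nonneg _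
      nlinarith
    refine ⟨Function.update c (n + 1) u, ⟨?_, ?_, ?_, ?_, ?_, ?_⟩, ?_⟩
    · intro i hi
      rw [Function.update_of_ne (by omega)]; exact hc.zero i hi
    · intro j hj
      rcases hj.eq_or_lt with h | h
      · rw [h, Function.update_self]; exact hu
      · rw [Function.update_of_ne (by omega)]; exact hc.harm j (by omega)
    · intro j hj
      rcases hj.eq_or_lt with h | h
      · rw [h, Function.update_self, hu0]; exact hc.left n le_rfl
      · rw [Function.update_of_ne (by omega)]; exact hc.left j (by omega)
    · intro j hj
      rcases hj.eq_or_lt with h | h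
      · rw [h, Function.update_self]; exact huN
      · rw [Function.update_of_ne (by omega)]; exact hc.right j (by omega)
    · intro j hj
      rcases hj.eq_or_lt with h | h
      · rw [h, Function.update_self]; exact hlu.trans hlen
      · rw [Function.update_of_ne (by omega)]; exact hc.len j (by omega)
    · intro j hj i hi
      rcases (Nat.lt_succ_iff.1 hj).eq_or_lt with h | h
      · rw [h, Function.update_self, Function.update_of_ne (by omega), dist_comm]
        exact (hud i hi).trans hMd
      · rw [Function.update_of_ne (by omega), Function.update_of_ne (by omega)]
        exact hc.step j h i hi
    · rw [Function.update_self]; exact hlu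

/-- One step of both lifts enlarges their distance from at most `ρ / 2` to at most `ρ`, and the
maximum principle brings it back to `M * ε`. The error therefore does not accumulate. -/
theorem IsLift.dist_le (hB : HasBetween U) {p p' : ℕ → U} {n : ℕ} {c c' : ℕ → ℕ → U}
    (h : S.IsLift p n c) (h' : S.IsLift p' n c') (hp : dist S.o (p 0) + S.L ≤ S.R)
    (hp' : dist S.o (p' 0) + S.L ≤ S.R) {ε : ℝ} (hε : S.M * ε ≤ S.ρ / 2)
    (hpp : ∀ j ≤ n, dist (p j) (p' j) ≤ ε) :
    ∀ j ≤ n, ∀ i ≤ S.N, dist (c j i) (c' j i) ≤ S.M * ε := by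
  have hε0 : 0 ≤ ε := dist_nonneg.trans (hpp 0 (Nat.zero_le _))
  have hM := S.M_pos
  intro j
  induction j with
  | zero =>
    intro _ i hi
    rw [h.zero i hi, h'.zero i hi]
    have := hpp 0 (Nat.zero_le _)
    nlinarith [S.one_le_M]
  | succ j ih =>
    intro hj i hi
    have hσ : 0 ≤ S.M * ε := by positivity
    have hend : ∀ i ≤ S.N, ε ≤ S.M * ε * S.f i := fun i hi => by
      have := S.le_f i hi
      nlinarith
    refine (S.dist_le_of_ends hB (h.harm _ hj) (h'.harm _ hj) (h.len _ hj) (h'.len _ hj)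
      (fun i hi => by simpa using h.dist_center_le (r := 0) (by simpa using hp) hj hi)
      (fun i hi => by simpa using h'.dist_center_le (r := 0) (by simpa using hp') hj hi) ?_ hσ ?_ ?_
      i hi).trans ?_
    · intro i hi
      have h1 := h.step j hj i hi
      have h2 := h'.step j hj i hi
      have h3 := ih (by omega) i hi
      have h4 := dist_triangle4 (c (j + 1) i) (c j i) (c' j i) (c' (j + 1) i)
      rw [dist_comm (c (j + 1) i) (c j i)] at h4
      linarith
    · rw [h.left _ hj, h'.left _ hj]
      exact (hpp 0 (Nat.zero_le _)).trans (hend 0 (Nat.zero_le _))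
    · rw [h.right _ hj, h'.right _ hj]
      exact (hpp _ hj).trans (hend _ le_rfl)
    · have := S.f_le i hi
      nlinarith

end ChainScale

end Chains

/-! ### Lifting closed polygons from both ends -/

section Bigons

variable {U : Type*} [MetricSpace U]

theorem sum_add_sum_reverse (p : ℕ → U) {m j : ℕ} (hj : j ≤ m) :
    ∑ i ∈ Finset.range (m - j), dist (p i) (p (i + 1)) +
      ∑ i ∈ Finset.range j, dist (p (m - i)) (p (m - (i + 1))) =
      ∑ i ∈ Finset.range m, dist (p i) (p (i + 1)) := by
  induction j with
  | zero => simp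
  | succ j ih =>
    rw [← ih (by omega), show m - j = m - (j + 1) + 1 by omega, Finset.sum_range_succ,
      Finset.sum_range_succ, show m - j = m - (j + 1) + 1 by omega, dist_comm (p (m - (j + 1) + 1))]
    ring

theorem exists_split {g : ℕ → ℝ} {m : ℕ} {a : ℝ} (h0 : g 0 ≤ a) :
    ∃ k ≤ m, g k ≤ a ∧ (k = m ∨ k < m ∧ a < g (k + 1)) := by
  induction m with
  | zero => exact ⟨0, le_rfl, h0, Or.inl rfl⟩
  | succ m ih =>
    obtain ⟨k, hk, hka, h | h⟩ := ih
    · by_cases hc : g (k + 1) ≤ a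
      · exact ⟨k + 1, by omega, hc, Or.inl (by omega)⟩
      · exact ⟨k, by omega, hka, Or.inr ⟨by omega, not_le.1 hc⟩⟩
    · exact ⟨k, by omega, hka, Or.inr ⟨by omega, h.2⟩⟩

namespace ChainScale

variable {S : ChainScale U}

/-- The forward and the backward lifts along the closed polygon `p 0, …, p m` agree wherever both of
them exist. -/
def Agree (S : ChainScale U) (p : ℕ → U) (m : ℕ) : Prop :=
  ∀ k ≤ m, ∀ c b, S.IsLift p k c → S.IsLift (fun j => p (m - j)) (m - k) b →
    ∀ i ≤ S.N, c k i = b (m - k) i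

theorem IsLift.eq (hB : HasBetween U) {p : ℕ → U} {n : ℕ} {c c' : ℕ → ℕ → U}
    (h : S.IsLift p n c) (h' : S.IsLift p n c') (hp : dist S.o (p 0) + S.L ≤ S.R) :
    ∀ j ≤ n, ∀ i ≤ S.N, c j i = c' j i := fun j hj i hi => by
  have := h.dist_le hB h' hp hp (ε := 0) (by linarith [S.ρ_pos]) (by simp) j hj i hi
  rw [mul_zero] at this
  exact dist_le_zero.1 this

/-- When the meeting vertex moves by one, each lift moves by at most `ρ / 4`. Agreement at one
vertex thus leaves the chains at the other one `ρ`-close with common ends, and such chains are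
equal. -/
theorem IsLift.agree_succ_iff (hB : HasBetween U) {p : ℕ → U} {m k : ℕ} {c b : ℕ → ℕ → U}
    (hk : k + 1 ≤ m) (hc : S.IsLift p (k + 1) c) (hb : S.IsLift (fun j => p (m - j)) (m - k) b)
    (hpm : p m = p 0) (hp : dist S.o (p 0) + S.L ≤ S.R) :
    (∀ i ≤ S.N, c k i = b (m - k) i) ↔ ∀ i ≤ S.N, c (k + 1) i = b (m - (k + 1)) i := by
  have hp' : dist S.o (p (m - 0)) + S.L ≤ S.R := by simpa [hpm] using hp
  have e : m - k = m - (k + 1) + 1 := by omega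
  have hρ := S.ρ_pos
  have hcR : ∀ j ≤ k + 1, ∀ i ≤ S.N, dist S.o (c j i) ≤ S.R := fun j hj i hi => by
    simpa using hc.dist_center_le (r := 0) (by simpa using hp) hj hi
  have hbR : ∀ j ≤ m - k, ∀ i ≤ S.N, dist S.o (b j i) ≤ S.R := fun j hj i hi => by
    simpa using hb.dist_center_le (r := 0) (by simpa using hp') hj hi
  have s1 := hc.step k (by omega)
  have s2 := hb.step (m - (k + 1)) (by omega)
  rw [← e] at s2
  constructor
  · intro h
    refine S.eq_of_ends hB (hc.harm _ le_rfl) (hb.harm _ (by omega)) (hc.len _ le_rfl)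
      (hb.len _ (by omega)) (hcR _ le_rfl) (hbR _ (by omega)) ?_ ?_ ?_
    · intro i hi
      have t := dist_triangle (c (k + 1) i) (c k i) (b (m - (k + 1)) i)
      have a1 := s1 i hi
      have a2 := s2 i hi
      rw [dist_comm] at a1
      rw [← h i hi, dist_comm] at a2
      linarith
    · rw [hc.left _ le_rfl, hb.left _ (by omega)]; simp [hpm]
    · rw [hc.right _ le_rfl, hb.right _ (by omega)]
      congr 1; omega
  · intro h
    refine S.eq_of_ends hB (hc.harm _ (by omega)) (hb.harm _ le_rfl) (hc.len _ (by omega))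
      (hb.len _ le_rfl) (hcR _ (by omega)) (hbR _ le_rfl) ?_ ?_ ?_
    · intro i hi
      have t := dist_triangle (c k i) (c (k + 1) i) (b (m - k) i)
      have := s1 i hi
      have := s2 i hi
      rw [h i hi] at *
      linarith
    · rw [hc.left _ (by omega), hb.left _ le_rfl]; simp [hpm]
    · rw [hc.right _ (by omega), hb.right _ le_rfl]
      congr 1; omega

theorem IsLift.agree_iff (hB : HasBetween U) {p : ℕ → U} {m k k' : ℕ} {c b : ℕ → ℕ → U}
    (hkk : k ≤ k') (hk : k' ≤ m) (hc : S.IsLift p k' c)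
    (hb : S.IsLift (fun j => p (m - j)) (m - k) b)
    (hpm : p m = p 0) (hp : dist S.o (p 0) + S.L ≤ S.R) :
    (∀ i ≤ S.N, c k i = b (m - k) i) ↔ ∀ i ≤ S.N, c k' i = b (m - k') i := by
  induction k', hkk using Nat.le_induction with
  | base => rfl
  | succ n hn ih =>
    rw [ih (by omega) (hc.mono (by omega))]
    exact agree_succ_iff hB hk hc (hb.mono (by omega)) hpm hp

/-- Lifts are unique and agreement is independent of the meeting vertex, so one matching pair
decides for all of them. -/
theorem agree_of_exists (hB : HasBetween U) {p : ℕ → U} {m k : ℕ} {c b : ℕ → ℕ → U} (hk : k ≤ m)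
    (hc : S.IsLift p k c) (hb : S.IsLift (fun j => p (m - j)) (m - k) b)
    (hpm : p m = p 0) (hp : dist S.o (p 0) + S.L ≤ S.R) (h : ∀ i ≤ S.N, c k i = b (m - k) i) :
    S.Agree p m := by
  intro k' hk' c' b' hc' hb'
  have hp' : dist S.o (p (m - 0)) + S.L ≤ S.R := by simpa [hpm] using hp
  rcases le_total k k' with hkk | hkk
  · have h1 := (IsLift.agree_iff hB hkk hk' hc' hb hpm hp).1 fun i hi => by
      rw [← h i hi, (hc'.mono hkk).eq hB hc hp k le_rfl i hi]
    intro i hi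
    rw [h1 i hi]
    exact (hb.mono (by omega)).eq hB hb' hp' _ le_rfl i hi
  · have h1 := (IsLift.agree_iff hB hkk hk hc hb' hpm hp).2 fun i hi => by
      rw [h i hi]
      exact hb.eq hB (hb'.mono (by omega)) hp' _ le_rfl i hi
    intro i hi
    rw [← h1 i hi]
    exact hc'.eq hB (hc.mono hkk) hp _ le_rfl i hi

theorem isLift_const {p : ℕ → U} {n : ℕ} (h : ∀ j ≤ n, p j = p 0) :
    S.IsLift p n (fun _ _ => p 0) :=
  ⟨fun _ _ => rfl, fun _ _ => isHarmonic_const _ _, fun _ _ => rfl, fun j hj => (h j hj).symm,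
    fun _ _ => by simpa using S.L_nonneg, fun _ _ _ _ => by
      rw [dist_self]; linarith [S.ρ_pos]⟩

theorem agree_const (hB : HasBetween U) {p : ℕ → U} {m : ℕ} (h : ∀ j ≤ m, p j = p 0)
    (hp : dist S.o (p 0) + S.L ≤ S.R) : S.Agree p m := by
  intro k hk c b hc hb i hi
  have hm := h m le_rfl
  rw [hc.eq hB (isLift_const fun j hj => h j (by omega)) hp k le_rfl i hi,
    hb.eq hB (isLift_const fun j hj => (h _ (by omega)).trans (h _ (by omega)).symm)
      (by simpa [hm] using hp) (m - k) le_rfl i hi]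
  simp [hm]

theorem sum_dist_le_of_close {p p' : ℕ → U} {n m : ℕ} {ε : ℝ} (hnm : n ≤ m) (hε : 0 ≤ ε)
    (h : ∀ j ≤ n, dist (p j) (p' j) ≤ ε) :
    ∑ j ∈ Finset.range n, dist (p' j) (p' (j + 1)) ≤
      ∑ j ∈ Finset.range n, dist (p j) (p (j + 1)) + 2 * m * ε := by
  calc _ ≤ ∑ j ∈ Finset.range n, (dist (p j) (p (j + 1)) + 2 * ε) := by
        refine Finset.sum_le_sum fun j hj => ?_
        have hj : j < n := by simpa using hj
        have h1 := h j hj.le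
        have h2 := h (j + 1) hj
        have := dist_triangle4 (p' j) (p j) (p (j + 1)) (p' (j + 1))
        rw [dist_comm (p' j) (p j)] at this
        linarith
    _ = ∑ j ∈ Finset.range n, dist (p j) (p (j + 1)) + 2 * n * ε := by
        rw [Finset.sum_add_distrib]; simp; ring
    _ ≤ _ := by gcongr

/-- Lift both polygons from both ends to a vertex near half the perimeter. Corresponding lifts are
`ρ / 2`-close, so agreement for `p` puts the two lifts of `p'` within `ρ` of each other, and
uniqueness makes them equal. -/
theorem Agree.of_close [ProperSpace U] (hB : HasBetween U) {p p' : ℕ → U} {m : ℕ}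
    {η τ d₀ l ε : ℝ} (hη : 0 < η) (hτ : 0 < τ) (hd1 : S.M * d₀ ≤ S.ρ / 4)
    (hd2 : S.N * d₀ ≤ 2 * η * τ) (hl : η + (1 + τ) * (l + 2 * d₀) ≤ S.L) (hl0 : 0 ≤ l)
    (hstep : ∀ j < m, dist (p j) (p (j + 1)) ≤ d₀) (hstep' : ∀ j < m, dist (p' j) (p' (j + 1)) ≤ d₀)
    (hper : ∑ j ∈ Finset.range m, dist (p j) (p (j + 1)) ≤ 2 * l)
    (hpm : p m = p 0) (hpm' : p' m = p' 0)
    (hp : dist S.o (p 0) + S.L + S.ρ ≤ S.R) (hp' : dist S.o (p' 0) + S.L + S.ρ ≤ S.R)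
    (hε0 : 0 ≤ ε) (hd0 : 0 ≤ d₀) (hε : S.M * ε ≤ S.ρ / 2) (hε' : 2 * m * ε ≤ d₀)
    (hpp : ∀ j ≤ m, dist (p j) (p' j) ≤ ε) (h : S.Agree p m) : S.Agree p' m := by
  have hρ := S.ρ_pos
  -- The forward part has length at most `l`, the backward part at most `l + d₀` because of the edge
  -- crossing the middle. Passing to `p'` costs at most another `d₀`, whence `l + 2 * d₀` in `hl`.
  obtain ⟨k, hkm, hka, hkb⟩ := exists_split
    (g := fun k => ∑ j ∈ Finset.range k, dist (p j) (p (j + 1))) (m := m) (a := l) (by simpa using hl0)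
  have hsum := sum_add_sum_reverse p (m := m) (j := m - k) (by omega)
  rw [Nat.sub_sub_self hkm] at hsum
  have hrev : ∑ i ∈ Finset.range (m - k), dist (p (m - i)) (p (m - (i + 1))) ≤ l + d₀ := by
    rcases hkb with rfl | ⟨h1, h2⟩
    · simp; positivity
    · simp only [Finset.sum_range_succ] at h2
      have := hstep k h1
      linarith
  have hrstep : ∀ q : ℕ → U, (∀ j < m, dist (q j) (q (j + 1)) ≤ d₀) →
      ∀ j < m - k, dist (q (m - j)) (q (m - (j + 1))) ≤ d₀ := by
    intro q hq j hj
    have := hq (m - (j + 1)) (by omega)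
    rwa [show m - (j + 1) + 1 = m - j by omega, dist_comm] at this
  have hb1 : ∀ x : ℝ, x ≤ l + 2 * d₀ → η + (1 + τ) * x ≤ S.L := fun x hx => by
    refine le_trans ?_ hl
    gcongr
  obtain ⟨c, hc, -⟩ := exists_isLift (S := S) hB (p := p) (n := k) hη hτ hd1 hd2
    (fun j hj => hstep j (by omega)) (hb1 _ (by linarith)) hp
  obtain ⟨b, hb, -⟩ := exists_isLift (S := S) hB (p := fun j => p (m - j)) (n := m - k) hη hτ hd1 hd2
    (hrstep p hstep) (hb1 _ (by linarith)) (by simpa [hpm] using hp)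
  have c1 := sum_dist_le_of_close hkm hε0 (p := p) (p' := p') (fun j hj => hpp j (by omega))
  have c2 := sum_dist_le_of_close (Nat.sub_le m k) hε0 (p := fun j => p (m - j))
    (p' := fun j => p' (m - j)) (fun j hj => hpp (m - j) (by omega))
  obtain ⟨c', hc', -⟩ := exists_isLift (S := S) hB (p := p') (n := k) hη hτ hd1 hd2
    (fun j hj => hstep' j (by omega)) (hb1 _ (by linarith)) hp'
  obtain ⟨b', hb', -⟩ := exists_isLift (S := S) hB (p := fun j => p' (m - j)) (n := m - k) hη hτ hd1
    hd2 (hrstep p' hstep') (hb1 _ (by linarith)) (by simpa [hpm'] using hp')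
  refine agree_of_exists hB hkm hc' hb' hpm' (by linarith) ?_
  have hag := h k hkm c b hc hb
  have d1 := hc.dist_le hB hc' (by linarith) (by linarith) hε (fun j hj => hpp j (by omega)) k le_rfl
  have d2 := hb.dist_le hB hb' (by simp [hpm]; linarith) (by simp [hpm']; linarith) hε
    (fun j hj => hpp _ (by omega)) (m - k) le_rfl
  refine S.eq_of_ends hB (hc'.harm _ le_rfl) (hb'.harm _ le_rfl) (hc'.len _ le_rfl)
    (hb'.len _ le_rfl) (fun i hi => ?_) (fun i hi => ?_) ?_ ?_ ?_
  · linarith [hc'.dist_center_le hp' le_rfl hi]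
  · linarith [hb'.dist_center_le (r := S.ρ) (by simpa [hpm'] using hp') le_rfl hi]
  · intro i hi
    have := d1 i hi
    have := d2 i hi
    rw [← hag i hi] at this
    have := dist_triangle_left (c' k i) (b' (m - k) i) (c k i)
    linarith
  · rw [hc'.left _ le_rfl, hb'.left _ le_rfl]; simp [hpm']
  · rw [hc'.right _ le_rfl, hb'.right _ le_rfl]
    congr 1; omega

theorem agree_of_family [ProperSpace U] (hB : HasBetween U) {p : ℝ → ℕ → U} {m : ℕ}
    {η τ d₀ l : ℝ} (hη : 0 < η) (hτ : 0 < τ) (hd0 : 0 < d₀) (hd1 : S.M * d₀ ≤ S.ρ / 4)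
    (hd2 : S.N * d₀ ≤ 2 * η * τ) (hl : η + (1 + τ) * (l + 2 * d₀) ≤ S.L) (hl0 : 0 ≤ l)
    (hstep : ∀ s ∈ Icc (0 : ℝ) 1, ∀ j < m, dist (p s j) (p s (j + 1)) ≤ d₀)
    (hper : ∀ s ∈ Icc (0 : ℝ) 1, ∑ j ∈ Finset.range m, dist (p s j) (p s (j + 1)) ≤ 2 * l)
    (hpm : ∀ s ∈ Icc (0 : ℝ) 1, p s m = p s 0)
    (hp : ∀ s ∈ Icc (0 : ℝ) 1, dist S.o (p s 0) + S.L + S.ρ ≤ S.R)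
    (huc : ∀ ε > 0, ∃ δ > 0, ∀ s ∈ Icc (0 : ℝ) 1, ∀ s' ∈ Icc (0 : ℝ) 1, |s - s'| < δ →
      ∀ j ≤ m, dist (p s j) (p s' j) ≤ ε)
    (hconst : ∀ j ≤ m, p 1 j = p 1 0) : S.Agree (p 0) m := by
  have hM := S.M_pos
  have hρ := S.ρ_pos
  set ε := min (S.ρ / (2 * S.M)) (d₀ / (2 * m + 1)) with hεdef
  have hε : 0 < ε := by positivity
  have hε1 : S.M * ε ≤ S.ρ / 2 := by
    calc S.M * ε ≤ S.M * (S.ρ / (2 * S.M)) := by gcongr; exact min_le_left _ _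
      _ = _ := by field_simp
  have hε2 : 2 * m * ε ≤ d₀ := by
    calc 2 * m * ε ≤ (2 * m + 1) * (d₀ / (2 * m + 1)) := by
          gcongr
          · linarith
          · exact min_le_right _ _
      _ = d₀ := by field_simp
  obtain ⟨δ, hδ, hclose⟩ := huc ε hε
  obtain ⟨n, hn⟩ := exists_nat_one_div_lt hδ
  have hn0 : (0 : ℝ) < n + 1 := by positivity
  -- Agreement is carried from the constant polygon at parameter `1` down to parameter `0` in steps
  -- shorter than `δ`.
  have key : ∀ i : ℕ, i ≤ n + 1 → S.Agree (p (1 - i / (n + 1))) m := by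
    intro i
    induction i with
    | zero =>
      intro _
      simp only [Nat.cast_zero, zero_div, sub_zero]
      exact agree_const hB hconst (by linarith [hp 1 (by simp)])
    | succ i ih =>
      intro hi
      have mem : ∀ j : ℕ, j ≤ n + 1 → (1 - j / (n + 1) : ℝ) ∈ Icc (0 : ℝ) 1 := by
        intro j hj
        have : (j : ℝ) / (n + 1) ≤ 1 := by
          rw [div_le_one hn0]; exact_mod_cast hj
        exact ⟨by linarith, by have : (0 : ℝ) ≤ j / (n + 1) := by positivity
                               linarith⟩
      have h1 := mem i (by omega)
      have h2 := mem (i + 1) hi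
      refine Agree.of_close hB hη hτ hd1 hd2 hl hl0 (hstep _ h1) (hstep _ h2) (hper _ h1) (hpm _ h1)
        (hpm _ h2) (hp _ h1) (hp _ h2) hε.le hd0.le hε1 hε2 (hclose _ h1 _ h2 ?_) (ih (by omega))
      have : (1 - (i : ℝ) / (n + 1)) - (1 - ((i + 1 : ℕ) : ℝ) / (n + 1)) = 1 / (n + 1) := by
        push_cast; field_simp; ring
      rw [this, abs_of_pos (by positivity)]
      exact hn
  have := key (n + 1) le_rfl
  push_cast at this
  rwa [div_self hn0.ne', sub_self] at this

/-- Equidistant points on the initial segments of a geodesic form harmonic chains, so along its own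
subdivision a geodesic lifts to itself. -/
theorem isLift_geodesic {γ : ℝ → U} {x y : U} (hγ : IsGeodesic γ x y) {n : ℕ} (hn : 0 < n)
    {p : ℕ → U} (hp : ∀ j ≤ n, p j = γ (j * (dist x y / n))) (hL : dist x y ≤ S.L)
    (hstep : dist x y / n ≤ S.ρ / 4) :
    S.IsLift p n (fun j i => γ (j * (dist x y / n) * (i / S.N))) := by
  set ℓ := dist x y with hℓ
  have hℓ0 : 0 ≤ ℓ := dist_nonneg
  have hn' : (0 : ℝ) < n := by exact_mod_cast hn
  have hN := S.N_pos
  have hp0 : p 0 = γ 0 := by simpa using hp 0 (Nat.zero_le _)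
  have hle : ∀ j ≤ n, (j : ℝ) * (ℓ / n) ≤ ℓ := fun j hj => by
    calc (j : ℝ) * (ℓ / n) ≤ n * (ℓ / n) := by gcongr
      _ = ℓ := by field_simp
  have hi1 : ∀ i ≤ S.N, (i : ℝ) / S.N ≤ 1 := fun i hi => by
    rw [div_le_one hN]; exact_mod_cast hi
  have hmem : ∀ j ≤ n, ∀ i ≤ S.N, (j * (ℓ / n) * (i / S.N) : ℝ) ∈ Icc 0 ℓ := fun j hj i hi => by
    refine ⟨by positivity, ?_⟩
    have := hle j hj
    have := hi1 i hi
    have h0 : (0 : ℝ) ≤ j * (ℓ / n) := by positivity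
    nlinarith
  refine ⟨?_, ?_, ?_, ?_, ?_, ?_⟩
  · intro i hi
    simp [hp0]
  · intro j hj i hi
    have m0 := hmem j hj i (by omega)
    have m1 := hmem j hj (i + 1) (by omega)
    have m2 := hmem j hj (i + 2) hi
    have hj0 : (0 : ℝ) ≤ j * (ℓ / n) := by positivity
    have l1 : (j * (ℓ / n) * (i / S.N) : ℝ) ≤ j * (ℓ / n) * ((i + 1 : ℕ) / S.N) := by
      gcongr; omega
    have l2 : (j * (ℓ / n) * ((i + 1 : ℕ) / S.N) : ℝ) ≤ j * (ℓ / n) * ((i + 2 : ℕ) / S.N) := by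
      gcongr; omega
    constructor
    · rw [hγ.dist_eq _ _ m0.1 l1 m1.2, hγ.dist_eq _ _ m0.1 (l1.trans l2) m2.2]
      push_cast; ring
    · rw [hγ.dist_eq _ _ m1.1 l2 m2.2, hγ.dist_eq _ _ m0.1 (l1.trans l2) m2.2]
      push_cast; ring
  · intro j hj
    simp [hp0]
  · intro j hj
    rw [div_self hN.ne', mul_one, hp j hj]
  · intro j hj
    have m1 := hmem j hj 1 (by have := S.two_le; omega)
    have m0 := hmem j hj 0 (Nat.zero_le _)
    rw [hγ.dist_eq _ _ m0.1 (by simpa using m1.1) m1.2]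
    have := hle j hj
    calc _ = (j : ℝ) * (ℓ / n) := by push_cast; field_simp; ring
      _ ≤ S.L := this.trans hL
  · intro j hj i hi
    have m0 := hmem j (by omega) i hi
    have m1 := hmem (j + 1) (by omega) i hi
    have l1 : (j * (ℓ / n) * (i / S.N) : ℝ) ≤ ((j + 1 : ℕ) * (ℓ / n) * (i / S.N)) := by
      gcongr; omega
    rw [hγ.dist_eq _ _ m0.1 l1 m1.2]
    have := hi1 i hi
    have h0 : 0 ≤ ℓ / n := by positivity
    calc _ = ℓ / n * (i / S.N) := by push_cast; ring
      _ ≤ ℓ / n * 1 := by gcongr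
      _ ≤ _ := by linarith

end ChainScale

end Bigons

/-! ### Subdividing families of polygons -/

section Families

variable {U : Type*} [MetricSpace U]

/-- Near the ball of radius `R` about `o`, midpoints of pairs at distance at most `r` with a common
point depend on the other point in a 1-Lipschitz way. -/
def MidNonexpanding (o : U) (R r : ℝ) : Prop :=
  ∀ a b b' m m', dist o a ≤ R → dist a b ≤ r → dist a b' ≤ r → IsMid a b m → IsMid a b' m' →
    dist m m' ≤ dist b b'

theorem MidNonexpanding.eq {o : U} {R r : ℝ} (h : MidNonexpanding o R r) {a b m m' : U}
    (ha : dist o a ≤ R) (hab : dist a b ≤ r) (hm : IsMid a b m) (hm' : IsMid a b m') : m = m' := by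
  have := h a b b m m' ha hab hab hm hm'
  rw [dist_self] at this
  exact dist_le_zero.1 this

theorem MidNonexpanding.dist_le (hB : HasBetween U) {o : U} {R r : ℝ} (h : MidNonexpanding o R r)
    {a b a' b' m m' : U} (ha : dist o a ≤ R) (hb' : dist o b' ≤ R) (hab : dist a b ≤ r)
    (hab' : dist a b' ≤ r) (hab'' : dist a' b' ≤ r) (hm : IsMid a b m) (hm' : IsMid a' b' m') :
    dist m m' ≤ dist a a' + dist b b' := by
  obtain ⟨n, hn⟩ := hB.exists_mid a b'
  have e1 := h a b b' m n ha hab hab' hm hn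
  have e2 := h b' a a' n m' hb' (by rwa [dist_comm]) (by rwa [dist_comm]) hn.symm hm'.symm
  linarith [dist_triangle m n m']

theorem perimeter_subdivide {mid : U → U → U} (hmid : ∀ a b, IsMid a b (mid a b)) (p : ℕ → U)
    (n : ℕ) : ∑ j ∈ Finset.range (2 * n), dist (subdivide mid p j) (subdivide mid p (j + 1)) =
      ∑ j ∈ Finset.range n, dist (p j) (p (j + 1)) := by
  induction n with
  | zero => simp
  | succ n ih =>
    rw [show 2 * (n + 1) = 2 * n + 1 + 1 by ring, Finset.sum_range_succ, Finset.sum_range_succ, ih,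
      Finset.sum_range_succ, dist_subdivide hmid, dist_subdivide hmid,
      show (2 * n + 1) / 2 = n by omega, show 2 * n / 2 = n by omega]
    ring

theorem perimeter_iterate_subdivide {mid : U → U → U} (hmid : ∀ a b, IsMid a b (mid a b))
    (p : ℕ → U) (q n : ℕ) :
    ∑ j ∈ Finset.range (2 ^ q * n),
      dist ((subdivide mid)^[q] p j) ((subdivide mid)^[q] p (j + 1)) =
      ∑ j ∈ Finset.range n, dist (p j) (p (j + 1)) := by
  induction q with
  | zero => simp
  | succ q ih =>
    rw [← ih, ← perimeter_subdivide hmid ((subdivide mid)^[q] p), ← mul_assoc, ← pow_succ']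
    simp only [Function.iterate_succ_apply']

/-- A midpoint moves by at most the sum of the displacements of its neighbours, so each subdivision
at most doubles the distance of two polygons. This is crude, but `q` is fixed and only continuity in
the family parameter is needed. -/
theorem dist_iterate_subdivide_le (hB : HasBetween U) {mid : U → U → U}
    (hmid : ∀ a b, IsMid a b (mid a b)) {o : U} {R δ : ℝ} (h : MidNonexpanding o R (2 * δ)) (q : ℕ) :
    ∀ (e ε : ℝ) (n : ℕ) (p p' : ℕ → U), (∀ j < n, dist (p j) (p (j + 1)) ≤ e) →
      (∀ j < n, dist (p' j) (p' (j + 1)) ≤ e) → (∀ j ≤ n, dist o (p j) + e ≤ R) →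
      (∀ j ≤ n, dist o (p' j) + e ≤ R) → (∀ j ≤ n, dist (p j) (p' j) ≤ ε) → 0 ≤ e → 0 ≤ ε →
      e ≤ δ → 2 ^ q * ε ≤ δ →
      ∀ k ≤ 2 ^ q * n, dist ((subdivide mid)^[q] p k) ((subdivide mid)^[q] p' k) ≤ 2 ^ q * ε := by
  induction q with
  | zero =>
    intro e ε n p p' _ _ _ _ hd _ _ _ _ k hk
    simpa using hd k (by simpa using hk)
  | succ q ih =>
    intro e ε n p p' hp hp' hR hR' hd he hε heδ hεδ k hk
    rw [Function.iterate_succ_apply, Function.iterate_succ_apply]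
    have hq : (1 : ℝ) ≤ 2 ^ q := one_le_pow₀ (by norm_num)
    have hedge : ∀ p : ℕ → U, (∀ j < n, dist (p j) (p (j + 1)) ≤ e) → ∀ j < 2 * n,
        dist (subdivide mid p j) (subdivide mid p (j + 1)) ≤ e / 2 := fun p hp j hj => by
      rw [dist_subdivide hmid]
      have := hp (j / 2) (by omega)
      linarith
    have hreg : ∀ p : ℕ → U, (∀ j < n, dist (p j) (p (j + 1)) ≤ e) → (∀ j ≤ n, dist o (p j) + e ≤ R) →
        ∀ j ≤ 2 * n, dist o (subdivide mid p j) + e / 2 ≤ R := fun p hp hR j hj => by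
      rcases Nat.even_or_odd' j with ⟨i, rfl | rfl⟩
      · rw [subdivide_two_mul]
        linarith [hR i (by omega)]
      · have h1 := dist_subdivide hmid p (2 * i)
        rw [subdivide_two_mul, show 2 * i / 2 = i by omega] at h1
        have := hp i (by omega)
        have := hR i (by omega)
        have := dist_triangle o (p i) (subdivide mid p (2 * i + 1))
        linarith
    have e1 : (2 : ℝ) ^ (q + 1) * ε = 2 ^ q * (2 * ε) := by ring
    rw [e1] at hεδ ⊢
    refine ih (e / 2) (2 * ε) (2 * n) _ _ (hedge p hp) (hedge p' hp') (hreg p hp hR)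
      (hreg p' hp' hR') ?_ (by positivity) (by positivity) (by linarith) hεδ k
      (by rwa [← mul_assoc, ← pow_succ])
    intro j hj
    rcases Nat.even_or_odd' j with ⟨i, rfl | rfl⟩
    · rw [subdivide_two_mul, subdivide_two_mul]
      linarith [hd i (by omega)]
    · rw [subdivide_two_mul_add_one, subdivide_two_mul_add_one]
      have d1 := hd i (by omega)
      have d2 := hd (i + 1) (by omega)
      have a1 := hp i (by omega)
      have hε' : ε ≤ δ := by nlinarith
      refine (h.dist_le hB (by linarith [hR i (by omega)]) (by linarith [hR' (i + 1) (by omega)])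
        (by linarith) ?_ (by linarith [hp' i (by omega)]) (hmid _ _) (hmid _ _)).trans (by linarith)
      linarith [dist_triangle (p i) (p (i + 1)) (p' (i + 1))]

/-- Short pairs have unique midpoints, so the midpoints inserted between points of a geodesic stay
on it. A negative `v` serves for a side traversed backwards. -/
theorem iterate_subdivide_geodesic {mid : U → U → U} (hmid : ∀ a b, IsMid a b (mid a b)) {o : U}
    {R r : ℝ} (h : MidNonexpanding o R r) {γ : ℝ → U} {x y : U} (hγ : IsGeodesic γ x y)
    {p : ℕ → U} {u v : ℝ} {j₀ j₁ : ℕ} (hv : |v| ≤ r)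
    (hmem : ∀ j, j₀ ≤ j → j ≤ j₁ → u + v * j ∈ Icc 0 (dist x y))
    (hR : ∀ t ∈ Icc 0 (dist x y), dist o (γ t) ≤ R)
    (hp : ∀ j, j₀ ≤ j → j ≤ j₁ → p j = γ (u + v * j)) (q : ℕ) :
    ∀ k, 2 ^ q * j₀ ≤ k → k ≤ 2 ^ q * j₁ →
      u + v * (k / 2 ^ q) ∈ Icc 0 (dist x y) ∧ (subdivide mid)^[q] p k = γ (u + v * (k / 2 ^ q)) := by
  induction q with
  | zero => intro k h0 h1; simpa using ⟨hmem k (by simpa using h0) (by simpa using h1), hp k (by simpa using h0) (by simpa using h1)⟩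
  | succ q ih =>
    intro k h0 h1
    rw [pow_succ', mul_assoc] at h0 h1
    have hq : (1 : ℝ) ≤ 2 ^ q := one_le_pow₀ (by norm_num)
    rw [Function.iterate_succ_apply']
    rcases Nat.even_or_odd' k with ⟨i, rfl | rfl⟩
    · rw [subdivide_two_mul]
      have := ih i (by omega) (by omega)
      have e : (((2 * i : ℕ) : ℝ) / 2 ^ (q + 1)) = i / 2 ^ q := by
        push_cast; rw [pow_succ']; field_simp
      rwa [e]
    · obtain ⟨m1, g1⟩ := ih i (by omega) (by omega)
      obtain ⟨m2, g2⟩ := ih (i + 1) (by omega) (by omega)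
      have hmem' : u + v * (((2 * i + 1 : ℕ) : ℝ) / 2 ^ (q + 1)) ∈ Icc 0 (dist x y) := by
        have e : u + v * (((2 * i + 1 : ℕ) : ℝ) / 2 ^ (q + 1)) =
            ((u + v * (i / 2 ^ q)) + (u + v * ((i + 1 : ℕ) / 2 ^ q))) / 2 := by
          push_cast; rw [pow_succ']; field_simp; ring
        rw [e]
        exact ⟨by linarith [m1.1, m2.1], by linarith [m1.2, m2.2]⟩
      refine ⟨hmem', ?_⟩
      rw [subdivide_two_mul_add_one]
      have e1 : u + v * (i / 2 ^ q) - (u + v * ((i + 1 : ℕ) / 2 ^ q)) = - v / 2 ^ q := by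
        push_cast; field_simp; ring
      have e2 : u + v * (i / 2 ^ q) - (u + v * ((2 * i + 1 : ℕ) / 2 ^ (q + 1))) = - v / 2 ^ q / 2 := by
        push_cast; rw [pow_succ']; field_simp; ring
      have e3 : (u + v * ((2 * i + 1 : ℕ) / 2 ^ (q + 1))) - (u + v * ((i + 1 : ℕ) / 2 ^ q)) =
          - v / 2 ^ q / 2 := by
        push_cast; rw [pow_succ']; field_simp; ring
      rw [g1, g2]
      refine h.eq (hR _ m1) ?_ (hmid _ _) ⟨?_, ?_⟩
      · rw [hγ.dist_eq_abs m1 m2, e1, abs_div, abs_neg, abs_of_pos (show (0 : ℝ) < 2 ^ q by positivity)]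
        exact (div_le_self (abs_nonneg _) hq).trans hv
      · rw [hγ.dist_eq_abs m1 m2, hγ.dist_eq_abs m1 hmem', e1, e2, abs_div _ (2 : ℝ)]; simp
      · rw [hγ.dist_eq_abs m1 m2, hγ.dist_eq_abs hmem' m2, e1, e3, abs_div _ (2 : ℝ)]; simp

theorem IsGeodesic.eq_of_grid {γ₀ γ₁ : ℝ → U} {x y : U} (h₀ : IsGeodesic γ₀ x y)
    (h₁ : IsGeodesic γ₁ x y)
    (h : ∀ N₀ : ℕ, ∃ N : ℕ, N₀ ≤ N ∧ 0 < N ∧ ∀ i ≤ N, γ₀ (dist x y * (i / N)) = γ₁ (dist x y * (i / N))) :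
    ∀ t ∈ Icc 0 (dist x y), γ₀ t = γ₁ t := by
  intro t ht
  set ℓ := dist x y with hℓ
  have hℓ0 : 0 ≤ ℓ := dist_nonneg
  rcases hℓ0.eq_or_lt with h0 | h0
  · have : t = 0 := le_antisymm (by rw [h0]; exact ht.2) ht.1
    rw [this, h₀.left, h₁.left]
  refine dist_le_zero.1 (le_of_forall_pos_le_add fun ε hε => ?_)
  obtain ⟨N₀, hN₀⟩ := exists_nat_gt (2 * ℓ / ε)
  obtain ⟨N, hN, hN1, hag⟩ := h N₀
  have hNp : (0 : ℝ) < N := by exact_mod_cast hN1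
  have hlt : 2 * ℓ / N < ε := by
    have : 2 * ℓ / ε < N := hN₀.trans_le (by exact_mod_cast hN)
    rw [div_lt_iff₀ hε] at this
    rw [div_lt_iff₀ hNp]; linarith
  set i := ⌊t / ℓ * N⌋₊ with hi
  have f1 : (i : ℝ) ≤ t / ℓ * N := Nat.floor_le (by have := ht.1; positivity)
  have f2 := Nat.lt_floor_add_one (t / ℓ * N)
  rw [← hi] at f2
  have htl : t / ℓ ≤ 1 := by rw [div_le_one h0]; exact ht.2
  have hiN : i ≤ N := by
    have : (i : ℝ) ≤ N := f1.trans (by nlinarith)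
    exact_mod_cast this
  have g1 : ℓ * (i / N) ≤ t := by
    rw [mul_div_assoc', div_le_iff₀ hNp]
    have := mul_le_mul_of_nonneg_left f1 h0.le
    calc _ ≤ _ := this
      _ = _ := by field_simp
  have g2 : t ≤ ℓ * (i / N) + ℓ / N := by
    have := mul_le_mul_of_nonneg_left f2.le h0.le
    have e : ℓ * (t / ℓ * N) = t * N := by field_simp
    rw [e] at this
    rw [mul_div_assoc', ← add_div, le_div_iff₀ hNp]
    linarith
  have g0 : 0 ≤ ℓ * (i / N) := by positivity
  have a0 := h₀.dist_eq _ _ g0 g1 ht.2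
  have a1 := h₁.dist_eq _ _ g0 g1 ht.2
  have := dist_triangle_left (γ₀ t) (γ₁ t) (γ₀ (ℓ * (i / N)))
  rw [a0, hag i hiN, a1] at this
  have : 2 * ℓ / N = 2 * (ℓ / N) := by ring
  linarith

/-- Two geodesics with common endpoints coincide if the closed polygon inscribed in the bigon that
they form can be contracted through closed polygons of perimeter at most `2 * l`, and harmonic chains
of length slightly more than `l` are under control. -/
theorem IsGeodesic.eq_of_family [ProperSpace U] (hB : HasBetween U) {γ₀ γ₁ : ℝ → U} {x y : U}
    (h₀ : IsGeodesic γ₀ x y) (h₁ : IsGeodesic γ₁ x y) {o : U} {R R' δ l L : ℝ} {n : ℕ} (hn : 0 < n)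
    {Q : ℝ → ℕ → U} (hδ : 0 < δ) (hmid : MidNonexpanding o R' (2 * δ)) (hlL : l < L)
    (hxy : dist x y ≤ l)
    (hS : ∀ N₀ : ℕ, ∃ S : ChainScale U, S.o = o ∧ S.R = R ∧ S.L = L ∧ S.ρ ≤ 1 ∧ N₀ ≤ S.N)
    (hR : ∀ s ∈ Icc (0 : ℝ) 1, ∀ j ≤ 2 * n, dist o (Q s j) + L + δ + 1 ≤ R)
    (hR' : ∀ s ∈ Icc (0 : ℝ) 1, ∀ j ≤ 2 * n, dist o (Q s j) + dist x y + δ ≤ R')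
    (hstep : ∀ s ∈ Icc (0 : ℝ) 1, ∀ j < 2 * n, dist (Q s j) (Q s (j + 1)) ≤ δ)
    (hper : ∀ s ∈ Icc (0 : ℝ) 1, ∑ j ∈ Finset.range (2 * n), dist (Q s j) (Q s (j + 1)) ≤ 2 * l)
    (hclosed : ∀ s ∈ Icc (0 : ℝ) 1, Q s (2 * n) = Q s 0)
    (huc : ∀ ε > 0, ∃ δ > 0, ∀ s ∈ Icc (0 : ℝ) 1, ∀ s' ∈ Icc (0 : ℝ) 1, |s - s'| < δ →
      ∀ j ≤ 2 * n, dist (Q s j) (Q s' j) ≤ ε)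
    (hconst : ∀ j ≤ 2 * n, Q 1 j = Q 1 0)
    (hQ₀ : ∀ j ≤ n, Q 0 j = γ₀ (j * (dist x y / n)))
    (hQ₁ : ∀ j ≤ n, Q 0 (2 * n - j) = γ₁ (j * (dist x y / n))) :
    ∀ t ∈ Icc 0 (dist x y), γ₀ t = γ₁ t := by
  refine h₀.eq_of_grid h₁ fun N₀ => ?_
  obtain ⟨S, hSo, hSR, hSL, hSρ, hSN⟩ := hS N₀
  have hN := S.N_pos
  refine ⟨S.N, hSN, by exact_mod_cast hN, ?_⟩
  choose mid hmid' using hB.exists_mid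
  set ℓ := dist x y with hℓ
  have hℓ0 : 0 ≤ ℓ := dist_nonneg
  have hl0 : 0 ≤ l := hℓ0.trans hxy
  have hM := S.M_pos
  have hρ := S.ρ_pos
  have hn' : (0 : ℝ) < n := by exact_mod_cast hn
  -- The surplus `g` pays for everything that a lift exceeds `l` by: the allowance `η`, the term `τ
  -- * l`, and the multiples of `d₀`.
  set g := L - l with hg
  have hg0 : 0 < g := by linarith
  set η := g / 4 with hη
  set τ := min 1 (g / (4 * (l + 1))) with hτ
  have hτ0 : 0 < τ := by positivity
  have hτ1 : τ ≤ 1 := min_le_left _ _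
  have hτl : τ * l ≤ g / 4 := by
    calc τ * l ≤ g / (4 * (l + 1)) * (l + 1) := by
          gcongr
          · exact min_le_right _ _
          · linarith
      _ = g / 4 := by field_simp
  set d₀ := min (min (S.ρ / (4 * S.M)) (2 * η * τ / S.N)) (g / 16) with hd₀
  have hη0 : 0 < η := by positivity
  have hd0 : 0 < d₀ := by positivity
  have hd1 : S.M * d₀ ≤ S.ρ / 4 := by
    calc S.M * d₀ ≤ S.M * (S.ρ / (4 * S.M)) := by
          gcongr; exact (min_le_left _ _).trans (min_le_left _ _)
      _ = _ := by field_simp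
  have hd2 : S.N * d₀ ≤ 2 * η * τ := by
    calc S.N * d₀ ≤ S.N * (2 * η * τ / S.N) := by
          gcongr; exact (min_le_left _ _).trans (min_le_right _ _)
      _ = _ := by field_simp
  have hd3 : d₀ ≤ g / 16 := min_le_right _ _
  have hl : η + (1 + τ) * (l + 2 * d₀) ≤ S.L := by
    rw [hSL]
    nlinarith
  -- The edge bound `d₀` depends on the scale `S`, hence on `N`, while `Q` is fixed beforehand;
  -- subdivision makes the edges short enough without changing the perimeter.
  obtain ⟨q, hq⟩ := pow_unbounded_of_one_lt (δ / d₀) (one_lt_two)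
  have hq0 : (0 : ℝ) < 2 ^ q := by positivity
  have hqd : δ / 2 ^ q ≤ d₀ := by
    rw [div_le_iff₀ hq0]; rw [div_lt_iff₀ hd0] at hq; linarith
  set p : ℝ → ℕ → U := fun s => (subdivide mid)^[q] (Q s) with hp
  have hp0 : ∀ s, p s 0 = Q s 0 := fun s => by
    have := iterate_subdivide_two_pow_mul mid (Q s) q 0
    rwa [mul_zero] at this
  have hpm : ∀ s, p s (2 ^ q * (2 * n)) = Q s (2 * n) := fun s =>
    iterate_subdivide_two_pow_mul mid (Q s) q (2 * n)
  have hdiv : ∀ j < 2 ^ q * (2 * n), j / 2 ^ q < 2 * n := fun j hj =>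
    Nat.div_lt_of_lt_mul hj
  have hL0 : 0 ≤ L := by linarith
  have hag : S.Agree (p 0) (2 ^ q * (2 * n)) := by
    refine ChainScale.agree_of_family hB (η := η) (τ := τ) (d₀ := d₀) (l := l) hη0 hτ0 hd0 hd1 hd2 hl
      hl0 ?_ ?_ ?_ ?_ ?_ ?_
    · intro s hs j hj
      simp only [hp]
      rw [dist_iterate_subdivide hmid']
      refine le_trans ?_ hqd
      gcongr
      exact hstep s hs _ (hdiv j hj)
    · intro s hs
      simp only [hp]
      rw [perimeter_iterate_subdivide hmid']
      exact hper s hs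
    · intro s hs
      rw [hp0, hpm, hclosed s hs]
    · intro s hs
      rw [hp0, hSo, hSL, hSR]
      linarith [hR s hs 0 (Nat.zero_le _)]
    · intro ε hε
      obtain ⟨δ', hδ', hc⟩ := huc (min ε δ / 2 ^ q) (by positivity)
      refine ⟨δ', hδ', fun s hs s' hs' hss j hj => ?_⟩
      have hmul : 2 ^ q * (min ε δ / 2 ^ q) = min ε δ := by field_simp
      refine (dist_iterate_subdivide_le hB hmid' hmid q δ (min ε δ / 2 ^ q) (2 * n) (Q s) (Q s')
        (hstep s hs) (hstep s' hs') (fun j hj => by linarith [hR' s hs j hj])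
        (fun j hj => by linarith [hR' s' hs' j hj]) (hc s hs s' hs' hss) hδ.le (by positivity) le_rfl
        (by rw [hmul]; exact min_le_right _ _) j hj).trans ?_
      rw [hmul]
      exact min_le_left _ _
    · intro j hj
      induction j with
      | zero => rfl
      | succ j ih =>
        rw [← ih (by omega), ← dist_eq_zero, dist_comm]
        simp only [hp]
        have h1 := hdiv j (by omega)
        rw [dist_iterate_subdivide hmid', hconst _ h1.le, hconst _ h1]
        simp
  have hdn : ℓ / n ≤ δ := by
    have h1 := hstep 0 (by simp) 0 (by omega)
    have h2 := hQ₀ 0 (Nat.zero_le _)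
    have h3 := hQ₀ 1 hn
    simp only [zero_add] at h1
    rw [h2, h3] at h1
    have h4 := h₀.dist_eq 0 (ℓ / n) le_rfl (by positivity)
      (div_le_self hℓ0 (by exact_mod_cast hn))
    simp only [Nat.cast_zero, zero_mul, Nat.cast_one, one_mul] at h1
    linarith
  have hox : dist o x + ℓ ≤ R' := by
    have h1 := hR' 0 (by simp) 0 (Nat.zero_le _)
    rw [hQ₀ 0 (Nat.zero_le _)] at h1
    simp only [Nat.cast_zero, zero_mul, h₀.left] at h1
    linarith
  have hregion : ∀ γ, IsGeodesic γ x y → ∀ t ∈ Icc 0 ℓ, dist o (γ t) ≤ R' := fun γ hγ t ht => by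
    have := hγ.dist_left ht.1 ht.2
    linarith [dist_triangle o x (γ t), ht.2]
  have habs : |ℓ / n| ≤ 2 * δ := by rw [abs_of_nonneg (by positivity)]; linarith
  have hjl : ∀ j ≤ n, (j : ℝ) * (ℓ / n) ≤ ℓ := fun j hj => by
    calc (j : ℝ) * (ℓ / n) ≤ n * (ℓ / n) := by gcongr
      _ = ℓ := by field_simp
  have hn2 : ((2 ^ q * n : ℕ) : ℝ) = 2 ^ q * n := by push_cast; ring
  have k0 : ∀ j ≤ 2 ^ q * n, p 0 j = γ₀ (j * (ℓ / (2 ^ q * n : ℕ))) := by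
    intro j hj
    have := (iterate_subdivide_geodesic hmid' hmid h₀ (p := Q 0) (u := 0) (v := ℓ / n) (j₀ := 0)
      (j₁ := n) habs (fun j _ hj => ⟨by positivity, by have := hjl j hj; linarith⟩) (hregion γ₀ h₀)
      (fun j _ hj => by rw [hQ₀ j hj]; congr 1; ring) q j (by simp) hj).2
    simp only [hp]
    rw [this, hn2]
    congr 1
    field_simp; ring
  have k1 : ∀ j ≤ 2 ^ q * n, p 0 (2 ^ q * (2 * n) - j) = γ₁ (j * (ℓ / (2 ^ q * n : ℕ))) := by
    intro j hj
    have hmul : 2 ^ q * (2 * n) = 2 * (2 ^ q * n) := by ring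
    have hcast : ∀ i ≤ 2 * n, ((2 * n - i : ℕ) : ℝ) = 2 * n - i := fun i hi => by
      rw [Nat.cast_sub hi]; push_cast; ring
    have he : ∀ i : ℕ, n ≤ i → i ≤ 2 * n → 2 * ℓ + -(ℓ / n) * i = (2 * n - i : ℕ) * (ℓ / n) :=
      fun i h1 h2 => by rw [hcast i h2]; field_simp; ring
    -- The second half of the polygon runs back along `γ₁`: vertex `i` has parameter `2 * ℓ - (ℓ /
    -- n) * i`.
    have := (iterate_subdivide_geodesic hmid' hmid h₁ (p := Q 0) (u := 2 * ℓ) (v := -(ℓ / n)) (j₀ := n)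
      (j₁ := 2 * n) (by rwa [abs_neg]) (fun i h1 h2 => by
        rw [he i h1 h2]
        exact ⟨by positivity, hjl _ (by omega)⟩) (hregion γ₁ h₁)
      (fun i h1 h2 => by
        rw [he i h1 h2, ← hQ₁ _ (by omega)]; congr 1; omega) q (2 ^ q * (2 * n) - j) (by omega)
        (by omega)).2
    simp only [hp]
    rw [this]
    congr 1
    rw [Nat.cast_sub (by omega)]
    push_cast
    field_simp; ring
  have hstep' : ℓ / (2 ^ q * n : ℕ) ≤ S.ρ / 4 := by
    have h1 : ℓ / (2 ^ q * n : ℕ) = ℓ / n / 2 ^ q := by rw [hn2]; field_simp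
    rw [h1]
    calc ℓ / n / 2 ^ q ≤ δ / 2 ^ q := by gcongr
      _ ≤ d₀ := hqd
      _ ≤ S.M * d₀ := by nlinarith [S.one_le_M]
      _ ≤ _ := hd1
  have hpos : 0 < 2 ^ q * n := by positivity
  have l0 := ChainScale.isLift_geodesic (S := S) h₀ hpos k0 (by linarith) hstep'
  have l1 := ChainScale.isLift_geodesic (S := S) h₁ hpos k1 (by linarith) hstep'
  have e1 : 2 ^ q * (2 * n) - 2 ^ q * n = 2 ^ q * n := by
    rw [show 2 ^ q * (2 * n) = 2 * (2 ^ q * n) by ring]; omega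
  -- The meeting vertex is `y`: there the forward chain lies on `γ₀` and the backward one on `γ₁`.
  have := hag (2 ^ q * n) (by nlinarith) _ _ l0 (by rw [e1]; exact l1)
  intro i hi
  have h2 := this i hi
  rw [e1] at h2
  have e2 : ((2 ^ q * n : ℕ) : ℝ) * (ℓ / (2 ^ q * n : ℕ)) = ℓ := by
    have : ((2 ^ q * n : ℕ) : ℝ) ≠ 0 := by exact_mod_cast hpos.ne'
    field_simp
  rw [e2] at h2
  exact h2

end Families

/-! ### Contraction of midpoints from local comparison -/

section Local

/-- A Lebesgue number for the cover of the compact ball of radius `R` by the balls on which `P`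
holds. -/
theorem exists_uniform_local {U : Type*} [MetricSpace U] [ProperSpace U] {P : U → U → U → U → Prop}
    (h : ∀ c : U, ∃ r : ℝ, 0 < r ∧ ∀ p ∈ Metric.closedBall c r, ∀ q ∈ Metric.closedBall c r,
      ∀ x ∈ Metric.closedBall c r, ∀ y ∈ Metric.closedBall c r, P p q x y) (o : U) (R : ℝ) :
    ∃ r : ℝ, 0 < r ∧ r ≤ 1 / 2 ∧ ∀ c, dist o c ≤ R → ∀ p q x y, dist c p ≤ r → dist c q ≤ r →
      dist c x ≤ r → dist c y ≤ r → P p q x y := by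
  choose ρ hρ hP using h
  obtain ⟨δ, hδ, hleb⟩ := lebesgue_number_lemma_of_metric (isCompact_closedBall o R)
    (c := fun c : U => Metric.ball c (ρ c)) (fun c => Metric.isOpen_ball)
    (fun c _ => mem_iUnion.2 ⟨c, Metric.mem_ball_self (hρ c)⟩)
  refine ⟨min (δ / 2) (1 / 2), by positivity, min_le_right _ _, fun c hc p q x y hp hq hx hy => ?_⟩
  obtain ⟨i, hi⟩ := hleb c (by rwa [Metric.mem_closedBall, dist_comm])
  have hmem : ∀ p, dist c p ≤ min (δ / 2) (1 / 2) → p ∈ Metric.closedBall i (ρ i) := fun p hp => by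
    refine Metric.ball_subset_closedBall (hi ?_)
    rw [Metric.mem_ball, dist_comm]
    exact (hp.trans (min_le_left _ _)).trans_lt (by linarith)
  exact hP i p (hmem p hp) q (hmem q hq) x (hmem x hx) y (hmem y hy)

/-- `CAT(0)` comparison holds in the balls of radius `r` centred in the ball of radius `R`. -/
def UniformlyCATZero {U : Type*} [MetricSpace U] (o : U) (R r : ℝ) : Prop :=
  ∀ c, dist o c ≤ R → ∀ p q x y, dist c p ≤ r → dist c q ≤ r → dist c x ≤ r → dist c y ≤ r →
    CATZeroComparison p q x y

/-- `CAT(1)` comparison holds in the balls of radius `r` centred in the ball of radius `R`. -/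
def UniformlyCATOne {U : Type*} [MetricSpace U] (o : U) (R r : ℝ) : Prop :=
  ∀ c, dist o c ≤ R → ∀ p q x y, dist c p ≤ r → dist c q ≤ r → dist c x ≤ r → dist c y ≤ r →
    CATOneComparison p q x y

variable {U : Type*} [MetricSpace U]

theorem IsLocallyCATZero.uniformly [ProperSpace U] (h : IsLocallyCATZero U) (o : U) (R : ℝ) :
    ∃ r : ℝ, 0 < r ∧ r ≤ 1 / 2 ∧ UniformlyCATZero o R r :=
  exists_uniform_local (fun c => by
    obtain ⟨r, hr, hc⟩ := h c
    exact ⟨r, hr, fun p hp q hq x hx y hy => hc ⟨p, hp⟩ ⟨q, hq⟩ ⟨x, hx⟩ ⟨y, hy⟩⟩) o R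

theorem IsLocallyCATOne.uniformly [ProperSpace U] (h : IsLocallyCATOne U) (o : U) (R : ℝ) :
    ∃ r : ℝ, 0 < r ∧ r ≤ 1 / 2 ∧ UniformlyCATOne o R r :=
  exists_uniform_local (fun c => by
    obtain ⟨r, hr, hc⟩ := h c
    exact ⟨r, hr, fun p hp q hq x hx y hy => hc ⟨p, hp⟩ ⟨q, hq⟩ ⟨x, hx⟩ ⟨y, hy⟩⟩) o R

theorem dist_sq_affine {V : Type*} [NormedAddCommGroup V] [InnerProductSpace ℝ V] (p x y : V) (t : ℝ) :
    dist p ((1 - t) • x + t • y) ^ 2 =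
      (1 - t) * dist p x ^ 2 + t * dist p y ^ 2 - t * (1 - t) * dist x y ^ 2 := by
  have key : ∀ u w : V, ‖u - t • w‖ ^ 2 =
      (1 - t) * ‖u‖ ^ 2 + t * ‖u - w‖ ^ 2 - t * (1 - t) * ‖w‖ ^ 2 := fun u w => by
    rw [norm_sub_sq_real, norm_sub_sq_real, norm_smul, inner_smul_right, mul_pow, Real.norm_eq_abs,
      sq_abs]
    ring
  have e1 : p - ((1 - t) • x + t • y) = (p - x) - t • (y - x) := by module
  have e2 : p - y = (p - x) - (y - x) := by module
  rw [dist_eq_norm, dist_eq_norm, dist_eq_norm, dist_comm x y, dist_eq_norm, e1, e2, key]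

theorem exists_planar_triangle {a b l : ℝ} (ha : 0 ≤ a) (hb : 0 ≤ b) (hl : 0 ≤ l) (h1 : a ≤ b + l)
    (h2 : b ≤ a + l) (h3 : l ≤ a + b) : ∃ p x y : EuclideanSpace ℝ (Fin 2),
      dist p x = a ∧ dist x y = l ∧ dist y p = b := by
  rcases hl.eq_or_lt with h0 | h0
  · refine ⟨!₂[a, 0], !₂[0, 0], !₂[0, 0], ?_, ?_, ?_⟩
    · simp [EuclideanSpace.dist_eq, Real.sqrt_sq_eq_abs, abs_of_nonneg ha]
    · simp [← h0]
    · have : a = b := by linarith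
      simp [EuclideanSpace.dist_eq, Real.sqrt_sq_eq_abs, Real.dist_eq, abs_of_nonneg hb, this]
  · set u := (a ^ 2 + l ^ 2 - b ^ 2) / (2 * l) with hu
    have hul : 2 * l * u = a ^ 2 + l ^ 2 - b ^ 2 := by rw [hu]; field_simp
    have hua : u ≤ a := by
      rw [hu, div_le_iff₀ (by positivity)]
      nlinarith [mul_nonneg (show 0 ≤ b + l - a by linarith) (show 0 ≤ b - l + a by linarith)]
    have hua' : -a ≤ u := by
      rw [hu, le_div_iff₀ (by positivity)]
      nlinarith [mul_nonneg (show 0 ≤ a + l - b by linarith) (show 0 ≤ b + l + a by linarith)]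
    have hv : 0 ≤ a ^ 2 - u ^ 2 := by nlinarith
    have hs := Real.sq_sqrt hv
    refine ⟨!₂[u, √(a ^ 2 - u ^ 2)], !₂[0, 0], !₂[l, 0], ?_, ?_, ?_⟩
    · rw [EuclideanSpace.dist_eq]
      simp only [Fin.sum_univ_two, Real.dist_eq, sq_abs]
      simp [hs, Real.sqrt_sq ha]
    · rw [EuclideanSpace.dist_eq]
      simp only [Fin.sum_univ_two, Real.dist_eq, sq_abs]
      simp [Real.sqrt_sq hl]
    · rw [EuclideanSpace.dist_eq]
      simp only [Fin.sum_univ_two, Real.dist_eq, sq_abs]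
      simp only [Matrix.cons_val_zero, Matrix.cons_val_one, zero_sub, neg_sq, hs]
      rw [show (l - u) ^ 2 + (a ^ 2 - u ^ 2) = b ^ 2 by linarith [sq (l - u)], Real.sqrt_sq hb]

/-- The second vertex of the quadruple is the point `z` of the side itself. Its model triangle is
degenerate, so comparison bounds `dist p z` by a distance in the plane, which Stewart's formula
computes. -/
theorem CATZeroComparison.dist_sq_le {p x y z : U} {t : ℝ} (h : CATZeroComparison p z x y)
    (ht0 : 0 ≤ t) (ht1 : t ≤ 1) (h1 : dist x z = t * dist x y) (h2 : dist z y = (1 - t) * dist x y) :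
    dist p z ^ 2 ≤ (1 - t) * dist p x ^ 2 + t * dist p y ^ 2 - t * (1 - t) * dist x y ^ 2 := by
  obtain ⟨p', x', y', e1, e2, e3⟩ := exists_planar_triangle (dist_nonneg (x := p) (y := x))
    (dist_nonneg (x := p) (y := y)) (dist_nonneg (x := x) (y := y))
    (by linarith [dist_triangle p y x, dist_comm x y]) (dist_triangle p x y)
    (by linarith [dist_triangle x p y, dist_comm x p])
  have hd1 : dist ((1 - t) • x' + t • y') x' = t * dist x y := by
    rw [dist_eq_norm, show (1 - t) • x' + t • y' - x' = t • (y' - x') by module, norm_smul,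
      ← dist_eq_norm, dist_comm y' x', e2, Real.norm_eq_abs, abs_of_nonneg ht0]
  have hd2 : dist y' ((1 - t) • x' + t • y') = (1 - t) * dist x y := by
    rw [dist_eq_norm, show y' - ((1 - t) • x' + t • y') = (1 - t) • (y' - x') by module, norm_smul,
      Real.norm_eq_abs, abs_of_nonneg (by linarith), ← dist_eq_norm, dist_comm y' x', e2]
  have key := h p' ((1 - t) • x' + t • y') x' y' ⟨e1, e2, by rw [e3, dist_comm]⟩
    ⟨by rw [hd1, dist_comm z x, h1], e2, by rw [hd2, dist_comm y z, h2]⟩ ((1 - t) • x' + t • y')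
    ⟨1 - t, t, by linarith, ht0, by ring, rfl⟩
  rw [dist_self, add_zero] at key
  rw [dist_comm] at e3
  calc dist p z ^ 2 ≤ dist p' ((1 - t) • x' + t • y') ^ 2 := by gcongr
    _ = _ := by rw [dist_sq_affine, e1, e2, e3]

/-- The median inequality is used twice, for `b'` against `[a b]` and for `m` against `[a b']`; all
terms but `dist b b' ^ 2 / 4` cancel. -/
theorem UniformlyCATZero.dist_mid_le {o : U} {R r : ℝ} (h : UniformlyCATZero o R r) {a b b' m m' : U}
    (ha : dist o a ≤ R) (hab : dist a b ≤ r) (hab' : dist a b' ≤ r) (hm : IsMid a b m)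
    (hm' : IsMid a b' m') : 2 * dist m m' ≤ dist b b' := by
  have h0 : dist a a ≤ r := by rw [dist_self]; exact dist_nonneg.trans hab
  have hma : dist a m ≤ r := by rw [hm.1]; linarith [dist_nonneg (x := a) (y := b)]
  have hma' : dist a m' ≤ r := by rw [hm'.1]; linarith [dist_nonneg (x := a) (y := b')]
  have e1 := (h a ha b' m a b hab' hma h0 hab).dist_sq_le (t := 1 / 2) (by norm_num) (by norm_num)
    (by rw [hm.1]; ring) (by rw [hm.2]; ring)
  have e2 := (h a ha m m' a b' hma hma' h0 hab').dist_sq_le (t := 1 / 2) (by norm_num) (by norm_num)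
    (by rw [hm'.1]; ring) (by rw [hm'.2]; ring)
  rw [dist_comm m a, hm.1, dist_comm m b'] at e2
  rw [dist_comm b' a, dist_comm b' b] at e1
  exact abs_le_of_sq_le_sq' (by nlinarith) dist_nonneg |>.2

theorem UniformlyCATZero.midNonexpanding {o : U} {R r : ℝ} (h : UniformlyCATZero o R r) :
    MidNonexpanding o R r := fun a b b' m m' ha hab hab' hm hm' => by
  linarith [h.dist_mid_le ha hab hab' hm hm', dist_nonneg (x := m) (y := m')]

/-- The cosine centred at `N / 2` solves `f i + f (i + 2) = 2 * cos (Λ / N) * f (i + 1)`. As `Λ <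
π`, it is at least `cos (Λ / 2) > 0` on the whole range, which gives `M`. -/
theorem exists_weights {N : ℕ} (hN : 2 ≤ N) {Λ : ℝ} (h0 : 0 < Λ) (hΛ : Λ < Real.pi) {k : ℝ}
    (hk : 2 * Real.cos (Λ / N) < k) : ∃ (f : ℕ → ℝ) (M : ℝ), 0 < M ∧ (∀ i ≤ N, f i ≤ 1) ∧
      (∀ i ≤ N, 1 ≤ M * f i) ∧ ∀ i, i + 2 ≤ N → f i + f (i + 2) < k * f (i + 1) := by
  have hN' : (0 : ℝ) < N := by exact_mod_cast (show 0 < N by omega)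
  have hc : 0 < Real.cos (Λ / 2) := Real.cos_pos_of_mem_Ioo ⟨by linarith, by linarith⟩
  have hf : ∀ i ≤ N, Real.cos (Λ / 2) ≤ Real.cos (Λ / N * (i - N / 2)) := fun i hi => by
    rw [← Real.cos_abs (Λ / N * (i - N / 2))]
    have hi' : (i : ℝ) ≤ N := by exact_mod_cast hi
    refine Real.cos_le_cos_of_nonneg_of_le_pi (abs_nonneg _) (by linarith) ?_
    rw [abs_mul, abs_of_pos (by positivity : 0 < Λ / N)]
    calc Λ / N * |(i : ℝ) - N / 2| ≤ Λ / N * (N / 2) := by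
          gcongr
          rw [abs_le]
          constructor <;> linarith [Nat.cast_nonneg (α := ℝ) i]
      _ = Λ / 2 := by field_simp
  refine ⟨fun i => Real.cos (Λ / N * (i - N / 2)), 1 / Real.cos (Λ / 2), by positivity,
    fun i _ => Real.cos_le_one _, fun i hi => ?_, fun i hi => ?_⟩
  · rw [div_mul_eq_mul_div, one_mul, le_div_iff₀ hc, one_mul]
    exact hf i hi
  · have e : Real.cos (Λ / N * (i - N / 2)) + Real.cos (Λ / N * ((i + 2 : ℕ) - N / 2)) =
        2 * Real.cos (Λ / N) * Real.cos (Λ / N * ((i + 1 : ℕ) - N / 2)) := by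
      rw [show Λ / N * ((i : ℝ) - N / 2) = Λ / N * ((i + 1 : ℕ) - N / 2) - Λ / N by push_cast; ring,
        show Λ / N * (((i + 2 : ℕ) : ℝ) - N / 2) = Λ / N * ((i + 1 : ℕ) - N / 2) + Λ / N by
          push_cast; ring, Real.cos_sub, Real.cos_add]
      ring
    simp only
    rw [e]
    have := hf (i + 1) (by omega)
    exact mul_lt_mul_of_pos_right hk (by linarith)

theorem UniformlyCATZero.exists_chainScale {o : U} {R r : ℝ} (h : UniformlyCATZero o R r) (hr : 0 < r)
    {L : ℝ} (hL : 0 ≤ L) (N₀ : ℕ) :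
    ∃ S : ChainScale U, S.o = o ∧ S.R = R ∧ S.L = L ∧ S.ρ ≤ 1 ∧ N₀ ≤ S.N := by
  obtain ⟨n, hn⟩ := exists_nat_gt (4 * L / r)
  set N := max (max N₀ 2) n with hN
  have hN2 : 2 ≤ N := (le_max_right _ _).trans (le_max_left _ _)
  have hN' : (0 : ℝ) < N := by exact_mod_cast (show 0 < N by omega)
  have hNL : L / N ≤ r / 4 := by
    have h1 : 4 * L / r < N := hn.trans_le (by exact_mod_cast le_max_right _ _)
    rw [div_lt_iff₀ hr] at h1
    rw [div_le_iff₀ hN']; linarith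
  have hpi := Real.pi_gt_three
  have hcos : 2 * Real.cos (1 / N) < 2 := by
    have : Real.cos (1 / N) < Real.cos 0 := by
      refine Real.cos_lt_cos_of_nonneg_of_le_pi le_rfl ?_ (by positivity)
      have : (1 : ℝ) / N ≤ 1 := by
        rw [div_le_one hN']; exact_mod_cast (show 1 ≤ N by omega)
      linarith
    rw [Real.cos_zero] at this
    linarith
  obtain ⟨f, M, hM, hf1, hf2, hf3⟩ := exists_weights hN2 one_pos (by linarith) hcos
  -- With `L / N` and `ρ` at most `r / 4`, the pairs in `contract` are at distance at most `r`.
  refine ⟨⟨o, R, N, L, min 1 (r / 4), 2, M, f, hN2, hL, by positivity, two_pos, hM, hf1, hf2, hf3, ?_⟩,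
    rfl, rfl, rfl, min_le_left _ _, (le_max_left _ _).trans (le_max_left _ _)⟩
  intro a b b' m m' ha hab hab' _ hm hm'
  have : min 1 (r / 4) ≤ r / 4 := min_le_right _ _
  exact h.dist_mid_le ha (by linarith) (by linarith) hm hm'

theorem cos_sphericalDist (a b : UnitTwoSphere) :
    Real.cos (sphericalDist a b) = inner ℝ (a : EuclideanSpace ℝ (Fin 3)) (b : EuclideanSpace ℝ (Fin 3)) := by
  rw [sphericalDist, InnerProductGeometry.cos_angle, norm_eq_of_mem_sphere, norm_eq_of_mem_sphere]
  simp

theorem sphericalDist_nonneg (a b : UnitTwoSphere) : 0 ≤ sphericalDist a b :=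
  InnerProductGeometry.angle_nonneg _ _

theorem sphericalDist_le_pi (a b : UnitTwoSphere) : sphericalDist a b ≤ Real.pi :=
  InnerProductGeometry.angle_le_pi _ _

theorem sphericalDist_comm (a b : UnitTwoSphere) : sphericalDist a b = sphericalDist b a :=
  InnerProductGeometry.angle_comm _ _

theorem sphericalDist_eq {a b : UnitTwoSphere} {θ : ℝ} (h0 : 0 ≤ θ) (h1 : θ ≤ Real.pi)
    (h : inner ℝ (a : EuclideanSpace ℝ (Fin 3)) (b : EuclideanSpace ℝ (Fin 3)) = Real.cos θ) :
    sphericalDist a b = θ :=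
  Real.injOn_cos ⟨sphericalDist_nonneg a b, sphericalDist_le_pi a b⟩ ⟨h0, h1⟩
    (by rw [cos_sphericalDist, h])

/-- A point of the sphere given by its coordinates. -/
def spherePoint (u v w : ℝ) (h : u ^ 2 + v ^ 2 + w ^ 2 = 1) : UnitTwoSphere :=
  ⟨!₂[u, v, w], by
    rw [mem_sphere_zero_iff_norm, EuclideanSpace.norm_eq]
    simp [Fin.sum_univ_three, h]⟩

theorem inner_spherePoint {u v w u' v' w' : ℝ} (h : u ^ 2 + v ^ 2 + w ^ 2 = 1)
    (h' : u' ^ 2 + v' ^ 2 + w' ^ 2 = 1) :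
    inner ℝ (spherePoint u v w h : EuclideanSpace ℝ (Fin 3))
      (spherePoint u' v' w' h' : EuclideanSpace ℝ (Fin 3)) = u * u' + v * v' + w * w' := by
  simp [spherePoint, PiLp.inner_apply, Fin.sum_univ_three]
  ring

/-- The spherical analogue of Stewart's formula, obtained from comparison with a degenerate triangle
for `z` and explicit coordinates with `x', y', z'` on the equator. The products avoid dividing by a
sine that may vanish. -/
theorem CATOneComparison.sin_mul_cos_le {p x y z : U} (h : CATOneComparison p z x y)
    (hxy : dist x y ≤ 1) (hpx : dist p x ≤ 1) (hpy : dist p y ≤ 1)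
    (hz : dist x z + dist z y = dist x y) :
    Real.sin (dist z y) * Real.cos (dist p x) + Real.sin (dist x z) * Real.cos (dist p y) ≤
      Real.sin (dist x y) * Real.cos (dist p z) := by
  have hpi := Real.pi_gt_three
  set l := dist x y with hl
  set s := dist x z with hs
  set a := dist p x with ha
  set b := dist p y with hb
  have hzy : dist z y = l - s := by linarith
  have hzy0 : 0 ≤ l - s := by rw [← hzy]; exact dist_nonneg
  have hs0 : 0 ≤ s := dist_nonneg
  have ha0 : 0 ≤ a := dist_nonneg
  have hb0 : 0 ≤ b := dist_nonneg
  rw [hzy]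
  have hl0 : 0 ≤ l := dist_nonneg
  rcases hl0.eq_or_lt with h0 | h0
  · have h1 : s = 0 := by linarith
    simp [← h0, h1]
  have hsin : 0 < Real.sin l := Real.sin_pos_of_pos_of_lt_pi h0 (by linarith)
  have t1 : a ≤ b + l := by rw [ha, hb, hl, dist_comm x y]; exact dist_triangle _ _ _
  have t2 : b ≤ a + l := by rw [ha, hb, hl]; exact dist_triangle _ _ _
  have t3 : l ≤ a + b := by rw [ha, hb, hl, dist_comm p x]; exact dist_triangle _ _ _
  have c1 : Real.cos (a + l) ≤ Real.cos b :=
    Real.cos_le_cos_of_nonneg_of_le_pi hb0 (by linarith) t2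
  have c2 : Real.cos b ≤ Real.cos (a - l) := by
    rw [← Real.cos_abs (a - l)]
    exact Real.cos_le_cos_of_nonneg_of_le_pi (abs_nonneg _) (by linarith)
      (abs_le.2 ⟨by linarith, by linarith⟩)
  rw [Real.cos_add] at c1
  rw [Real.cos_sub] at c2
  -- The second coordinate of `p'` is forced by its inner products with `x'` and `y'`; the triangle
  -- inequalities bound it by `sin a`, which leaves room for the third coordinate.
  set B := (Real.cos b - Real.cos a * Real.cos l) / Real.sin l with hB
  have hBl : B * Real.sin l = Real.cos b - Real.cos a * Real.cos l := by rw [hB]; field_simp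
  have hB1 : B ≤ Real.sin a := by
    rw [hB, div_le_iff₀ hsin]; linarith
  have hB2 : -Real.sin a ≤ B := by
    rw [hB, le_div_iff₀ hsin]; linarith
  have hC : 0 ≤ Real.sin a ^ 2 - B ^ 2 := by nlinarith
  have hCs := Real.sq_sqrt hC
  set C := √(Real.sin a ^ 2 - B ^ 2) with hCdef
  have sa := Real.sin_sq_add_cos_sq a
  set p' := spherePoint (Real.cos a) B C (by linarith) with hp'
  set x' := spherePoint 1 0 0 (by norm_num) with hx'
  set y' := spherePoint (Real.cos l) (Real.sin l) 0 (by linarith [Real.sin_sq_add_cos_sq l]) with hy'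
  set z' := spherePoint (Real.cos s) (Real.sin s) 0 (by linarith [Real.sin_sq_add_cos_sq s]) with hz'
  have m1 : sphericalDist p' x' = a := sphericalDist_eq ha0 (by linarith) (by
    rw [hp', hx', inner_spherePoint]; ring)
  have m2 : sphericalDist x' y' = l := sphericalDist_eq hl0 (by linarith) (by
    rw [hy', hx', inner_spherePoint]; ring)
  have m3 : sphericalDist y' p' = b := sphericalDist_eq hb0 (by linarith) (by
    rw [hy', hp', inner_spherePoint]; linarith)
  have m4 : sphericalDist z' x' = s := sphericalDist_eq hs0 (by linarith) (by
    rw [hz', hx', inner_spherePoint]; ring)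
  have m5 : sphericalDist y' z' = l - s := sphericalDist_eq hzy0 (by linarith) (by
    rw [hz', hy', inner_spherePoint, Real.cos_sub]; ring)
  have m6 : Real.cos (sphericalDist p' z') = Real.cos a * Real.cos s + B * Real.sin s := by
    rw [cos_sphericalDist, hp', hz', inner_spherePoint]; ring
  have m7 : sphericalDist z' z' = 0 := sphericalDist_eq le_rfl (by linarith) (by
    rw [hz', inner_spherePoint, Real.cos_zero]; linarith [Real.sin_sq_add_cos_sq s])
  have key := h p' z' x' y'
    ⟨by rw [← ha, ← hl, dist_comm y p, ← hb]; linarith, m1, m2, by rw [m3, hb, dist_comm]⟩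
    ⟨by rw [dist_comm z x, ← hs, ← hl, dist_comm y z, hzy]; linarith, by rw [m4, hs, dist_comm], m2,
      by rw [m5, dist_comm y z, hzy]⟩ z' (by
        rw [sphericalSegment, mem_ofPred_eq, sphericalDist_comm x' z', m4, sphericalDist_comm z' y', m5,
          m2]; ring)
  rw [m7, add_zero] at key
  have hc := Real.cos_le_cos_of_nonneg_of_le_pi dist_nonneg (sphericalDist_le_pi p' z') key
  rw [m6] at hc
  calc Real.sin (l - s) * Real.cos a + Real.sin s * Real.cos b =
        Real.sin l * (Real.cos a * Real.cos s + B * Real.sin s) := by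
        rw [Real.sin_sub]
        linear_combination (-Real.sin s) * hBl
    _ ≤ _ := by gcongr

theorem CATOneComparison.cos_mid_le {p x y m : U} (h : CATOneComparison p m x y)
    (hxy : dist x y ≤ 1) (hpx : dist p x ≤ 1) (hpy : dist p y ≤ 1) (hm : IsMid x y m) :
    Real.cos (dist p x) + Real.cos (dist p y) ≤
      2 * Real.cos (dist x y / 2) * Real.cos (dist p m) := by
  have key := h.sin_mul_cos_le hxy hpx hpy (by rw [hm.1, hm.2]; ring)
  rw [hm.1, hm.2] at key
  have h0 : 0 ≤ dist x y := dist_nonneg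
  rcases h0.eq_or_lt with h0 | h0
  · have e1 : x = y := dist_eq_zero.1 h0.symm
    have e2 : x = m := dist_eq_zero.1 (by rw [hm.1, ← h0]; simp)
    subst e1; subst e2
    rw [dist_self]; simp; linarith
  · have hs : 0 < Real.sin (dist x y / 2) :=
      Real.sin_pos_of_pos_of_lt_pi (by linarith) (by linarith [Real.pi_gt_three])
    have e : Real.sin (dist x y) = 2 * Real.sin (dist x y / 2) * Real.cos (dist x y / 2) := by
      rw [← Real.sin_two_mul]; ring_nf
    rw [e] at key
    refine le_of_mul_le_mul_left (a := Real.sin (dist x y / 2)) ?_ hs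
    linarith

/-- The spherical median inequality is applied twice, as in the flat case, and rewritten with half
angles. Halving the base loses the factor `cos t`. -/
theorem UniformlyCATOne.sin_mid_le {o : U} {R r : ℝ} (h : UniformlyCATOne o R r) (hr : r ≤ 1 / 2)
    {a b b' m m' : U} (ha : dist o a ≤ R) (hab : dist a b ≤ r) (hab' : dist a b' ≤ r)
    (hm : IsMid a b m) (hm' : IsMid a b' m') {t : ℝ} (ht : t ≤ 1 / 2) (hab2 : dist a b ≤ 2 * t)
    (hab2' : dist a b' ≤ 2 * t) :
    2 * Real.cos t * Real.sin (dist m m' / 2) ≤ Real.sin (dist b b' / 2) := by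
  have hpi := Real.pi_gt_three
  have n1 : 0 ≤ dist a b := dist_nonneg
  have n2 : 0 ≤ dist a b' := dist_nonneg
  have h0 : dist a a ≤ r := by rw [dist_self]; exact dist_nonneg.trans hab
  have hma : dist a m ≤ r := by rw [hm.1]; linarith
  have hma' : dist a m' ≤ r := by rw [hm'.1]; linarith
  have bb1 : dist b b' ≤ 1 := by linarith [dist_triangle_left b b' a]
  have e1 := (h a ha b' m a b hab' hma h0 hab).cos_mid_le (by linarith)
    (by rw [dist_comm]; linarith) (by rw [dist_comm]; exact bb1) hm
  have e2 := (h a ha m m' a b' hma hma' h0 hab').cos_mid_le (by linarith)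
    (by rw [dist_comm]; linarith) (by linarith [dist_triangle_left m b' a]) hm'
  rw [dist_comm m a, hm.1, dist_comm m b'] at e2
  rw [dist_comm b' a, dist_comm b' b] at e1
  set α := dist a b / 2 with hα
  set β := dist a b' / 2 with hβ
  have hA : Real.cos t ≤ Real.cos α :=
    Real.cos_le_cos_of_nonneg_of_le_pi (by positivity) (by linarith) (by linarith)
  have hB : Real.cos t ≤ Real.cos β :=
    Real.cos_le_cos_of_nonneg_of_le_pi (by positivity) (by linarith) (by linarith)
  have ht0 : 0 < Real.cos t := Real.cos_pos_of_mem_Ioo ⟨by linarith, by linarith⟩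
  have eβ : Real.cos (dist a b') = 2 * Real.cos β ^ 2 - 1 := by
    rw [← Real.cos_two_mul, hβ]; ring_nf
  have ec : Real.cos (dist b b') = 1 - 2 * Real.sin (dist b b' / 2) ^ 2 := by
    have := Real.cos_two_mul (dist b b' / 2)
    rw [show 2 * (dist b b' / 2) = dist b b' by ring] at this
    linarith [Real.sin_sq_add_cos_sq (dist b b' / 2)]
  have em : Real.cos (dist m m') = 1 - 2 * Real.sin (dist m m' / 2) ^ 2 := by
    have := Real.cos_two_mul (dist m m' / 2)
    rw [show 2 * (dist m m' / 2) = dist m m' by ring] at this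
    linarith [Real.sin_sq_add_cos_sq (dist m m' / 2)]
  rw [eβ, ec] at e1
  rw [em] at e2
  set A := Real.cos α with hAdef
  set B := Real.cos β with hBdef
  set C := Real.cos t with hCdef
  set μ := Real.sin (dist m m' / 2) with hμ
  set ν := Real.sin (dist b b' / 2) with hν
  have hA0 : 0 < A := by linarith
  have k1 : 2 * A * (A + Real.cos (dist b' m)) ≤ 2 * A * (2 * B * (1 - 2 * μ ^ 2)) := by gcongr
  -- Combining both inequalities leaves a term `(A - B) ^ 2` of favourable sign.
  have k2 : 4 * (A * B) * μ ^ 2 ≤ ν ^ 2 := by nlinarith [sq_nonneg (A - B)]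
  have k3 : C * C ≤ A * B := by gcongr
  have k4 : (2 * C * μ) ^ 2 ≤ ν ^ 2 := by nlinarith [sq_nonneg μ]
  have hν0 : 0 ≤ ν := Real.sin_nonneg_of_nonneg_of_le_pi (by positivity) (by linarith)
  exact abs_le_of_sq_le_sq' k4 hν0 |>.2

theorem UniformlyCATOne.midNonexpanding {o : U} {R r : ℝ} (h : UniformlyCATOne o R r)
    (hr : r ≤ 1 / 2) : MidNonexpanding o R r := fun a b b' m m' ha hab hab' hm hm' => by
  have hpi := Real.pi_gt_three
  have key := h.sin_mid_le hr ha hab hab' hm hm' (t := 1 / 2) le_rfl (by linarith) (by linarith)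
  have hc : 1 / 2 ≤ Real.cos (1 / 2) := by
    refine Real.cos_pi_div_three.symm.le.trans ?_
    exact Real.cos_le_cos_of_nonneg_of_le_pi (by norm_num) (by linarith) (by linarith)
  have bb1 : dist b b' ≤ 1 := by linarith [dist_triangle_left b b' a]
  have hma : dist a m ≤ r := by rw [hm.1]; linarith [dist_nonneg (x := a) (y := b)]
  have hma' : dist a m' ≤ r := by rw [hm'.1]; linarith [dist_nonneg (x := a) (y := b')]
  have mm1 : dist m m' ≤ 1 := by linarith [dist_triangle_left m m' a]
  have hs : 0 ≤ Real.sin (dist m m' / 2) :=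
    Real.sin_nonneg_of_nonneg_of_le_pi (by positivity) (by linarith)
  have hle : Real.sin (dist m m' / 2) ≤ Real.sin (dist b b' / 2) := by nlinarith
  by_contra! hlt
  have := Real.sin_lt_sin_of_lt_of_le_pi_div_two (x := dist b b' / 2) (y := dist m m' / 2)
    (by linarith [dist_nonneg (x := b) (y := b')]) (by linarith) (by linarith)
  linarith

theorem mul_cos_le_sin {x : ℝ} (h0 : 0 ≤ x) (h1 : x < Real.pi / 2) : x * Real.cos x ≤ Real.sin x := by
  have hc : 0 < Real.cos x := Real.cos_pos_of_mem_Ioo ⟨by linarith, h1⟩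
  have := Real.le_tan h0 h1
  rwa [Real.tan_eq_sin_div_cos, le_div_iff₀ hc] at this

/-- Midpoints contract by the factor `2 * cos (L / N)` up to errors that vanish with `ρ`. Weights
for a slightly larger angle, still below `π`, therefore satisfy the strict inequality. -/
theorem UniformlyCATOne.exists_chainScale {o : U} {R r : ℝ} (h : UniformlyCATOne o R r) (hr : 0 < r)
    (hr' : r ≤ 1 / 2) {L : ℝ} (hL : 0 ≤ L) (hLpi : L < Real.pi) (N₀ : ℕ) :
    ∃ S : ChainScale U, S.o = o ∧ S.R = R ∧ S.L = L ∧ S.ρ ≤ 1 ∧ N₀ ≤ S.N := by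
  have hpi := Real.pi_gt_three
  obtain ⟨n, hn⟩ := exists_nat_gt (4 * L / r)
  set N := max (max N₀ 2) n with hN
  have hN2 : 2 ≤ N := (le_max_right _ _).trans (le_max_left _ _)
  have hN' : (0 : ℝ) < N := by exact_mod_cast (show 0 < N by omega)
  have hNL : L / N ≤ r / 4 := by
    have h1 : 4 * L / r < N := hn.trans_le (by exact_mod_cast le_max_right _ _)
    rw [div_lt_iff₀ hr] at h1
    rw [div_le_iff₀ hN']; linarith
  -- Here `L < Λ₁ < Λ₂ < π`. The first gap absorbs `ρ` and the passage from sines to distances, the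
  -- second makes `f_lt` strict.
  obtain ⟨Λ₁, hΛ1, hΛ1'⟩ := exists_between hLpi
  obtain ⟨Λ₂, hΛ2, hΛ2'⟩ := exists_between hΛ1'
  have hNge : (2 : ℝ) ≤ N := by exact_mod_cast hN2
  have hdiv : ∀ Λ, Λ < Real.pi → Λ / N < Real.pi / 2 := fun Λ hΛ => by
    rw [div_lt_iff₀ hN']; nlinarith
  have hcos0 : 0 < Real.cos (Λ₁ / N) := Real.cos_pos_of_mem_Ioo
    ⟨by have : 0 < Λ₁ / N := by have : 0 < Λ₁ := by linarith
                                positivity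
        linarith, hdiv _ hΛ1'⟩
  have hcos : 2 * Real.cos (Λ₂ / N) < 2 * Real.cos (Λ₁ / N) := by
    have : Real.cos (Λ₂ / N) < Real.cos (Λ₁ / N) := by
      have : 0 < Λ₁ := by linarith
      refine Real.cos_lt_cos_of_nonneg_of_le_pi (by positivity) ?_ (by gcongr)
      linarith [hdiv _ hΛ2']
    linarith
  obtain ⟨f, M, hM, hf1, hf2, hf3⟩ := exists_weights hN2 (by linarith) hΛ2' hcos
  have hlim : ∀ᶠ ρ in 𝓝[>] (0 : ℝ), Real.cos (Λ₁ / N) < Real.cos (L / N + ρ) * Real.cos (ρ / 2) := by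
    have hcont : Continuous fun ρ : ℝ => Real.cos (L / N + ρ) * Real.cos (ρ / 2) := by fun_prop
    have h0 : Real.cos (Λ₁ / N) < Real.cos (L / N + 0) * Real.cos (0 / 2) := by
      simp only [add_zero, zero_div, Real.cos_zero, mul_one]
      refine Real.cos_lt_cos_of_nonneg_of_le_pi (by positivity) ?_ (by gcongr)
      linarith [hdiv _ hΛ1']
    exact nhdsWithin_le_nhds (hcont.continuousAt.eventually_const_lt h0)
  have hlim2 : ∀ᶠ ρ in 𝓝[>] (0 : ℝ), ρ < r / 4 :=
    nhdsWithin_le_nhds (eventually_lt_nhds (by positivity))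
  obtain ⟨ρ, ⟨hρ1, hρ2⟩, hρ0⟩ := ((hlim.and hlim2).and self_mem_nhdsWithin).exists
  have hρ0 : 0 < ρ := hρ0
  refine ⟨⟨o, R, N, L, ρ, 2 * Real.cos (Λ₁ / N), M, f, hN2, hL, hρ0, by positivity, hM, hf1, hf2, hf3,
    ?_⟩, rfl, rfl, rfl, by show ρ ≤ 1; linarith, (le_max_left _ _).trans (le_max_left _ _)⟩
  intro a b b' m m' ha hab hab' hbb hm hm'
  have hab1 : dist a b ≤ r := by linarith
  have hab1' : dist a b' ≤ r := by linarith
  have key := h.sin_mid_le hr' ha hab1 hab1' hm hm' (t := L / N + ρ) (by linarith) (by linarith)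
    (by linarith)
  have hmm := h.midNonexpanding hr' a b b' m m' ha hab1 hab1' hm hm'
  have n0 : 0 ≤ dist m m' := dist_nonneg
  have s1 := Real.sin_le (x := dist b b' / 2) (by positivity)
  have s2 := mul_cos_le_sin (x := dist m m' / 2) (by positivity) (by linarith)
  have s3 : Real.cos (ρ / 2) ≤ Real.cos (dist m m' / 2) :=
    Real.cos_le_cos_of_nonneg_of_le_pi (by positivity) (by linarith) (by linarith)
  have c0 : 0 < Real.cos (L / N + ρ) :=
    Real.cos_pos_of_mem_Ioo ⟨by have : 0 ≤ L / N := by positivity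
                                linarith, by linarith⟩
  calc 2 * Real.cos (Λ₁ / N) * dist m m'
      ≤ 2 * (Real.cos (L / N + ρ) * Real.cos (ρ / 2)) * dist m m' := by gcongr
    _ ≤ 2 * (Real.cos (L / N + ρ) * Real.cos (dist m m' / 2)) * dist m m' := by gcongr
    _ = 2 * (2 * Real.cos (L / N + ρ) * (dist m m' / 2 * Real.cos (dist m m' / 2))) := by ring
    _ ≤ 2 * (2 * Real.cos (L / N + ρ) * Real.sin (dist m m' / 2)) := by gcongr
    _ ≤ dist b b' := by linarith

end Local

/-! ### Uniqueness of geodesics from contractibility of bigons -/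

/-- The closed curve running along `γ₀` and back along `γ₁`. -/
noncomputable def bigonLoop {U : Type*} (γ₀ γ₁ : ℝ → U) (ℓ : ℝ) (t : ℝ) : U :=
  if t ≤ 1 / 2 then γ₀ (2 * t * ℓ) else γ₁ ((2 - 2 * t) * ℓ)

theorem bigonLoop_left {U : Type*} {γ₀ γ₁ : ℝ → U} {ℓ t : ℝ} (ht : t ≤ 1 / 2) :
    bigonLoop γ₀ γ₁ ℓ t = γ₀ (2 * t * ℓ) := if_pos ht

section Uniqueness

variable {U : Type*} [MetricSpace U]

/-- The homotopy is sampled at finitely many times so finely that edges have length at most `δ`. The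
predicate `adm` says for which lengths chain scales exist. In `hper` the bounds may depend on the
grid: inscribed perimeters are continuous in `s`, whereas lengths of curves are not. -/
theorem IsGeodesic.eq_of_homotopy [ProperSpace U] (hB : HasBetween U) {adm : ℝ → Prop}
    (hmid : ∀ (o : U) (R : ℝ), ∃ r : ℝ, 0 < r ∧ MidNonexpanding o R r)
    (hscale : ∀ (o : U) (R L : ℝ), 0 ≤ L → adm L → ∀ N₀ : ℕ,
      ∃ S : ChainScale U, S.o = o ∧ S.R = R ∧ S.L = L ∧ S.ρ ≤ 1 ∧ N₀ ≤ S.N)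
    {γ₀ γ₁ : ℝ → U} {x y : U} (h₀ : IsGeodesic γ₀ x y) (h₁ : IsGeodesic γ₁ x y)
    {h : unitInterval → unitInterval → U}
    (hc : Continuous fun z : unitInterval × unitInterval => h z.1 z.2)
    (h0a : ∀ t : unitInterval, (t : ℝ) ≤ 1 / 2 → h 0 t = γ₀ (2 * t * dist x y))
    (h0b : ∀ t : unitInterval, 1 / 2 ≤ (t : ℝ) → h 0 t = γ₁ ((2 - 2 * t) * dist x y))
    (hclosed : ∀ s, h s 1 = h s 0) (hconst : ∀ t, h 1 t = h 1 0)
    (hper : ∀ u : ℕ → unitInterval, Monotone u → ∀ n : ℕ, ∃ l L, l < L ∧ adm L ∧ dist x y ≤ l ∧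
      ∀ s, ∑ j ∈ Finset.range n, dist (h s (u j)) (h s (u (j + 1))) ≤ 2 * l) :
    ∀ t ∈ Icc 0 (dist x y), γ₀ t = γ₁ t := by
  set ℓ := dist x y with hℓ
  have hℓ0 : 0 ≤ ℓ := dist_nonneg
  have huc := CompactSpace.uniformContinuous_of_continuous hc
  rw [Metric.uniformContinuous_iff] at huc
  obtain ⟨R₀, hR₀⟩ := (isCompact_range hc).isBounded.subset_closedBall x
  have hR₀' : ∀ s t, dist x (h s t) ≤ R₀ := fun s t => by
    have := hR₀ (mem_range_self (s, t))
    rwa [Metric.mem_closedBall, dist_comm] at this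
  obtain ⟨r, hr, hmidr⟩ := hmid x (R₀ + ℓ + 1)
  set δ := min (r / 2) 1 with hδ
  have hδ0 : 0 < δ := by positivity
  have hδr : 2 * δ ≤ r := by have : δ ≤ r / 2 := min_le_left _ _
                             linarith
  obtain ⟨δ', hδ', hcl⟩ := huc δ hδ0
  obtain ⟨k, hk⟩ := exists_nat_one_div_lt hδ'
  set n := k + 1 with hn
  have hn' : (0 : ℝ) < n := by positivity
  set u : ℕ → unitInterval := fun j => projIcc (0 : ℝ) 1 zero_le_one (j / (2 * n)) with hu
  have hcast : ∀ j ≤ 2 * n, (j / (2 * n) : ℝ) ∈ Icc (0 : ℝ) 1 := fun j hj => by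
    refine ⟨by positivity, ?_⟩
    rw [div_le_one (by positivity)]; exact_mod_cast hj
  have huj : ∀ j ≤ 2 * n, ((u j : unitInterval) : ℝ) = j / (2 * n) := fun j hj => by
    simp only [hu]
    rw [projIcc_of_mem _ (hcast j hj)]
  have humono : Monotone u := fun i j hij => monotone_projIcc _ (by gcongr)
  obtain ⟨l, L, hlL, hadm, hxl, hsum⟩ := hper u humono (2 * n)
  have hu0 : u 0 = 0 := Subtype.ext (by rw [huj 0 (Nat.zero_le _)]; simp)
  have hun : u (2 * n) = 1 := Subtype.ext (by
    rw [huj _ le_rfl]; push_cast; rw [div_self (by positivity)])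
  have hp0 : projIcc (0 : ℝ) 1 zero_le_one 0 = 0 := projIcc_left _
  have hp1 : projIcc (0 : ℝ) 1 zero_le_one 1 = 1 := projIcc_right _
  refine h₀.eq_of_family hB h₁ (o := x) (R := R₀ + L + 2) (R' := R₀ + ℓ + 1) (δ := δ) (l := l)
    (L := L) (n := n) (by omega) (Q := fun s j => h (projIcc (0 : ℝ) 1 zero_le_one s) (u j)) hδ0
    (fun a b b' m m' ha hab hab' => hmidr a b b' m m' ha (hab.trans hδr) (hab'.trans hδr)) hlL hxl
    (fun N₀ => hscale x _ L (by linarith) hadm N₀) ?_ ?_ ?_ ?_ ?_ ?_ ?_ ?_ ?_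
  · intro s _ j _
    have : δ ≤ 1 := min_le_right _ _
    linarith [hR₀' (projIcc (0 : ℝ) 1 zero_le_one s) (u j)]
  · intro s _ j _
    have : δ ≤ 1 := min_le_right _ _
    linarith [hR₀' (projIcc (0 : ℝ) 1 zero_le_one s) (u j)]
  · intro s _ j hj
    refine (hcl (a := (_, u j)) (b := (_, u (j + 1))) ?_).le
    rw [Prod.dist_eq, dist_self, max_eq_right dist_nonneg, Subtype.dist_eq, huj _ hj.le, huj _ hj,
      Real.dist_eq]
    have : (j : ℝ) / (2 * n) - ((j + 1 : ℕ) : ℝ) / (2 * n) = -(1 / (2 * n)) := by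
      push_cast; field_simp; ring
    rw [this, abs_neg, abs_of_pos (by positivity)]
    refine lt_of_le_of_lt ?_ hk
    have e : (k : ℝ) + 1 = n := by rw [hn]; push_cast; ring
    rw [e]
    gcongr
    linarith
  · intro s _
    exact hsum _
  · intro s _
    simp only [hu0, hun, hclosed]
  · intro ε hε
    obtain ⟨δ₁, hδ₁, hcl₁⟩ := huc ε hε
    refine ⟨δ₁, hδ₁, fun s hs s' hs' hss j _ => ?_⟩
    rw [projIcc_of_mem _ hs, projIcc_of_mem _ hs']
    refine (hcl₁ (a := (⟨s, hs⟩, u j)) (b := (⟨s', hs'⟩, u j)) ?_).le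
    rw [Prod.dist_eq, dist_self, max_eq_left dist_nonneg]
    exact hss
  · intro j _
    simp only [hp1]
    rw [hconst (u j), hconst (u 0)]
  · intro j hj
    simp only [hp0]
    rw [h0a, huj j (by omega)]
    · congr 1; rw [hℓ]; field_simp
    · rw [huj j (by omega), div_le_div_iff₀ (by positivity) two_pos]
      have : (j : ℝ) ≤ n := by exact_mod_cast hj
      linarith
  · intro j hj
    simp only [hp0]
    have hj' : (j : ℝ) ≤ n := by exact_mod_cast hj
    have e : ((2 * n - j : ℕ) : ℝ) = 2 * n - j := by rw [Nat.cast_sub (by omega)]; push_cast; ring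
    rw [h0b, huj _ (by omega), e]
    · congr 1; field_simp; ring
    · rw [huj _ (by omega), e, div_le_div_iff₀ two_pos (by positivity)]
      linarith

theorem bigonLoop_right {γ₀ γ₁ : ℝ → U} {x y : U} (h₀ : IsGeodesic γ₀ x y) (h₁ : IsGeodesic γ₁ x y)
    {t : ℝ} (ht : 1 / 2 ≤ t) :
    bigonLoop γ₀ γ₁ (dist x y) t = γ₁ ((2 - 2 * t) * dist x y) := by
  rcases ht.eq_or_lt with h | h
  · subst h
    rw [bigonLoop_left le_rfl, show 2 * (1 / 2 : ℝ) * dist x y = dist x y by ring,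
      show (2 - 2 * (1 / 2 : ℝ)) * dist x y = dist x y by ring, h₀.right, h₁.right]
  · exact if_neg (not_le.2 h)

theorem lipschitzOnWith_bigonLoop {γ₀ γ₁ : ℝ → U} {x y : U} (h₀ : IsGeodesic γ₀ x y)
    (h₁ : IsGeodesic γ₁ x y) : LipschitzOnWith (Real.toNNReal (2 * dist x y))
      (bigonLoop γ₀ γ₁ (dist x y)) (Icc 0 1) := by
  have hℓ0 := dist_nonneg (x := x) (y := y)
  set ℓ := dist x y with hℓ
  have left : ∀ s t, 0 ≤ s → s ≤ t → t ≤ 1 / 2 →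
      dist (bigonLoop γ₀ γ₁ ℓ s) (bigonLoop γ₀ γ₁ ℓ t) ≤ 2 * ℓ * (t - s) := by
    intro s t hs hst ht
    rw [bigonLoop_left (hst.trans ht), bigonLoop_left ht,
      h₀.dist_eq _ _ (by positivity) (by gcongr) (by rw [← hℓ]; nlinarith)]
    linarith
  have right : ∀ s t, 1 / 2 ≤ s → s ≤ t → t ≤ 1 →
      dist (bigonLoop γ₀ γ₁ ℓ s) (bigonLoop γ₀ γ₁ ℓ t) ≤ 2 * ℓ * (t - s) := by
    intro s t hs hst ht
    rw [bigonLoop_right h₀ h₁ hs, bigonLoop_right h₀ h₁ (hs.trans hst), dist_comm,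
      h₁.dist_eq _ _ (by apply mul_nonneg <;> linarith) (by gcongr) (by nlinarith)]
    nlinarith
  have all : ∀ s t, 0 ≤ s → s ≤ t → t ≤ 1 →
      dist (bigonLoop γ₀ γ₁ ℓ s) (bigonLoop γ₀ γ₁ ℓ t) ≤ 2 * ℓ * (t - s) := by
    intro s t hs hst ht
    rcases le_total t (1 / 2) with h | h
    · exact left s t hs hst h
    rcases le_total s (1 / 2) with h' | h'
    · have a1 := left s (1 / 2) hs h' le_rfl
      have a2 := right (1 / 2) t le_rfl h ht
      linarith [dist_triangle (bigonLoop γ₀ γ₁ ℓ s) (bigonLoop γ₀ γ₁ ℓ (1 / 2)) (bigonLoop γ₀ γ₁ ℓ t)]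
    · exact right s t h' hst ht
  refine LipschitzOnWith.of_dist_le_mul fun s hs t ht => ?_
  rw [Real.coe_toNNReal _ (by positivity), Real.dist_eq]
  rcases le_total s t with h | h
  · rw [abs_sub_comm, abs_of_nonneg (by linarith)]
    exact all s t hs.1 h ht.2
  · rw [abs_of_nonneg (by linarith), dist_comm]
    exact all t s ht.1 h hs.2

theorem bigonLoop_zero {γ₀ γ₁ : ℝ → U} {x y : U} (h₀ : IsGeodesic γ₀ x y) :
    bigonLoop γ₀ γ₁ (dist x y) 0 = x := by
  rw [bigonLoop_left (by norm_num)]; simp [h₀.left]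

theorem bigonLoop_one {γ₀ γ₁ : ℝ → U} {x y : U} (h₀ : IsGeodesic γ₀ x y) (h₁ : IsGeodesic γ₁ x y) :
    bigonLoop γ₀ γ₁ (dist x y) 1 = x := by
  rw [bigonLoop_right h₀ h₁ (by norm_num)]; simp [h₁.left]

theorem exists_perimeter_max {h : unitInterval → unitInterval → U}
    (hc : Continuous fun z : unitInterval × unitInterval => h z.1 z.2) (u : ℕ → unitInterval) (n : ℕ) :
    ∃ s₀, ∀ s, ∑ j ∈ Finset.range n, dist (h s (u j)) (h s (u (j + 1))) ≤
      ∑ j ∈ Finset.range n, dist (h s₀ (u j)) (h s₀ (u (j + 1))) := by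
  have hcu : ∀ t, Continuous fun s => h s t := fun t => hc.comp (Continuous.prodMk_left t)
  have : Continuous fun s => ∑ j ∈ Finset.range n, dist (h s (u j)) (h s (u (j + 1))) :=
    continuous_finsetSum _ fun j _ => (hcu _).dist (hcu _)
  obtain ⟨s₀, -, hs₀⟩ := isCompact_univ.exists_isMaxOn univ_nonempty this.continuousOn
  exact ⟨s₀, fun s => hs₀ (mem_univ s)⟩

/-- The bigon is a loop, null-homotopic by simple connectedness. Chain scales exist for every
length, so the perimeter bound supplied by compactness is enough, however large. -/
theorem IsLocallyCATZero.geodesic_unique [ProperSpace U] [SimplyConnectedSpace U]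
    (hB : HasBetween U) (hU : IsLocallyCATZero U) {γ₀ γ₁ : ℝ → U} {x y : U}
    (h₀ : IsGeodesic γ₀ x y) (h₁ : IsGeodesic γ₁ x y) : ∀ t ∈ Icc 0 (dist x y), γ₀ t = γ₁ t := by
  let P : Path x x :=
    { toFun := fun t => bigonLoop γ₀ γ₁ (dist x y) t
      continuous_toFun := (lipschitzOnWith_bigonLoop h₀ h₁).continuousOn.comp_continuous
        continuous_subtype_val (fun t => t.2)
      source' := by simpa using bigonLoop_zero h₀
      target' := by simpa using bigonLoop_one h₀ h₁ }
  obtain ⟨F⟩ := SimplyConnectedSpace.paths_homotopic P (Path.refl x)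
  have hc : Continuous fun z : unitInterval × unitInterval => F (z.1, z.2) := F.continuous
  refine h₀.eq_of_homotopy hB (adm := fun _ => True) ?_ ?_ h₁ (h := fun s t => F (s, t)) hc ?_ ?_ ?_ ?_ ?_
  · intro o R
    obtain ⟨r, hr, -, h⟩ := hU.uniformly o R
    exact ⟨r, hr, h.midNonexpanding⟩
  · intro o R L hL _ N₀
    obtain ⟨r, hr, -, h⟩ := hU.uniformly o R
    exact h.exists_chainScale hr hL N₀
  · intro t ht
    rw [F.apply_zero]
    exact bigonLoop_left ht
  · intro t ht
    rw [F.apply_zero]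
    exact bigonLoop_right h₀ h₁ ht
  · intro s
    simp
  · intro t
    simp
  · intro u _ n
    obtain ⟨s₀, hs₀⟩ := exists_perimeter_max (h := fun s t => F (s, t)) hc u n
    refine ⟨max (dist x y) (∑ j ∈ Finset.range n, dist (F (s₀, u j)) (F (s₀, u (j + 1)))), _,
      lt_add_one _, trivial, le_max_left _ _, fun s => (hs₀ s).trans ?_⟩
    have h1 := le_max_right (dist x y) (∑ j ∈ Finset.range n, dist (F (s₀, u j)) (F (s₀, u (j + 1))))
    have h2 : 0 ≤ ∑ j ∈ Finset.range n, dist (F (s₀, u j)) (F (s₀, u (j + 1))) :=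
      Finset.sum_nonneg fun _ _ => dist_nonneg
    linarith

theorem sum_dist_lt_of_closedCurveLength_lt {γ : UnitAddCircle → U} {L : ℝ}
    (h : closedCurveLength γ < ENNReal.ofReal L) {u : ℕ → unitInterval} (hu : Monotone u) (n : ℕ) :
    ∑ j ∈ Finset.range n, dist (γ ((u j : ℝ) : UnitAddCircle)) (γ ((u (j + 1) : ℝ) : UnitAddCircle)) < L := by
  have h1 := eVariationOn.sum_le (f := fun t : ℝ => γ (t : UnitAddCircle)) (s := Icc 0 1) (n := n)
    (u := fun j => (u j : ℝ)) (fun i j hij => hu hij) (fun i => (u i).2)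
  have h2 := h1.trans_lt h
  simp only [edist_dist] at h2
  rw [← ENNReal.ofReal_sum_of_nonneg fun _ _ => dist_nonneg] at h2
  have h3 := (ENNReal.ofReal_lt_ofReal_iff_of_nonneg (Finset.sum_nonneg fun _ _ => dist_nonneg)).1 h2
  simpa only [dist_comm] using h3

/-- The bigon is shorter than `2 * π`, and so are all curves of the assumed homotopy; hence harmonic
chains of some length below `π` suffice. -/
theorem IsLocallyCATOne.geodesic_unique [ProperSpace U] (hB : HasBetween U) (hU : IsLocallyCATOne U)
    (hloop : ∀ γ : C(UnitAddCircle, U), closedCurveLength γ < ENNReal.ofReal (2 * Real.pi) →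
        NullHomotopicThroughShorter (2 * Real.pi) γ) {γ₀ γ₁ : ℝ → U} {x y : U}
    (h₀ : IsGeodesic γ₀ x y) (h₁ : IsGeodesic γ₁ x y) (hxy : dist x y < Real.pi) :
    ∀ t ∈ Icc 0 (dist x y), γ₀ t = γ₁ t := by
  set g := bigonLoop γ₀ γ₁ (dist x y) with hg
  have hlip := lipschitzOnWith_bigonLoop h₀ h₁
  have hℓ0 := dist_nonneg (x := x) (y := y)
  have hg0 : g 0 = x := bigonLoop_zero h₀
  have hg1 : g 1 = x := bigonLoop_one h₀ h₁
  let γ : C(UnitAddCircle, U) := ⟨AddCircle.liftIco 1 0 g,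
    AddCircle.liftIco_continuous (by rw [zero_add, hg0, hg1]) (by rw [zero_add]; exact hlip.continuousOn)⟩
  have hγ : ∀ t ∈ Icc (0 : ℝ) 1, γ (t : UnitAddCircle) = g t := by
    have hIco : ∀ t ∈ Ico (0 : ℝ) 1, γ (t : UnitAddCircle) = g t := fun t ht => by
      show AddCircle.liftIco (1 : ℝ) 0 g (t : AddCircle (1 : ℝ)) = g t
      exact AddCircle.liftIco_coe_apply (by rwa [zero_add])
    intro t ht
    rcases ht.2.eq_or_lt with h | h
    · subst h
      have e : ((1 : ℝ) : UnitAddCircle) = ((0 : ℝ) : UnitAddCircle) := by simp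
      rw [e, hg1, ← hg0]
      exact hIco 0 (by simp)
    · exact hIco t ⟨ht.1, h⟩
  have hlen : closedCurveLength γ < ENNReal.ofReal (2 * Real.pi) := by
    have e1 : closedCurveLength γ = eVariationOn (g ∘ id) (Icc 0 1) := eVariationOn.congr hγ
    rw [e1]
    refine (hlip.comp_eVariationOn_le (g := id) (s := Icc 0 1) (fun t ht => ht)).trans_lt ?_
    have e2 := (monotoneOn_id (s := Icc (0 : ℝ) 1)).eVariationOn_eq (left_mem_Icc.2 zero_le_one)
      (right_mem_Icc.2 zero_le_one)
    rw [inter_self] at e2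
    rw [e2]
    simp only [id, sub_zero, ENNReal.ofReal_one, mul_one]
    exact (ENNReal.ofReal_lt_ofReal_iff (by positivity)).2 (by linarith)
  obtain ⟨c, H, hH⟩ := hloop γ hlen
  have hc : Continuous fun z : unitInterval × unitInterval => H (z.1, ((z.2 : ℝ) : UnitAddCircle)) := by
    have : Continuous fun t : ℝ => (t : UnitAddCircle) := AddCircle.continuous_mk' 1
    fun_prop
  refine h₀.eq_of_homotopy hB (adm := fun L => L < Real.pi) ?_ ?_ h₁
    (h := fun s t => H (s, ((t : ℝ) : UnitAddCircle))) hc ?_ ?_ ?_ ?_ ?_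
  · intro o R
    obtain ⟨r, hr, hr', h⟩ := hU.uniformly o R
    exact ⟨r, hr, h.midNonexpanding hr'⟩
  · intro o R L hL hLpi N₀
    obtain ⟨r, hr, hr', h⟩ := hU.uniformly o R
    exact h.exists_chainScale hr hr' hL hLpi N₀
  · intro t ht
    rw [H.apply_zero, hγ t t.2]
    exact bigonLoop_left ht
  · intro t ht
    rw [H.apply_zero, hγ t t.2]
    exact bigonLoop_right h₀ h₁ ht
  · intro s
    simp [show ((1 : ℝ) : UnitAddCircle) = 0 from AddCircle.coe_period 1]
  · intro t
    simp
  · intro u hu n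
    -- The largest inscribed perimeter is attained at some `s₀`, so it is strictly below `2 * π`;
    -- this leaves room for `L` below `π`.
    obtain ⟨s₀, hs₀⟩ := exists_perimeter_max
      (h := fun s t => H (s, ((t : ℝ) : UnitAddCircle))) hc u n
    have hlt := sum_dist_lt_of_closedCurveLength_lt (hH s₀) hu n
    set m := ∑ j ∈ Finset.range n, dist (H (s₀, ((u j : ℝ) : UnitAddCircle)))
      (H (s₀, ((u (j + 1) : ℝ) : UnitAddCircle))) with hm
    obtain ⟨L, hL1, hL2⟩ := exists_between (show max (dist x y) (m / 2) < Real.pi from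
      max_lt hxy (by linarith))
    refine ⟨_, L, hL1, hL2, le_max_left _ _, fun s => (hs₀ s).trans ?_⟩
    have := le_max_right (dist x y) (m / 2)
    linarith

/-- Points between `x` and `y` are determined by their distance from `x`. -/
def UniqueBetween (x y : U) : Prop :=
  ∀ z z' : U, dist x z + dist z y = dist x y → dist x z' + dist z' y = dist x y →
    dist x z = dist x z' → z = z'

/-- Through any point between `x` and `y` there passes a geodesic, the concatenation of one from `x`
and one to `y`. -/
theorem uniqueBetween_of_geodesic [CompleteSpace U] (hB : HasBetween U) {x y : U}
    (h : ∀ γ₀ γ₁ : ℝ → U, IsGeodesic γ₀ x y → IsGeodesic γ₁ x y → ∀ t ∈ Icc 0 (dist x y), γ₀ t = γ₁ t) :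
    UniqueBetween x y := by
  have key : ∀ z, dist x z + dist z y = dist x y → ∃ γ, IsGeodesic γ x y ∧ γ (dist x z) = z := by
    intro z hz
    obtain ⟨α, hα⟩ := hB.exists_geodesic x z
    obtain ⟨β, hβ⟩ := hB.exists_geodesic z y
    exact ⟨_, hα.concat hβ hz, by simp [hα.right]⟩
  intro z z' hz hz' hzz
  obtain ⟨γ, hγ, e⟩ := key z hz
  obtain ⟨γ', hγ', e'⟩ := key z' hz'
  rw [← e, ← e', ← hzz]
  exact h γ γ' hγ hγ' _ ⟨dist_nonneg, by linarith [dist_nonneg (x := z) (y := y)]⟩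

/-- Otherwise points `z'` for endpoints converging to `y` would accumulate, by properness, at a
second point between `p` and `y` at the same distance from `p`. -/
theorem UniqueBetween.dist_lt [ProperSpace U] {p y z : U} (h : UniqueBetween p y)
    (hz : dist p z + dist z y = dist p y) {ρ : ℝ} (hρ : 0 < ρ) :
    ∃ ε > 0, ∀ y' z', dist y y' < ε → dist p z' + dist z' y' = dist p y' →
      |dist p z' - dist p z| < ε → dist z z' < ρ := by
  by_contra! hcon
  choose! y' z' h1 h2 h3 h4 using fun n : ℕ => hcon (1 / ((n : ℝ) + 1)) (by positivity)
  have hlim := tendsto_one_div_add_atTop_nhds_zero_nat (𝕜 := ℝ)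
  have hy : Tendsto y' atTop (𝓝 y) := by
    rw [tendsto_iff_dist_tendsto_zero]
    exact squeeze_zero (fun _ => dist_nonneg) (fun n => by rw [dist_comm]; exact (h1 n).le) hlim
  have hd : Tendsto (fun n => dist p (z' n)) atTop (𝓝 (dist p z)) := by
    rw [tendsto_iff_dist_tendsto_zero]
    exact squeeze_zero (fun _ => dist_nonneg) (fun n => (h3 n).le) hlim
  obtain ⟨w, -, φ, hφ, hw⟩ := (isCompact_closedBall p (dist p z + 1)).tendsto_subseq (x := z')
    (fun n => by
      rw [Metric.mem_closedBall, dist_comm]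
      have := (abs_lt.1 (h3 n)).2
      have h5 : 1 / ((n : ℝ) + 1) ≤ 1 := by
        rw [div_le_one (by positivity)]; linarith [Nat.cast_nonneg (α := ℝ) n]
      linarith)
  have e1 : dist p w = dist p z :=
    tendsto_nhds_unique (tendsto_const_nhds.dist hw) (hd.comp hφ.tendsto_atTop)
  have e2 : dist p w + dist w y = dist p y := by
    refine tendsto_nhds_unique ((tendsto_const_nhds.dist hw).add
      (hw.dist (hy.comp hφ.tendsto_atTop))) ?_
    have := (tendsto_const_nhds (x := p)).dist (hy.comp hφ.tendsto_atTop)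
    refine this.congr fun n => ?_
    exact (h2 (φ n)).symm
  have e3 : z = w := h z w hz e2 e1.symm
  have e4 : ρ ≤ dist z w :=
    ge_of_tendsto' (tendsto_const_nhds.dist hw) fun n => h4 (φ n)
  rw [e3, dist_self] at e4
  linarith

end Uniqueness

/-! ### Patching CAT(0) comparison along geodesics -/

section Patchwork

/-- The diagonal `d₁₃` is broken at the point dividing the other diagonal `D` in the ratio `t : 1 -
t`. The weighted Cauchy–Schwarz bound `z₁ ^ 2 / t + z₃ ^ 2 / (1 - t)` makes `D ^ 2` appear with
coefficient one, and `t` is then chosen to balance the two opposite sides. -/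
theorem diagonals_le_of_comparison {d₁₂ d₂₃ d₃₄ d₁₄ d₁₃ D : ℝ} (h12 : 0 ≤ d₁₂) (h34 : 0 ≤ d₃₄)
    (h13 : 0 ≤ d₁₃)
    (h : ∀ t : ℝ, 0 < t → t < 1 → ∃ z₁ z₃, d₁₃ ≤ z₁ + z₃ ∧
      z₁ ^ 2 ≤ (1 - t) * d₁₂ ^ 2 + t * d₁₄ ^ 2 - t * (1 - t) * D ^ 2 ∧
      z₃ ^ 2 ≤ (1 - t) * d₂₃ ^ 2 + t * d₃₄ ^ 2 - t * (1 - t) * D ^ 2) :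
    d₁₃ ^ 2 + D ^ 2 ≤ d₁₄ ^ 2 + d₂₃ ^ 2 + 2 * d₁₂ * d₃₄ := by
  have key : ∀ t : ℝ, 0 < t → t < 1 →
      d₁₃ ^ 2 + D ^ 2 ≤ d₁₄ ^ 2 + d₂₃ ^ 2 + (1 - t) / t * d₁₂ ^ 2 + t / (1 - t) * d₃₄ ^ 2 := by
    intro t ht0 ht1
    obtain ⟨z₁, z₃, h1, h2, h3⟩ := h t ht0 ht1
    have ht1' : 0 < 1 - t := by linarith
    have e1 : d₁₃ ^ 2 ≤ (z₁ + z₃) ^ 2 := by gcongr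
    have e2 : (z₁ + z₃) ^ 2 ≤ z₁ ^ 2 / t + z₃ ^ 2 / (1 - t) := by
      rw [div_add_div _ _ ht0.ne' ht1'.ne', le_div_iff₀ (by positivity)]
      nlinarith [sq_nonneg ((1 - t) * z₁ - t * z₃)]
    have e3 : z₁ ^ 2 / t ≤ ((1 - t) * d₁₂ ^ 2 + t * d₁₄ ^ 2 - t * (1 - t) * D ^ 2) / t := by gcongr
    have e4 : z₃ ^ 2 / (1 - t) ≤
        ((1 - t) * d₂₃ ^ 2 + t * d₃₄ ^ 2 - t * (1 - t) * D ^ 2) / (1 - t) := by gcongr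
    have e5 : ((1 - t) * d₁₂ ^ 2 + t * d₁₄ ^ 2 - t * (1 - t) * D ^ 2) / t =
        (1 - t) / t * d₁₂ ^ 2 + d₁₄ ^ 2 - (1 - t) * D ^ 2 := by field_simp
    have e6 : ((1 - t) * d₂₃ ^ 2 + t * d₃₄ ^ 2 - t * (1 - t) * D ^ 2) / (1 - t) =
        d₂₃ ^ 2 + t / (1 - t) * d₃₄ ^ 2 - t * D ^ 2 := by field_simp
    linarith
  have key2 : ∀ e : ℝ, 0 < e →
      d₁₃ ^ 2 + D ^ 2 ≤ d₁₄ ^ 2 + d₂₃ ^ 2 + 2 * d₁₂ * d₃₄ + e * (d₁₂ + d₃₄) := by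
    intro e he
    -- The optimal `t` is `d₁₂ / (d₁₂ + d₃₄)`; adding `e` keeps it strictly inside the unit
    -- interval.
    set a := d₁₂ + e with ha
    set b := d₃₄ + e with hb
    have ha0 : 0 < a := by positivity
    have hb0 : 0 < b := by positivity
    have hk := key (a / (a + b)) (by positivity) (by rw [div_lt_one (by positivity)]; linarith)
    have f1 : (1 - a / (a + b)) / (a / (a + b)) = b / a := by field_simp; ring
    have f2 : a / (a + b) / (1 - a / (a + b)) = a / b := by
      have : a + b - a ≠ 0 := by rw [add_sub_cancel_left]; exact hb0.ne'
      field_simp; ring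
    rw [f1, f2] at hk
    have g1 : b / a * d₁₂ ^ 2 ≤ b * d₁₂ := by
      rw [div_mul_eq_mul_div, div_le_iff₀ ha0]
      have : d₁₂ ^ 2 ≤ d₁₂ * a := by nlinarith
      nlinarith
    have g2 : a / b * d₃₄ ^ 2 ≤ a * d₃₄ := by
      rw [div_mul_eq_mul_div, div_le_iff₀ hb0]
      have : d₃₄ ^ 2 ≤ d₃₄ * b := by nlinarith
      nlinarith
    have : b * d₁₂ + a * d₃₄ = 2 * d₁₂ * d₃₄ + e * (d₁₂ + d₃₄) := by rw [ha, hb]; ring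
    linarith
  refine le_of_forall_pos_le_add fun δ hδ => ?_
  have := key2 (δ / (d₁₂ + d₃₄ + 1)) (by positivity)
  have h2 : δ / (d₁₂ + d₃₄ + 1) * (d₁₂ + d₃₄) ≤ δ := by
    rw [div_mul_eq_mul_div, div_le_iff₀ (by positivity)]
    nlinarith
  linarith

/-- Cauchy–Schwarz is used twice: for the sum of the `E i`, which exceeds `X`, and for the
increments of `D`, which telescope to `D N`. -/
theorem sq_le_of_chain {N : ℕ} {E D : ℕ → ℝ} {α β X : ℝ} (hX : 0 ≤ X)
    (hE : ∀ i < N, E i ^ 2 ≤ α ^ 2 / 2 + β ^ 2 / 2 - (D (i + 1) - D i) ^ 2 / 4) (hD : D 0 = 0)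
    (hXE : X ≤ ∑ i ∈ Finset.range N, E i) :
    X ^ 2 ≤ (N * α) ^ 2 / 2 + (N * β) ^ 2 / 2 - D N ^ 2 / 4 := by
  have h1 := sq_sum_le_card_mul_sum_sq (s := Finset.range N) (f := E)
  have h2 := sq_sum_le_card_mul_sum_sq (s := Finset.range N) (f := fun i => D (i + 1) - D i)
  rw [Finset.sum_range_sub, hD, sub_zero, Finset.card_range] at h2
  rw [Finset.card_range] at h1
  have h3 : ∑ i ∈ Finset.range N, E i ^ 2 ≤
      ∑ i ∈ Finset.range N, (α ^ 2 / 2 + β ^ 2 / 2 - (D (i + 1) - D i) ^ 2 / 4) :=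
    Finset.sum_le_sum fun i hi => hE i (by simpa using hi)
  rw [Finset.sum_sub_distrib, Finset.sum_const, Finset.card_range, nsmul_eq_mul,
    ← Finset.sum_div] at h3
  have h4 : X ^ 2 ≤ (∑ i ∈ Finset.range N, E i) ^ 2 := by gcongr
  have h5 := mul_le_mul_of_nonneg_left h3 (Nat.cast_nonneg (α := ℝ) N)
  nlinarith

/-- A maximum principle: a function satisfying a local strict sub-mean value inequality with respect
to cosines is nonpositive on an interval if it is so at the endpoints. -/
theorem nonpos_of_local {u : ℝ → ℝ} {l k : ℝ} (hl : 0 ≤ l) (hk : 0 < k) (hkl : k * l < Real.pi)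
    (hu : ContinuousOn u (Icc 0 l)) (h0 : u 0 ≤ 0) (h1 : u l ≤ 0)
    (h : ∀ t, 0 < t → t < l → ∃ ε > 0, ε ≤ t ∧ t + ε ≤ l ∧ ∃ c, Real.cos (k * ε) < c ∧
      c * u t ≤ (u (t - ε) + u (t + ε)) / 2) : ∀ t ∈ Icc 0 l, u t ≤ 0 := by
  -- `φ` is a positive solution of `φ (t - ε) + φ (t + ε) = 2 * cos (k * ε) * φ t`; a positive inner
  -- maximum of `u / φ` would contradict `cos (k * ε) < c`.
  set φ : ℝ → ℝ := fun t => Real.cos (k * (t - l / 2)) with hφ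
  have hφ0 : ∀ t ∈ Icc 0 l, 0 < φ t := fun t ht => by
    refine Real.cos_pos_of_mem_Ioo ⟨?_, ?_⟩ <;> nlinarith [ht.1, ht.2]
  have hφc : Continuous φ := by fun_prop
  obtain ⟨s, hs, hmax⟩ := isCompact_Icc.exists_isMaxOn (⟨0, le_rfl, hl⟩ : (Icc 0 l).Nonempty)
    (hu.div hφc.continuousOn fun t ht => (hφ0 t ht).ne')
  set τ := u s / φ s with hτ
  have hle : ∀ t ∈ Icc 0 l, u t ≤ τ * φ t := fun t ht => (div_le_iff₀ (hφ0 t ht)).1 (hmax ht)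
  have hus : u s = τ * φ s := by rw [hτ, div_mul_cancel₀ _ (hφ0 s hs).ne']
  suffices τ ≤ 0 from fun t ht => (hle t ht).trans (mul_nonpos_of_nonpos_of_nonneg this (hφ0 t ht).le)
  by_contra! hτ0
  have hpos : 0 < u s := by rw [hus]; exact mul_pos hτ0 (hφ0 s hs)
  have hs0 : 0 < s := lt_of_le_of_ne hs.1 fun e => by rw [← e] at hpos; linarith
  have hsl : s < l := lt_of_le_of_ne hs.2 fun e => by rw [e] at hpos; linarith
  obtain ⟨ε, hε, hε1, hε2, c, hc, hineq⟩ := h s hs0 hsl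
  have a1 := hle (s - ε) ⟨by linarith, by linarith⟩
  have a2 := hle (s + ε) ⟨by linarith, by linarith⟩
  have e : φ (s - ε) + φ (s + ε) = 2 * Real.cos (k * ε) * φ s := by
    simp only [hφ]
    rw [show k * (s - ε - l / 2) = k * (s - l / 2) - k * ε by ring,
      show k * (s + ε - l / 2) = k * (s - l / 2) + k * ε by ring, Real.cos_sub, Real.cos_add]
    ring
  have a3 : (u (s - ε) + u (s + ε)) / 2 ≤ Real.cos (k * ε) * u s := by
    rw [hus]
    calc _ ≤ τ * (φ (s - ε) + φ (s + ε)) / 2 := by linarith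
      _ = _ := by rw [e]; ring
  nlinarith

theorem exists_pos_forall_le {P : ℕ → ℝ → Prop} (hP : ∀ i e e', e' ≤ e → P i e → P i e')
    (h : ∀ i, ∃ e > 0, P i e) (N : ℕ) : ∃ e > 0, ∀ i ≤ N, P i e := by
  induction N with
  | zero =>
    obtain ⟨e, he, h0⟩ := h 0
    exact ⟨e, he, fun i hi => by rwa [Nat.le_zero.1 hi]⟩
  | succ N ih =>
    obtain ⟨e, he, h0⟩ := ih
    obtain ⟨e', he', h0'⟩ := h (N + 1)
    refine ⟨min e e', lt_min he he', fun i hi => ?_⟩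
    rcases hi.eq_or_lt with h | h
    · rw [h]; exact hP _ _ _ (min_le_right _ _) h0'
    · exact hP _ _ _ (min_le_left _ _) (h0 i (by omega))

variable {U : Type*} [MetricSpace U]

/-- Three median inequalities express `dist m n` through the sides and diagonals of the
quadrilateral `a, a', b', b`. The sum of the squared diagonals is bounded by
`diagonals_le_of_comparison`. -/
theorem UniformlyCATZero.dist_mid_sq_le (hB : HasBetween U) {o : U} {R r : ℝ}
    (h : UniformlyCATZero o R r) {c a a' b b' m n : U} (hc : dist o c ≤ R) (ha : dist c a ≤ r / 4)
    (ha' : dist c a' ≤ r / 4) (hb : dist c b ≤ r / 4) (hb' : dist c b' ≤ r / 4) (hm : IsMid a a' m)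
    (hn : IsMid b b' n) :
    dist m n ^ 2 ≤ dist a b ^ 2 / 2 + dist a' b' ^ 2 / 2 - (dist b b' - dist a a') ^ 2 / 4 := by
  have hr : 0 ≤ r := by linarith [dist_nonneg (x := c) (y := a)]
  have loc : ∀ p x y z : U, dist c p ≤ r → dist c x ≤ r / 4 → dist c y ≤ r / 4 → ∀ t : ℝ, 0 ≤ t →
      t ≤ 1 → dist x z = t * dist x y → dist z y = (1 - t) * dist x y →
      dist p z ^ 2 ≤ (1 - t) * dist p x ^ 2 + t * dist p y ^ 2 - t * (1 - t) * dist x y ^ 2 := by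
    intro p x y z hp hx hy t ht0 ht1 h1 h2
    refine (h c hc p z x y hp ?_ (by linarith) (by linarith)).dist_sq_le ht0 ht1 h1 h2
    have t1 := dist_triangle c x z
    have t2 := dist_triangle_left x y c
    have : t * dist x y ≤ dist x y := by nlinarith [dist_nonneg (x := x) (y := y)]
    linarith
  have half : ∀ p x y z : U, dist c p ≤ r → dist c x ≤ r / 4 → dist c y ≤ r / 4 → IsMid x y z →
      dist p z ^ 2 ≤ dist p x ^ 2 / 2 + dist p y ^ 2 / 2 - dist x y ^ 2 / 4 := by
    intro p x y z hp hx hy hz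
    have := loc p x y z hp hx hy (1 / 2) (by norm_num) (by norm_num) (by rw [hz.1]; ring)
      (by rw [hz.2]; ring)
    linarith
  have hmc : dist c m ≤ r := by
    have t1 := dist_triangle c a m
    have t2 := dist_triangle_left a a' c
    rw [hm.1] at t1
    linarith
  have e1 := half m b b' n hmc hb hb' hn
  have e2 := half b a a' m (by linarith) ha ha' hm
  have e3 := half b' a a' m (by linarith) ha ha' hm
  have e4 : dist a' b ^ 2 + dist a b' ^ 2 ≤ dist a' b' ^ 2 + dist a b ^ 2 + 2 * dist a' a * dist b b' := by
    refine diagonals_le_of_comparison dist_nonneg dist_nonneg dist_nonneg fun t ht0 ht1 => ?_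
    obtain ⟨z, hz1, hz2⟩ := hB a b' (t * dist a b') (by positivity)
      (by nlinarith [dist_nonneg (x := a) (y := b')])
    have hz2' : dist z b' = (1 - t) * dist a b' := by rw [hz2]; ring
    refine ⟨dist a' z, dist b z, by rw [dist_comm b z]; exact dist_triangle _ _ _,
      loc a' a b' z (by linarith) ha hb' t ht0.le ht1.le hz1 hz2', ?_⟩
    rw [dist_comm a b]
    exact loc b a b' z (by linarith) ha hb' t ht0.le ht1.le hz1 hz2'
  rw [dist_comm m b, dist_comm m b'] at e1
  rw [dist_comm b a] at e2
  rw [dist_comm b a'] at e2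
  rw [dist_comm b' a, dist_comm b' a'] at e3
  rw [dist_comm a' a] at e4
  nlinarith

/-- The thin triangle with vertex `p` and base from `γ (t - ε)` to `γ (t + ε)` is cut into small
quadrilaterals between its two long sides. The midpoints of the cuts form a chain from `p` to `γ t`,
and the quadrilateral estimates add up along it. -/
theorem IsLocallyCATZero.dist_sq_local [ProperSpace U] (hB : HasBetween U) (hU : IsLocallyCATZero U)
    (huniq : ∀ x y : U, UniqueBetween x y) (p : U) {γ : ℝ → U} {x y : U} (hγ : IsGeodesic γ x y)
    {t : ℝ} (ht0 : 0 < t) (ht1 : t < dist x y) :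
    ∃ ε₀ > 0, ∀ ε, 0 < ε → ε < ε₀ → ε ≤ t → t + ε ≤ dist x y →
      dist p (γ t) ^ 2 ≤
        dist p (γ (t - ε)) ^ 2 / 2 + dist p (γ (t + ε)) ^ 2 / 2 - ε ^ 2 := by
  set d := dist p (γ t) with hd
  have hd0 : 0 ≤ d := dist_nonneg
  obtain ⟨r, hr, hr', hloc⟩ := hU.uniformly p (d + 1)
  obtain ⟨α, hα⟩ := hB.exists_geodesic p (γ t)
  obtain ⟨N, hN⟩ := exists_nat_gt (8 * d / r)
  have hN0 : (0 : ℝ) < N := lt_of_le_of_lt (by positivity) hN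
  have hNd : d / N ≤ r / 8 := by
    rw [div_lt_iff₀ hr] at hN
    rw [div_le_iff₀ hN0]; linarith
  have hfrac : ∀ i ≤ N, ∀ D : ℝ, 0 ≤ D → (i : ℝ) * (D / N) ∈ Icc 0 D := fun i hi D hD => by
    refine ⟨by positivity, ?_⟩
    have : (i : ℝ) ≤ N := by exact_mod_cast hi
    calc (i : ℝ) * (D / N) ≤ N * (D / N) := by gcongr
      _ = D := by field_simp
  -- For endpoints close to `γ t`, the geodesics from `p` stay near `α` at all `N + 1` division
  -- points, by uniqueness.
  obtain ⟨e, he, hcont⟩ := exists_pos_forall_le (N := N)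
    (P := fun i e => i ≤ N → ∀ y' z', dist (γ t) y' < e → dist p z' + dist z' y' = dist p y' →
      |dist p z' - dist p (α (i * (d / N)))| < e → dist (α (i * (d / N))) z' < r / 8)
    (fun i e e' hee hP hi y' z' h1 h2 h3 => hP hi y' z' (h1.trans_le hee) h2 (h3.trans_le hee))
    (fun i => by
      by_cases hi : i ≤ N
      · have hm := hfrac i hi d hd0
        obtain ⟨e, he, h⟩ := (huniq p (γ t)).dist_lt (z := α (i * (d / N)))
          (by rw [hα.dist_left hm.1 hm.2, hα.dist_right hm.1 hm.2]; ring) (ρ := r / 8) (by positivity)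
        exact ⟨e, he, fun _ => h⟩
      · exact ⟨1, one_pos, fun h => absurd h hi⟩)
  refine ⟨min e (r / 8), by positivity, fun ε hε hεlt hεt hεl => ?_⟩
  have hεe : ε < e := hεlt.trans_le (min_le_left _ _)
  have hεr : ε < r / 8 := hεlt.trans_le (min_le_right _ _)
  have chain : ∀ y', dist (γ t) y' = ε → ∃ v : ℕ → U, v 0 = p ∧ v N = y' ∧
      (∀ i < N, dist (v i) (v (i + 1)) = dist p y' / N) ∧
      ∀ i ≤ N, dist (α (i * (d / N))) (v i) < r / 8 := by
    intro y' hy'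
    obtain ⟨β, hβ⟩ := hB.exists_geodesic p y'
    set d' := dist p y' with hd'
    have hd'0 : 0 ≤ d' := dist_nonneg
    refine ⟨fun i => β (i * (d' / N)), by simp [hβ.left], ?_, ?_, ?_⟩
    · show β (N * (d' / N)) = y'
      rw [show (N : ℝ) * (d' / N) = d' by field_simp, hd', hβ.right]
    · intro i hi
      have m1 := hfrac i hi.le d' hd'0
      have m2 := hfrac (i + 1) hi d' hd'0
      rw [hβ.dist_eq _ _ m1.1 (by gcongr; omega) m2.2]
      push_cast; ring
    · intro i hi
      have m1 := hfrac i hi d' hd'0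
      have m2 := hfrac i hi d hd0
      refine hcont i hi hi y' _ (by rw [hy']; exact hεe)
        (by rw [hβ.dist_left m1.1 m1.2, hβ.dist_right m1.1 m1.2]; ring) ?_
      rw [hβ.dist_left m1.1 m1.2, hα.dist_left m2.1 m2.2]
      have hdd : |d' - d| ≤ ε := by
        rw [hd', hd, ← hy', dist_comm p y', dist_comm p (γ t), dist_comm (γ t) y']
        exact abs_dist_sub_le _ _ _
      refine lt_of_le_of_lt ?_ hεe
      have hiN : (i : ℝ) / N ≤ 1 := by rw [div_le_one hN0]; exact_mod_cast hi
      calc |(i : ℝ) * (d' / N) - i * (d / N)| = i / N * |d' - d| := by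
            rw [show (i : ℝ) * (d' / N) - i * (d / N) = i / N * (d' - d) by field_simp, abs_mul,
              abs_of_nonneg (by positivity)]
        _ ≤ 1 * |d' - d| := by gcongr
        _ ≤ ε := by linarith
  have g1 : dist (γ t) (γ (t - ε)) = ε := by
    rw [dist_comm, hγ.dist_eq _ _ (by linarith) (by linarith) (by linarith)]; ring
  have g2 : dist (γ t) (γ (t + ε)) = ε := by
    rw [hγ.dist_eq _ _ (by linarith) (by linarith) (by linarith)]; ring
  have g3 : dist (γ (t - ε)) (γ (t + ε)) = 2 * ε := by
    rw [hγ.dist_eq _ _ (by linarith) (by linarith) (by linarith)]; ring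
  obtain ⟨v, hv0, hvN, hvs, hvc⟩ := chain _ g1
  obtain ⟨w, hw0, hwN, hws, hwc⟩ := chain _ g2
  choose mid hmid using hB.exists_mid
  have hm0 : mid (v 0) (w 0) = p := by
    have := (hmid (v 0) (w 0)).1
    rw [hv0, hw0, dist_self, zero_div] at this
    rw [hv0, hw0]
    exact (dist_eq_zero.1 this).symm
  have hαR : ∀ i ≤ N, dist p (α (i * (d / N))) ≤ d + 1 := fun i hi => by
    have m2 := hfrac i hi d hd0
    rw [hα.dist_left m2.1 m2.2]; linarith [m2.2]
  -- Nearby points have a unique midpoint, so the chosen one is `γ t`.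
  have hmN : mid (v N) (w N) = γ t := by
    refine hloc.midNonexpanding.eq (a := v N) (b := w N) ?_ ?_ (hmid _ _) ?_
    · rw [hvN]
      linarith [dist_triangle p (γ t) (γ (t - ε))]
    · rw [hvN, hwN, g3]; linarith
    · rw [hvN, hwN]
      exact ⟨by rw [dist_comm, g1, g3]; ring, by rw [g2, g3]; ring⟩
  have key := sq_le_of_chain (N := N) (E := fun i => dist (mid (v i) (w i)) (mid (v (i + 1)) (w (i + 1))))
    (D := fun i => dist (v i) (w i)) (α := dist p (γ (t - ε)) / N) (β := dist p (γ (t + ε)) / N)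
    (X := d) hd0 (fun i hi => by
      rw [← hvs i hi, ← hws i hi]
      have hstep : dist (α (i * (d / N))) (α ((i + 1 : ℕ) * (d / N))) ≤ r / 8 := by
        have m1 := hfrac i hi.le d hd0
        have m2 := hfrac (i + 1) hi d hd0
        rw [hα.dist_eq _ _ m1.1 (by gcongr; omega) m2.2]
        push_cast
        linarith
      refine hloc.dist_mid_sq_le hB (hαR i hi.le) ?_ ?_ ?_ ?_ (hmid _ _) (hmid _ _)
      · linarith [hvc i hi.le]
      · linarith [hwc i hi.le]
      · linarith [dist_triangle (α (i * (d / N))) (α ((i + 1 : ℕ) * (d / N))) (v (i + 1)), hvc (i + 1) hi]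
      · linarith [dist_triangle (α (i * (d / N))) (α ((i + 1 : ℕ) * (d / N))) (w (i + 1)), hwc (i + 1) hi])
    (by simp only [hv0, hw0, dist_self]) (by
      have := dist_le_range_sum_dist (fun i => mid (v i) (w i)) N
      simp only [hm0, hmN] at this
      exact this)
  simp only [hvN, hwN, g3] at key
  rw [mul_div_cancel₀ _ hN0.ne', mul_div_cancel₀ _ hN0.ne'] at key
  linarith

theorem dist_sq_le_of_local (p : U) {γ : ℝ → U} {x y : U} (hγ : IsGeodesic γ x y)
    (h : ∀ t, 0 < t → t < dist x y → ∃ ε₀ > 0, ∀ ε, 0 < ε → ε < ε₀ → ε ≤ t → t + ε ≤ dist x y →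
      dist p (γ t) ^ 2 ≤ dist p (γ (t - ε)) ^ 2 / 2 + dist p (γ (t + ε)) ^ 2 / 2 - ε ^ 2)
    {s : ℝ} (hs0 : 0 ≤ s) (hs1 : s ≤ 1) :
    dist p (γ (s * dist x y)) ^ 2 ≤
      (1 - s) * dist p x ^ 2 + s * dist p y ^ 2 - s * (1 - s) * dist x y ^ 2 := by
  set ℓ := dist x y with hℓ
  have hℓ0 : 0 ≤ ℓ := dist_nonneg
  rcases hℓ0.eq_or_lt with h0 | h0
  · have hxy : x = y := dist_eq_zero.1 h0.symm
    rw [← h0, mul_zero, hγ.left, ← hxy]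
    linarith
  have hpi := Real.pi_gt_three
  -- The quadratic expression given by Stewart's formula is subtracted. What remains is midpoint
  -- convex for small steps, so `c = 1` works, being larger than `cos (ε / ℓ)`.
  have key := nonpos_of_local (u := fun t => dist p (γ t) ^ 2 -
      ((1 - t / ℓ) * dist p x ^ 2 + t / ℓ * dist p y ^ 2 - t * (ℓ - t))) (l := ℓ) (k := 1 / ℓ) hℓ0
    (by positivity) (by rw [one_div, inv_mul_cancel₀ h0.ne']; linarith) ?_ ?_ ?_ ?_
    (s * ℓ) ⟨by positivity, by nlinarith⟩
  · rw [mul_div_cancel_right₀ _ h0.ne'] at key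
    linarith
  · have hc := hγ.continuousOn
    fun_prop
  · simp [hγ.left]
  · rw [hγ.right, div_self h0.ne']; simp
  · intro t ht0 ht1
    obtain ⟨ε₀, hε₀, hh⟩ := h t ht0 ht1
    set ε := min (ε₀ / 2) (min t (ℓ - t)) with hε
    have hε0 : 0 < ε := by
      have : 0 < ℓ - t := by linarith
      positivity
    have c1 : ε < ε₀ := (min_le_left _ _).trans_lt (by linarith)
    have c2 : ε ≤ t := (min_le_right _ _).trans (min_le_left _ _)
    have c3 : ε ≤ ℓ - t := (min_le_right _ _).trans (min_le_right _ _)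
    refine ⟨ε, hε0, c2, by linarith, 1, ?_, ?_⟩
    · refine lt_of_lt_of_eq ?_ Real.cos_zero
      refine Real.cos_lt_cos_of_nonneg_of_le_pi le_rfl ?_ (by positivity)
      rw [one_div, inv_mul_le_iff₀ h0]
      nlinarith
    · have := hh ε hε0 c1 c2 (by linarith)
      have e1 : (t - ε) / ℓ = t / ℓ - ε / ℓ := by ring
      have e2 : (t + ε) / ℓ = t / ℓ + ε / ℓ := by ring
      rw [e1, e2]
      nlinarith

theorem isCATZero_of_dist_sq_le (hgeo : ∀ x y : U, ∃ γ, IsGeodesic γ x y)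
    (h : ∀ (p : U) {γ : ℝ → U} {x y : U}, IsGeodesic γ x y → ∀ {s : ℝ}, 0 ≤ s → s ≤ 1 →
      dist p (γ (s * dist x y)) ^ 2 ≤
        (1 - s) * dist p x ^ 2 + s * dist p y ^ 2 - s * (1 - s) * dist x y ^ 2) : IsCATZero U := by
  intro p q x y p' q' x' y' hp hq z' hz'
  obtain ⟨γ, hγ⟩ := hgeo x y
  obtain ⟨a, s, ha, hs, has, rfl⟩ := hz'
  obtain rfl : a = 1 - s := by linarith
  have key : ∀ p p', IsEuclideanModel p x y p' x' y' →
      dist p (γ (s * dist x y)) ≤ dist p' ((1 - s) • x' + s • y') := by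
    intro p p' hp
    refine abs_le_of_sq_le_sq' ?_ dist_nonneg |>.2
    rw [dist_sq_affine, hp.1, hp.2.1, dist_comm p' y', hp.2.2, dist_comm y p]
    exact h p hγ hs (by linarith)
  have h1 := key p p' hp
  have h2 := key q q' hq
  rw [dist_comm q', dist_comm q] at h2
  exact (dist_triangle _ _ _).trans (add_le_add h1 h2)

theorem isCATZero_of_simplyConnected [ProperSpace U] (hL : IsLengthSpace U) [SimplyConnectedSpace U]
    (hU : IsLocallyCATZero U) : IsCATZero U := by
  have hB := hL.hasBetween
  have huniq : ∀ x y : U, UniqueBetween x y := fun x y =>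
    uniqueBetween_of_geodesic hB fun _ _ h₀ h₁ => hU.geodesic_unique hB h₀ h₁
  exact isCATZero_of_dist_sq_le hB.exists_geodesic fun p _ _ _ hγ _ hs0 hs1 =>
    dist_sq_le_of_local p hγ (fun _ ht0 ht1 => hU.dist_sq_local hB huniq p hγ ht0 ht1) hs0 hs1

end Patchwork

/-! ### Comparison in the Euclidean cone -/

/-- The squared distance, in the Euclidean cone, of two points at distances `r` and `s` from the apex
whose projections are at distance `d`. -/
noncomputable def coneSq (r s d : ℝ) : ℝ := r ^ 2 + s ^ 2 - 2 * r * s * Real.cos d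

/-- The point of the plane with polar coordinates `r` and `θ`. -/
noncomputable def polar (r θ : ℝ) : ℂ := ⟨r * Real.cos θ, r * Real.sin θ⟩

theorem dist_polar_sq (r s α β : ℝ) : dist (polar r α) (polar s β) ^ 2 = coneSq r s (α - β) := by
  rw [Complex.dist_eq, ← Complex.normSq_eq_norm_sq, Complex.normSq_apply, coneSq, Real.cos_sub]
  simp only [polar, Complex.sub_re, Complex.sub_im]
  linear_combination r ^ 2 * Real.sin_sq_add_cos_sq α + s ^ 2 * Real.sin_sq_add_cos_sq β

theorem coneSq_nonneg (r s d : ℝ) : 0 ≤ coneSq r s d := by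
  have := dist_polar_sq r s d 0
  rw [sub_zero] at this
  rw [← this]
  positivity

theorem dist_polar (r s α β : ℝ) : dist (polar r α) (polar s β) = √(coneSq r s (α - β)) := by
  rw [← dist_polar_sq, Real.sqrt_sq dist_nonneg]

theorem coneSq_neg (r s d : ℝ) : coneSq r s (-d) = coneSq r s d := by
  rw [coneSq, coneSq, Real.cos_neg]

theorem coneSq_comm (r s d : ℝ) : coneSq r s d = coneSq s r d := by
  rw [coneSq, coneSq]; ring

theorem coneSq_mono {r s d d' : ℝ} (hr : 0 ≤ r) (hs : 0 ≤ s) (hd : 0 ≤ d) (h : d ≤ d')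
    (hpi : d' ≤ Real.pi) : coneSq r s d ≤ coneSq r s d' := by
  have := Real.cos_le_cos_of_nonneg_of_le_pi hd hpi h
  have h2 : r * s * Real.cos d' ≤ r * s * Real.cos d := by gcongr
  rw [coneSq, coneSq]
  linarith

/-- The chain is unfolded in the plane around the apex, with the `δ i` as consecutive angles. As
long as the total angle is at most `π`, a larger angle means a longer chord. -/
theorem sqrt_coneSq_le_sum {N : ℕ} {ρ δ : ℕ → ℝ} {d : ℝ} (h0 : 0 ≤ ρ 0) (hN : 0 ≤ ρ N) (hd : 0 ≤ d)
    (hle : d ≤ ∑ i ∈ Finset.range N, δ i) (hpi : ∑ i ∈ Finset.range N, δ i ≤ Real.pi) :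
    √(coneSq (ρ 0) (ρ N) d) ≤ ∑ i ∈ Finset.range N, √(coneSq (ρ i) (ρ (i + 1)) (δ i)) := by
  set P : ℕ → ℂ := fun i => polar (ρ i) (∑ j ∈ Finset.range i, δ j) with hP
  have h := dist_le_range_sum_dist P N
  have e : ∀ i, dist (P i) (P (i + 1)) = √(coneSq (ρ i) (ρ (i + 1)) (δ i)) := fun i => by
    rw [hP, dist_polar, Finset.sum_range_succ, sub_add_cancel_left, coneSq_neg]
  simp only [e] at h
  refine le_trans ?_ h
  rw [hP, dist_polar, Finset.sum_range_zero, zero_sub, coneSq_neg]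
  exact Real.sqrt_le_sqrt (coneSq_mono h0 hN hd hle hpi)

theorem sqrt_coneSq_triangle {r s t d a b : ℝ} (hr : 0 ≤ r) (ht : 0 ≤ t) (hd : 0 ≤ d) (hab : d ≤ a + b)
    (hpi : a + b ≤ Real.pi) : √(coneSq r t d) ≤ √(coneSq r s a) + √(coneSq s t b) := by
  have h := dist_triangle (polar r 0) (polar s a) (polar t (a + b))
  rw [dist_polar, dist_polar, dist_polar, zero_sub, zero_sub, coneSq_neg, coneSq_neg,
    sub_add_cancel_left, coneSq_neg] at h
  exact (Real.sqrt_le_sqrt (coneSq_mono hr ht hd hab hpi)).trans h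

/-- Polar coordinates of the point dividing a chord. The angle cannot exceed `l`, because the sine
of the excess would be positive while `ρ` times it equals `-((1 - t) * r * sin l)`. -/
theorem exists_polar_affine {r s l t : ℝ} (hr : 0 < r) (hs : 0 < s) (hl : 0 ≤ l) (hlpi : l < Real.pi)
    (ht0 : 0 ≤ t) (ht1 : t ≤ 1) : ∃ ρ φ, 0 < ρ ∧ 0 ≤ φ ∧ φ ≤ l ∧
      ρ * Real.cos φ = (1 - t) * r + t * s * Real.cos l ∧ ρ * Real.sin φ = t * s * Real.sin l := by
  set w : ℂ := ⟨(1 - t) * r + t * s * Real.cos l, t * s * Real.sin l⟩ with hw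
  have hsl : 0 ≤ Real.sin l := Real.sin_nonneg_of_nonneg_of_le_pi hl hlpi.le
  have hw0 : w ≠ 0 := by
    intro h
    have h1 : (1 - t) * r + t * s * Real.cos l = 0 := congrArg Complex.re h
    have h2 : t * s * Real.sin l = 0 := congrArg Complex.im h
    rcases ht0.eq_or_lt with h0 | h0
    · rw [← h0] at h1; simp at h1; exact hr.ne' h1
    · rcases hl.eq_or_lt with hl0 | hl0
      · rw [← hl0, Real.cos_zero] at h1
        have : 0 ≤ (1 - t) * r := mul_nonneg (by linarith) hr.le
        have : 0 < t * s := by positivity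
        linarith
      · have := Real.sin_pos_of_pos_of_lt_pi hl0 hlpi
        have : 0 < t * s * Real.sin l := by positivity
        linarith
  have hρ : 0 < ‖w‖ := norm_pos_iff.2 hw0
  have e1 : ‖w‖ * Real.cos w.arg = (1 - t) * r + t * s * Real.cos l := by
    rw [Complex.norm_mul_cos_arg]
  have e2 : ‖w‖ * Real.sin w.arg = t * s * Real.sin l := by
    rw [Complex.norm_mul_sin_arg]
  have hφ0 : 0 ≤ w.arg := Complex.arg_nonneg_iff.2 (by simp only [hw]; positivity)
  refine ⟨‖w‖, w.arg, hρ, hφ0, ?_, e1, e2⟩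
  by_contra! hlt
  have e3 : ‖w‖ * Real.sin (w.arg - l) = -((1 - t) * r * Real.sin l) := by
    rw [Real.sin_sub]
    linear_combination Real.cos l * e2 - Real.sin l * e1
  have h4 : 0 < Real.sin (w.arg - l) ∨ (w.arg = Real.pi ∧ l = 0) := by
    rcases (Complex.arg_le_pi w).eq_or_lt with h | h
    · rcases hl.eq_or_lt with hl0 | hl0
      · exact Or.inr ⟨h, hl0.symm⟩
      · exact Or.inl (Real.sin_pos_of_pos_of_lt_pi (by linarith) (by linarith))
    · exact Or.inl (Real.sin_pos_of_pos_of_lt_pi (by linarith) (by linarith))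
  have h5 : 0 ≤ (1 - t) * r * Real.sin l := by
    apply mul_nonneg (mul_nonneg (by linarith) hr.le) hsl
  rcases h4 with h4 | ⟨h4, h6⟩
  · have := mul_pos hρ h4
    linarith
  · rw [h4, h6, Real.cos_pi, Real.cos_zero] at e1
    have : 0 ≤ (1 - t) * r := mul_nonneg (by linarith) hr.le
    have : 0 ≤ t * s := by positivity
    linarith

section Cone

variable {U : Type*} [MetricSpace U]

/-- In the Euclidean cone over `U`, the point `(z, ρ)` divides the segment from `(x, r)` to `(y, s)` in
the ratio `t : 1 - t`. -/
structure IsConePoint (t : ℝ) (x : U) (r : ℝ) (y : U) (s : ℝ) (z : U) (ρ : ℝ) : Prop where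
  between : dist x z + dist z y = dist x y
  pos : 0 < ρ
  cos_eq : ρ * Real.cos (dist x z) = (1 - t) * r + t * s * Real.cos (dist x y)
  sin_eq : ρ * Real.sin (dist x z) = t * s * Real.sin (dist x y)

theorem HasBetween.exists_isConePoint (hB : HasBetween U) {t : ℝ} (ht0 : 0 ≤ t) (ht1 : t ≤ 1) {x y : U}
    {r s : ℝ} (hr : 0 < r) (hs : 0 < s) (hxy : dist x y < Real.pi) :
    ∃ z ρ, IsConePoint t x r y s z ρ := by
  obtain ⟨ρ, φ, hρ, hφ0, hφ, h1, h2⟩ := exists_polar_affine hr hs dist_nonneg hxy ht0 ht1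
  obtain ⟨z, hz1, hz2⟩ := hB x y φ hφ0 hφ
  exact ⟨z, ρ, by rw [hz1, hz2]; ring, hρ, by rw [hz1, h1], by rw [hz1, h2]⟩

/-- CAT(1) comparison in the space becomes CAT(0) comparison in its cone: after multiplication by
`ρ`, the weights `ρ * sin (dist z y)` and `ρ * sin (dist x z)` turn into those of the affine
division. -/
theorem CATOneComparison.coneSq_le {p x y z : U} (h : CATOneComparison p z x y) (hxy : dist x y ≤ 1)
    (hpx : dist p x ≤ 1) (hpy : dist p y ≤ 1) {t q r s ρ : ℝ} (hq : 0 ≤ q)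
    (hz : IsConePoint t x r y s z ρ) :
    coneSq q ρ (dist p z) ≤ (1 - t) * coneSq q r (dist p x) + t * coneSq q s (dist p y) -
      t * (1 - t) * coneSq r s (dist x y) := by
  have key := h.sin_mul_cos_le hxy hpx hpy hz.between
  have hρ : ρ ^ 2 = (1 - t) ^ 2 * r ^ 2 + t ^ 2 * s ^ 2 + 2 * t * (1 - t) * r * s * Real.cos (dist x y) := by
    have e : ρ ^ 2 = (ρ * Real.cos (dist x z)) ^ 2 + (ρ * Real.sin (dist x z)) ^ 2 := by
      linear_combination -(ρ ^ 2) * Real.sin_sq_add_cos_sq (dist x z)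
    rw [e, hz.cos_eq, hz.sin_eq]
    linear_combination t ^ 2 * s ^ 2 * Real.sin_sq_add_cos_sq (dist x y)
  have hcos : (1 - t) * r * Real.cos (dist p x) + t * s * Real.cos (dist p y) ≤
      ρ * Real.cos (dist p z) := by
    have h0 : 0 ≤ dist x y := dist_nonneg
    rcases h0.eq_or_lt with h0 | h0
    · have e1 : x = y := dist_eq_zero.1 h0.symm
      have e2 : dist x z = 0 := by
        have := hz.between
        linarith [dist_nonneg (x := x) (y := z), dist_nonneg (x := z) (y := y)]
      have e3 : x = z := dist_eq_zero.1 e2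
      have e4 := hz.cos_eq
      rw [← h0, e2, Real.cos_zero] at e4
      rw [← e1, ← e3]
      apply le_of_eq
      linear_combination -(Real.cos (dist p x)) * e4
    · have hs : 0 < Real.sin (dist x y) :=
        Real.sin_pos_of_pos_of_lt_pi h0 (by linarith [Real.pi_gt_three])
      have e1 : ρ * Real.sin (dist z y) = (1 - t) * r * Real.sin (dist x y) := by
        rw [show dist z y = dist x y - dist x z by linarith [hz.between], Real.sin_sub]
        linear_combination Real.sin (dist x y) * hz.cos_eq - Real.cos (dist x y) * hz.sin_eq
      refine le_of_mul_le_mul_left ?_ hs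
      have := mul_le_mul_of_nonneg_left key hz.pos.le
      calc _ = ρ * (Real.sin (dist z y) * Real.cos (dist p x) +
            Real.sin (dist x z) * Real.cos (dist p y)) := by
            linear_combination -(Real.cos (dist p x)) * e1 - Real.cos (dist p y) * hz.sin_eq
        _ ≤ _ := this
        _ = _ := by ring
  have := mul_le_mul_of_nonneg_left hcos hq
  simp only [coneSq]
  rw [hρ]
  linarith

/-- The argument of `UniformlyCATZero.dist_mid_sq_le`, carried out with cone distances. -/
theorem UniformlyCATOne.coneSq_mid_le (hB : HasBetween U) {o : U} {R r : ℝ} (hr : r ≤ 1 / 2)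
    (h : UniformlyCATOne o R r) {c a a' b b' m n : U} {ra ra' rb rb' rm rn : ℝ} (hc : dist o c ≤ R)
    (ha : dist c a ≤ r / 4) (ha' : dist c a' ≤ r / 4) (hb : dist c b ≤ r / 4) (hb' : dist c b' ≤ r / 4)
    (pa : 0 < ra) (pa' : 0 < ra') (pb : 0 < rb) (pb' : 0 < rb')
    (hm : IsConePoint (1 / 2) a ra a' ra' m rm) (hn : IsConePoint (1 / 2) b rb b' rb' n rn) :
    coneSq rm rn (dist m n) ≤ coneSq ra rb (dist a b) / 2 + coneSq ra' rb' (dist a' b') / 2 -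
      (√(coneSq rb rb' (dist b b')) - √(coneSq ra ra' (dist a a'))) ^ 2 / 4 := by
  have hpi := Real.pi_gt_three
  have tri : ∀ {x y : U} {s s' : ℝ}, dist c x ≤ s → dist c y ≤ s' → dist x y ≤ s + s' :=
    fun {x y} {s s'} hx hy => (dist_triangle_left x y c).trans (add_le_add hx hy)
  have hbtw : ∀ {x y z : U}, dist x z + dist z y = dist x y → dist c x ≤ r / 4 → dist c y ≤ r / 4 →
      dist c z ≤ r := fun {x y z} hz hx hy => by
    have t1 := dist_triangle c x z
    have t2 := tri hx hy
    linarith [dist_nonneg (x := z) (y := y), dist_nonneg (x := c) (y := x)]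
  have loc : ∀ {p x y z : U} {q s s' ρ t : ℝ}, dist c p ≤ r → dist c x ≤ r / 4 → dist c y ≤ r / 4 →
      0 < q → IsConePoint t x s y s' z ρ → coneSq q ρ (dist p z) ≤ (1 - t) * coneSq q s (dist p x) +
        t * coneSq q s' (dist p y) - t * (1 - t) * coneSq s s' (dist x y) := by
    intro p x y z q s s' ρ t hp hx hy hq hz
    have hr0 : 0 ≤ r := dist_nonneg.trans hp
    refine (h c hc p z x y hp (hbtw hz.between hx hy) (by linarith) (by linarith)).coneSq_le ?_ ?_ ?_
      hq.le hz
    · linarith [tri hx hy]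
    · linarith [tri hp hx]
    · linarith [tri hp hy]
  have hr0 : 0 ≤ r := by linarith [dist_nonneg (x := c) (y := a)]
  have e1 := loc (hbtw hm.between ha ha') hb hb' hm.pos hn
  have e2 := loc (p := b) (by linarith) ha ha' pb hm
  have e3 := loc (p := b') (by linarith) ha ha' pb' hm
  have e4 : √(coneSq ra' rb (dist a' b)) ^ 2 + √(coneSq ra rb' (dist a b')) ^ 2 ≤
      √(coneSq ra' rb' (dist a' b')) ^ 2 + √(coneSq ra rb (dist a b)) ^ 2 +
        2 * √(coneSq ra' ra (dist a' a)) * √(coneSq rb rb' (dist b b')) := by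
    refine diagonals_le_of_comparison (Real.sqrt_nonneg _) (Real.sqrt_nonneg _) (Real.sqrt_nonneg _)
      fun t ht0 ht1 => ?_
    obtain ⟨z, ρ, hz⟩ := hB.exists_isConePoint (x := a) (y := b') ht0.le ht1.le pa pb'
      (by linarith [tri ha hb'])
    have hcz := hbtw hz.between ha hb'
    refine ⟨√(coneSq ra' ρ (dist a' z)), √(coneSq ρ rb (dist z b)), ?_, ?_, ?_⟩
    · exact sqrt_coneSq_triangle pa'.le pb.le dist_nonneg (dist_triangle _ _ _)
        (by linarith [tri ha' hcz, tri hcz hb])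
    · simp only [Real.sq_sqrt (coneSq_nonneg _ _ _)]
      exact loc (by linarith) ha hb' pa' hz
    · simp only [Real.sq_sqrt (coneSq_nonneg _ _ _)]
      rw [coneSq_comm ρ rb, coneSq_comm ra rb, dist_comm z b, dist_comm a b]
      exact loc (by linarith) ha hb' pb hz
  simp only [Real.sq_sqrt (coneSq_nonneg _ _ _)] at e4
  have q1 := Real.sq_sqrt (coneSq_nonneg rb rb' (dist b b'))
  have q2 := Real.sq_sqrt (coneSq_nonneg ra ra' (dist a a'))
  rw [coneSq_comm rb rm, coneSq_comm rb ra, coneSq_comm rb ra', dist_comm b m, dist_comm b a,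
    dist_comm b a'] at e2
  rw [coneSq_comm rb' rm, coneSq_comm rb' ra, coneSq_comm rb' ra', dist_comm b' m, dist_comm b' a,
    dist_comm b' a'] at e3
  rw [coneSq_comm ra' ra, dist_comm a' a] at e4
  nlinarith

/-- The point dividing the chord of an arc of length `l` of the unit circle in the ratio
`t : 1 - t`. -/
noncomputable def chordPoint (l t : ℝ) : ℂ := ⟨(1 - t) + t * Real.cos l, t * Real.sin l⟩

theorem chordPoint_mem_slitPlane {l t : ℝ} (hl : 0 ≤ l) (hlpi : l < Real.pi) (ht0 : 0 ≤ t) :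
    chordPoint l t ∈ Complex.slitPlane := by
  rw [Complex.mem_slitPlane_iff]
  simp only [chordPoint]
  rcases ht0.eq_or_lt with h0 | h0
  · left; rw [← h0]; simp
  · rcases hl.eq_or_lt with hl0 | hl0
    · left; rw [← hl0]; simp
    · right
      have := Real.sin_pos_of_pos_of_lt_pi hl0 hlpi
      positivity

theorem continuous_chordPoint : Continuous fun z : ℝ × ℝ => chordPoint z.1 z.2 := by
  have : (fun z : ℝ × ℝ => chordPoint z.1 z.2) = fun z : ℝ × ℝ =>
      (((1 - z.2) + z.2 * Real.cos z.1 : ℝ) : ℂ) + ((z.2 * Real.sin z.1 : ℝ) : ℂ) * Complex.I := by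
    funext z
    apply Complex.ext <;> simp [chordPoint, -Complex.ofReal_cos, -Complex.ofReal_sin]
  rw [this]
  fun_prop

theorem continuousAt_arg_chordPoint {l t : ℝ} (hl : 0 ≤ l) (hlpi : l < Real.pi) (ht0 : 0 ≤ t) :
    ContinuousAt (fun z : ℝ × ℝ => (chordPoint z.1 z.2).arg) (l, t) :=
  ContinuousAt.comp (x := (l, t)) (f := fun z : ℝ × ℝ => chordPoint z.1 z.2) (g := Complex.arg)
    (Complex.continuousAt_arg (chordPoint_mem_slitPlane hl hlpi ht0)) continuous_chordPoint.continuousAt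

theorem norm_chordPoint_pos {l t : ℝ} (hl : 0 ≤ l) (hlpi : l < Real.pi) (ht0 : 0 ≤ t) :
    0 < ‖chordPoint l t‖ :=
  norm_pos_iff.2 (Complex.slitPlane_ne_zero (chordPoint_mem_slitPlane hl hlpi ht0))

theorem polar_chordPoint (l t : ℝ) : polar ‖chordPoint l t‖ (chordPoint l t).arg = chordPoint l t := by
  apply Complex.ext
  · exact Complex.norm_mul_cos_arg _
  · exact Complex.norm_mul_sin_arg _

theorem chordPoint_zero (l : ℝ) : chordPoint l 0 = 1 := by
  apply Complex.ext <;> simp [chordPoint]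

theorem chordPoint_one (l : ℝ) : chordPoint l 1 = polar 1 l := by
  apply Complex.ext <;> simp [chordPoint, polar]

theorem norm_chordPoint_one (l : ℝ) : ‖chordPoint l 1‖ = 1 := by
  have h : ‖chordPoint l 1‖ ^ 2 = 1 := by
    rw [← Complex.normSq_eq_norm_sq, Complex.normSq_apply]
    simp only [chordPoint]
    linear_combination Real.sin_sq_add_cos_sq l
  nlinarith [norm_nonneg (chordPoint l 1)]

theorem arg_chordPoint_one {l : ℝ} (hl : 0 ≤ l) (hlpi : l < Real.pi) : (chordPoint l 1).arg = l := by
  have : chordPoint l 1 = (1 : ℝ) * (Complex.cos l + Complex.sin l * Complex.I) := by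
    rw [chordPoint_one]
    apply Complex.ext <;> simp [polar, ← Complex.ofReal_cos, ← Complex.ofReal_sin]
  rw [this]
  exact Complex.arg_mul_cos_add_sin_mul_I one_pos ⟨by linarith, hlpi.le⟩

/-- Both points lie on one straight chord, so their plane distance is `|t - t'|` times its length;
equidistant points of the chord give steps of equal cone length. -/
theorem coneSq_chordPoint (l t t' : ℝ) :
    coneSq ‖chordPoint l t‖ ‖chordPoint l t'‖ ((chordPoint l t).arg - (chordPoint l t').arg) =
      (t - t') ^ 2 * coneSq 1 1 l := by
  rw [← dist_polar_sq, polar_chordPoint, polar_chordPoint, Complex.dist_eq,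
    ← Complex.normSq_eq_norm_sq, Complex.normSq_apply, coneSq]
  simp only [chordPoint, Complex.sub_re, Complex.sub_im]
  linear_combination (t - t') ^ 2 * Real.sin_sq_add_cos_sq l

theorem arg_chordPoint_mono {l t t' : ℝ} (hl : 0 ≤ l) (hlpi : l < Real.pi) (ht0 : 0 ≤ t)
    (htt : t ≤ t') : (chordPoint l t).arg ≤ (chordPoint l t').arg := by
  have hs : 0 ≤ Real.sin l := Real.sin_nonneg_of_nonneg_of_le_pi hl hlpi.le
  have ha : ∀ t, 0 ≤ t → 0 ≤ (chordPoint l t).arg := fun t ht =>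
    Complex.arg_nonneg_iff.2 (by simp only [chordPoint]; positivity)
  have hlt : ∀ t, 0 ≤ t → (chordPoint l t).arg < Real.pi := fun t ht =>
    lt_of_le_of_ne (Complex.arg_le_pi _)
      (Complex.mem_slitPlane_iff_arg.1 (chordPoint_mem_slitPlane hl hlpi ht)).1
  by_contra! hcon
  have h1 := Real.sin_pos_of_pos_of_lt_pi (x := (chordPoint l t).arg - (chordPoint l t').arg)
    (by linarith) (by linarith [hlt t ht0, ha t' (ht0.trans htt)])
  have n1 := norm_chordPoint_pos hl hlpi ht0
  have n2 := norm_chordPoint_pos hl hlpi (ht0.trans htt)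
  have h2 := mul_pos (mul_pos n1 n2) h1
  rw [Real.sin_sub] at h2
  have c1 := Complex.norm_mul_cos_arg (chordPoint l t)
  have s1 := Complex.norm_mul_sin_arg (chordPoint l t)
  have c2 := Complex.norm_mul_cos_arg (chordPoint l t')
  have s2 := Complex.norm_mul_sin_arg (chordPoint l t')
  simp only [chordPoint] at c1 s1 c2 s2
  have e : ‖chordPoint l t‖ * ‖chordPoint l t'‖ *
      (Real.sin (chordPoint l t).arg * Real.cos (chordPoint l t').arg -
        Real.cos (chordPoint l t).arg * Real.sin (chordPoint l t').arg) = (t - t') * Real.sin l := by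
    calc _ = (‖chordPoint l t‖ * Real.sin (chordPoint l t).arg) *
          (‖chordPoint l t'‖ * Real.cos (chordPoint l t').arg) -
        (‖chordPoint l t‖ * Real.cos (chordPoint l t).arg) *
          (‖chordPoint l t'‖ * Real.sin (chordPoint l t').arg) := by ring
      _ = _ := by
        simp only [chordPoint]
        rw [s1, c1, s2, c2]; ring
  rw [e] at h2
  nlinarith

theorem arg_chordPoint_mem {l t : ℝ} (hl : 0 ≤ l) (hlpi : l < Real.pi) (ht0 : 0 ≤ t) (ht1 : t ≤ 1) :
    (chordPoint l t).arg ∈ Icc 0 l := by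
  have h0 := arg_chordPoint_mono hl hlpi le_rfl ht0
  have h1 := arg_chordPoint_mono hl hlpi ht0 ht1
  rw [chordPoint_zero, Complex.arg_one] at h0
  rw [arg_chordPoint_one hl hlpi] at h1
  exact ⟨h0, h1⟩

/-- A subdivision of the chord of `[p y]` in the cone, projected to the space. -/
theorem IsGeodesic.exists_chordChain {β : ℝ → U} {p y : U} (hβ : IsGeodesic β p y)
    (hpy : dist p y < Real.pi) {N : ℕ} (hN : 0 < N) : ∃ (v : ℕ → U) (ρ : ℕ → ℝ), v 0 = p ∧ v N = y ∧
      ρ 0 = 1 ∧ ρ N = 1 ∧ (∀ i, 0 < ρ i) ∧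
      (∀ i ≤ N, dist p (v i) = (chordPoint (dist p y) (i / N)).arg) ∧
      (∀ i ≤ N, dist p (v i) + dist (v i) y = dist p y) ∧
      (∀ i < N, dist (v i) (v (i + 1)) = dist p (v (i + 1)) - dist p (v i)) ∧
      ∀ i < N, coneSq (ρ i) (ρ (i + 1)) (dist (v i) (v (i + 1))) =
        (√(coneSq 1 1 (dist p y)) / N) ^ 2 := by
  set f := dist p y with hf
  have hf0 : 0 ≤ f := dist_nonneg
  have hN0 : (0 : ℝ) < N := by exact_mod_cast hN
  have hfrac : ∀ i ≤ N, (i : ℝ) / N ≤ 1 := fun i hi => by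
    rw [div_le_one hN0]; exact_mod_cast hi
  have hmem : ∀ i ≤ N, (chordPoint f (i / N)).arg ∈ Icc 0 f := fun i hi =>
    arg_chordPoint_mem hf0 hpy (by positivity) (hfrac i hi)
  have hmono : ∀ i : ℕ, (chordPoint f (i / N)).arg ≤ (chordPoint f ((i + 1 : ℕ) / N)).arg := fun i =>
    arg_chordPoint_mono hf0 hpy (by positivity) (by gcongr; omega)
  have hd : ∀ i ≤ N, dist p (β (chordPoint f (i / N)).arg) = (chordPoint f (i / N)).arg := fun i hi =>
    hβ.dist_left (hmem i hi).1 (hmem i hi).2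
  have hdd : ∀ i < N, dist (β (chordPoint f (i / N)).arg) (β (chordPoint f ((i + 1 : ℕ) / N)).arg) =
      (chordPoint f ((i + 1 : ℕ) / N)).arg - (chordPoint f (i / N)).arg := fun i hi =>
    hβ.dist_eq _ _ (hmem i hi.le).1 (hmono i) (hmem (i + 1) hi).2
  refine ⟨fun i => β (chordPoint f (i / N)).arg, fun i => ‖chordPoint f (i / N)‖, ?_, ?_, ?_, ?_,
    fun i => norm_chordPoint_pos hf0 hpy (by positivity), hd, fun i hi => ?_, fun i hi => ?_,
    fun i hi => ?_⟩
  · simp [chordPoint_zero, hβ.left]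
  · show β (chordPoint f (N / N)).arg = y
    rw [div_self hN0.ne', arg_chordPoint_one hf0 hpy, hf, hβ.right]
  · simp [chordPoint_zero]
  · show ‖chordPoint f (N / N)‖ = 1
    rw [div_self hN0.ne', norm_chordPoint_one]
  · simp only []
    rw [hd i hi, hβ.dist_right (hmem i hi).1 (hmem i hi).2]
    ring
  · simp only []
    rw [hd i hi.le, hd (i + 1) hi, hdd i hi]
  · simp only []
    rw [hdd i hi, ← coneSq_neg, neg_sub, coneSq_chordPoint, div_pow,
      Real.sq_sqrt (coneSq_nonneg _ _ _)]
    push_cast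
    field_simp
    ring

end Cone

/-! ### Patching CAT(1) comparison -/

section Spherical

variable {U : Type*} [MetricSpace U]

theorem IsConePoint.of_eq_left {p m : U} {ρ : ℝ} (h : IsConePoint (1 / 2) p 1 p 1 m ρ) :
    m = p ∧ ρ = 1 := by
  have h1 := h.between
  have h2 := h.cos_eq
  rw [dist_self, dist_comm m p] at h1
  have h3 : dist p m = 0 := by linarith
  rw [h3, dist_self, Real.cos_zero] at h2
  exact ⟨(dist_eq_zero.1 h3).symm, by linarith⟩

theorem IsConePoint.mid_of_unit {a b m : U} {ρ ε : ℝ} (h : IsConePoint (1 / 2) a 1 b 1 m ρ)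
    (hab : dist a b = 2 * ε) (hε : 0 ≤ ε) (hε' : ε < Real.pi / 2) : IsMid a b m ∧ ρ = Real.cos ε := by
  have h1 := h.between
  have h2 := h.cos_eq
  have h3 := h.sin_eq
  have hc : 0 < Real.cos ε := Real.cos_pos_of_mem_Ioo ⟨by linarith, hε'⟩
  rw [hab, Real.cos_two_mul] at h2
  rw [hab, Real.sin_two_mul] at h3
  have h4 : ρ * Real.sin (dist a m - ε) = 0 := by
    rw [Real.sin_sub]
    linear_combination Real.cos ε * h3 - Real.sin ε * h2
  have h5 : Real.sin (dist a m - ε) = 0 := (mul_eq_zero.1 h4).resolve_left h.pos.ne'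
  have h6 := (Real.sin_eq_zero_iff_of_lt_of_lt
    (by linarith [dist_nonneg (x := a) (y := m), Real.pi_pos])
    (by linarith [dist_nonneg (x := m) (y := b), Real.pi_pos])).1 h5
  have h7 : dist a m = ε := by linarith
  refine ⟨⟨by linarith, by linarith⟩, ?_⟩
  rw [h7] at h2
  exact mul_right_cancel₀ hc.ne' (by rw [h2]; ring)

/-- Points of the projected chord of `[p y]` depend continuously on `y` at an endpoint joined to `p` by
a unique geodesic. -/
theorem UniqueBetween.chord_dist_lt [ProperSpace U] {p y : U} (h : UniqueBetween p y)
    (hpy : dist p y < Real.pi) {c : ℕ → U} {N : ℕ}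
    (hc : ∀ i ≤ N, dist p (c i) = (chordPoint (dist p y) (i / N)).arg)
    (hc' : ∀ i ≤ N, dist p (c i) + dist (c i) y = dist p y) {ρ : ℝ} (hρ : 0 < ρ) :
    ∃ e > 0, ∀ i ≤ N, ∀ y' z', dist y y' < e → dist p z' + dist z' y' = dist p y' →
      dist p z' = (chordPoint (dist p y') (i / N)).arg → dist (c i) z' < ρ := by
  obtain ⟨e, he, h⟩ := exists_pos_forall_le (N := N)
    (P := fun i e => i ≤ N → ∀ y' z', dist y y' < e → dist p z' + dist z' y' = dist p y' →
      dist p z' = (chordPoint (dist p y') (i / N)).arg → dist (c i) z' < ρ)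
    (fun i e e' hee hP hi y' z' h1 h2 h3 => hP hi y' z' (h1.trans_le hee) h2 h3)
    (fun i => by
      by_cases hi : i ≤ N
      · obtain ⟨e, he, h⟩ := h.dist_lt (hc' i hi) hρ
        obtain ⟨δ, hδ, h'⟩ := Metric.continuousAt_iff.1 (continuousAt_arg_chordPoint (l := dist p y)
          (t := (i : ℝ) / N) dist_nonneg hpy (by positivity)) e he
        refine ⟨min e δ, lt_min he hδ, fun _ y' z' h1 h2 h3 =>
          h y' z' (h1.trans_le (min_le_left _ _)) h2 ?_⟩
        rw [h3, hc i hi, ← Real.dist_eq]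
        refine h' (x := (dist p y', (i : ℝ) / N)) ?_
        rw [Prod.dist_eq, dist_self, max_lt_iff]
        refine ⟨?_, hδ⟩
        rw [Real.dist_eq, dist_comm p y', dist_comm p y]
        exact (abs_dist_sub_le _ _ _).trans_lt (by
          rw [dist_comm]; exact h1.trans_le (min_le_right _ _))
      · exact ⟨1, one_pos, fun h => absurd h hi⟩)
  exact ⟨e, he, fun i hi => h i hi hi⟩

theorem exists_chord_subdivision {f r : ℝ} (hf0 : 0 ≤ f) (hf : f < Real.pi) (hr : 0 < r) :
    ∃ N : ℕ, 0 < N ∧ ∀ i < N,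
      (chordPoint f ((i + 1 : ℕ) / N)).arg - (chordPoint f (i / N)).arg < r := by
  have hcont : ContinuousOn (fun s => (chordPoint f s).arg) (Icc 0 1) := fun s hs =>
    ((continuousAt_arg_chordPoint hf0 hf hs.1).comp (f := fun s : ℝ => (f, s))
      (by fun_prop)).continuousWithinAt
  obtain ⟨δ, hδ, h⟩ := Metric.uniformContinuousOn_iff.1
    (isCompact_Icc.uniformContinuousOn_of_continuous hcont) r hr
  obtain ⟨n, hn⟩ := exists_nat_one_div_lt hδ
  refine ⟨n + 1, n.succ_pos, fun i hi => (le_abs_self _).trans_lt ?_⟩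
  have hn0 : (0 : ℝ) < ((n + 1 : ℕ) : ℝ) := by positivity
  have hm : ∀ j ≤ n + 1, (j : ℝ) / (n + 1 : ℕ) ∈ Icc (0 : ℝ) 1 := fun j hj =>
    ⟨by positivity, by rw [div_le_one hn0]; exact_mod_cast hj⟩
  rw [← Real.dist_eq]
  refine h _ (hm _ hi) _ (hm _ hi.le) ?_
  rw [Real.dist_eq, ← sub_div, abs_of_nonneg (by push_cast; rw [add_sub_cancel_left]; positivity)]
  push_cast
  rw [add_sub_cancel_left]
  exact hn

/-- The patchwork of the flat case in the cone: the chords from `(p, 1)` to `(γ (t - ε), 1)` and `(γ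
(t + ε), 1)` are subdivided, and the midpoints of corresponding points form a chain from `(p, 1)` to
`(γ t, cos ε)`. -/
theorem IsLocallyCATOne.cos_dist_local [ProperSpace U] (hB : HasBetween U) (hU : IsLocallyCATOne U)
    {p : U} {γ : ℝ → U} {x y : U} (hγ : IsGeodesic γ x y)
    {t : ℝ} (ht0 : 0 < t) (ht1 : t < dist x y) (huniq : UniqueBetween p (γ t))
    (hpi : dist p (γ t) < Real.pi) :
    ∃ ε₀ > 0, ∀ ε, 0 < ε → ε < ε₀ → ε ≤ t → t + ε ≤ dist x y →
      (Real.cos (dist p (γ (t - ε))) + Real.cos (dist p (γ (t + ε)))) / 2 ≤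
        Real.cos ε * Real.cos (dist p (γ t)) := by
  have hpi3 := Real.pi_gt_three
  set f := dist p (γ t) with hf
  have hf0 : 0 ≤ f := dist_nonneg
  obtain ⟨r, hr, hr', hloc⟩ := hU.uniformly p (f + 1)
  obtain ⟨α, hα⟩ := hB.exists_geodesic p (γ t)
  obtain ⟨N, hN, hNstep⟩ := exists_chord_subdivision hf0 hpi (r := r / 8) (by positivity)
  have hN0 : (0 : ℝ) < N := by exact_mod_cast hN
  obtain ⟨c, -, hc0, hcN, -, -, -, hcd, hcb, hcs, -⟩ := hα.exists_chordChain hpi hN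
  have hπf : 0 < Real.pi - f := by linarith
  -- The midpoints will be within `3 * ρ'` of the points `c i`, so their chain has total angle at
  -- most `f + N * (6 * ρ')`. This choice keeps it at most `π`, as the unfolding requires.
  set ρ' := min (r / 8) ((Real.pi - f) / (6 * N)) with hρ'
  have hρ0 : 0 < ρ' := by positivity
  have hρr : ρ' ≤ r / 8 := min_le_left _ _
  have hρN : N * (6 * ρ') ≤ Real.pi - f := by
    have := (min_le_right (r / 8) ((Real.pi - f) / (6 * N)))
    rw [← hρ', le_div_iff₀ (by positivity)] at this
    linarith
  obtain ⟨e, he, hcont⟩ := huniq.chord_dist_lt hpi hcd hcb hρ0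
  refine ⟨min e (min (r / 8) (Real.pi - f)), by positivity, fun ε hε hεlt hεt hεl => ?_⟩
  have hεe : ε < e := hεlt.trans_le (min_le_left _ _)
  have hεr : ε < r / 8 := hεlt.trans_le ((min_le_right _ _).trans (min_le_left _ _))
  have hεπ : ε < Real.pi - f := hεlt.trans_le ((min_le_right _ _).trans (min_le_right _ _))
  have chain : ∀ y', dist (γ t) y' = ε → ∃ (v : ℕ → U) (ρ : ℕ → ℝ), v 0 = p ∧ v N = y' ∧
      ρ 0 = 1 ∧ ρ N = 1 ∧ (∀ i, 0 < ρ i) ∧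
      (∀ i < N, coneSq (ρ i) (ρ (i + 1)) (dist (v i) (v (i + 1))) =
        (√(coneSq 1 1 (dist p y')) / N) ^ 2) ∧ ∀ i ≤ N, dist (c i) (v i) < ρ' := by
    intro y' hy'
    obtain ⟨β, hβ⟩ := hB.exists_geodesic p y'
    obtain ⟨v, ρ, hv0, hvN, hρ0, hρN, hρ, hvd, hvb, -, hvc⟩ := hβ.exists_chordChain
      (by linarith [dist_triangle p (γ t) y']) hN
    exact ⟨v, ρ, hv0, hvN, hρ0, hρN, hρ, hvc, fun i hi =>
      hcont i hi y' _ (by rw [hy']; exact hεe) (hvb i hi) (hvd i hi)⟩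
  have g1 : dist (γ t) (γ (t - ε)) = ε := by
    rw [dist_comm, hγ.dist_eq _ _ (by linarith) (by linarith) (by linarith)]; ring
  have g2 : dist (γ t) (γ (t + ε)) = ε := by
    rw [hγ.dist_eq _ _ (by linarith) (by linarith) (by linarith)]; ring
  have g3 : dist (γ (t - ε)) (γ (t + ε)) = 2 * ε := by
    rw [hγ.dist_eq _ _ (by linarith) (by linarith) (by linarith)]; ring
  obtain ⟨v, a, hv0, hvN, ha0, haN, ha, hvs, hvc⟩ := chain _ g1
  obtain ⟨w, b, hw0, hwN, hb0, hbN, hb, hws, hwc⟩ := chain _ g2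
  have hvw : ∀ i ≤ N, dist (v i) (w i) < 2 * ρ' := fun i hi => by
    linarith [dist_triangle_left (v i) (w i) (c i), hvc i hi, hwc i hi]
  have : Nonempty U := ⟨p⟩
  choose! m ρ hm using fun i (hi : i ≤ N) =>
    hB.exists_isConePoint (t := 1 / 2) (by norm_num) (by norm_num) (ha i) (hb i)
      (show dist (v i) (w i) < Real.pi by linarith [hvw i hi])
  have hm0 := hm 0 N.zero_le
  rw [hv0, hw0, ha0, hb0] at hm0
  obtain ⟨em0, eρ0⟩ := hm0.of_eq_left
  have hmN := hm N le_rfl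
  rw [hvN, hwN, haN, hbN] at hmN
  obtain ⟨hmid, eρN⟩ := hmN.mid_of_unit g3 hε.le (by linarith)
  have emN : m N = γ t := by
    refine (hloc.midNonexpanding hr').eq ?_ ?_ hmid ?_
    · linarith [dist_triangle p (γ t) (γ (t - ε))]
    · rw [g3]; linarith
    · exact ⟨by rw [dist_comm, g1, g3]; ring, by rw [g2, g3]; ring⟩
  have hcm' : ∀ i ≤ N, dist (c i) (m i) ≤ 3 * ρ' := fun i hi => by
    linarith [dist_triangle (c i) (v i) (m i), hvc i hi, hvw i hi, (hm i hi).between,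
      dist_nonneg (x := m i) (y := w i)]
  have hsum : ∑ i ∈ Finset.range N, dist (m i) (m (i + 1)) ≤ Real.pi := by
    calc _ ≤ ∑ i ∈ Finset.range N, (6 * ρ' + (dist p (c (i + 1)) - dist p (c i))) := by
          refine Finset.sum_le_sum fun i hi => ?_
          have hi : i < N := Finset.mem_range.1 hi
          have t1 := dist_triangle4 (m i) (c i) (c (i + 1)) (m (i + 1))
          rw [hcs i hi, dist_comm (m i) (c i)] at t1
          linarith [hcm' i hi.le, hcm' (i + 1) hi]
      _ = N * (6 * ρ') + f := by
          rw [Finset.sum_add_distrib, Finset.sum_range_sub (fun i => dist p (c i)), hc0, hcN, dist_self,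
            Finset.sum_const, Finset.card_range, nsmul_eq_mul, sub_zero]
      _ ≤ Real.pi := by linarith
  have key := sq_le_of_chain (N := N) (E := fun i => √(coneSq (ρ i) (ρ (i + 1)) (dist (m i) (m (i + 1)))))
    (D := fun i => √(coneSq (a i) (b i) (dist (v i) (w i))))
    (α := √(coneSq 1 1 (dist p (γ (t - ε)))) / N) (β := √(coneSq 1 1 (dist p (γ (t + ε)))) / N)
    (X := √(coneSq (ρ 0) (ρ N) f)) (Real.sqrt_nonneg _) (fun i hi => by
      rw [← hvs i hi, ← hws i hi, Real.sq_sqrt (coneSq_nonneg _ _ _)]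
      have hstep := hNstep i hi
      rw [← hcd i hi.le, ← hcd (i + 1) hi, ← hcs i hi] at hstep
      refine hloc.coneSq_mid_le hB hr' (c := c i) ?_ ?_ ?_ ?_ ?_ (ha i) (hb i) (ha _) (hb _)
        (hm i hi.le) (hm (i + 1) hi)
      · linarith [hcb i hi.le, dist_nonneg (x := c i) (y := γ t)]
      · linarith [hvc i hi.le]
      · linarith [hwc i hi.le]
      · linarith [dist_triangle (c i) (c (i + 1)) (v (i + 1)), hvc (i + 1) hi]
      · linarith [dist_triangle (c i) (c (i + 1)) (w (i + 1)), hwc (i + 1) hi])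
    (by simp [hv0, hw0, ha0, hb0, coneSq]; norm_num)
    (sqrt_coneSq_le_sum (hm 0 N.zero_le).pos.le (hm N le_rfl).pos.le hf0 (by
      have := dist_le_range_sum_dist m N
      rwa [em0, emN] at this) hsum)
  rw [mul_div_cancel₀ _ hN0.ne', mul_div_cancel₀ _ hN0.ne'] at key
  simp only [Real.sq_sqrt (coneSq_nonneg _ _ _), hvN, hwN, haN, hbN, g3, eρ0, eρN] at key
  -- All radii at the ends are explicit, and the squared radius `cos ε ^ 2` cancels against the term
  -- from the base of length `2 * ε`; only the cosines of the three distances remain.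
  simp only [coneSq, Real.cos_two_mul] at key
  linarith

/-- The spherical law of cosines for a point dividing a side, as a comparison inequality. -/
theorem sin_mul_cos_le_of_local {p : U} {γ : ℝ → U} {x y : U} (hγ : IsGeodesic γ x y)
    (hxy : dist x y < Real.pi)
    (h : ∀ t, 0 < t → t < dist x y → ∃ ε₀ > 0, ∀ ε, 0 < ε → ε < ε₀ → ε ≤ t → t + ε ≤ dist x y →
      (Real.cos (dist p (γ (t - ε))) + Real.cos (dist p (γ (t + ε)))) / 2 ≤
        Real.cos ε * Real.cos (dist p (γ t))) {t : ℝ} (ht : t ∈ Icc 0 (dist x y)) :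
    Real.sin (dist x y - t) * Real.cos (dist p x) + Real.sin t * Real.cos (dist p y) ≤
      Real.sin (dist x y) * Real.cos (dist p (γ t)) := by
  set l := dist x y with hl
  have hl0 : 0 ≤ l := dist_nonneg
  -- The function below satisfies its mean value inequality with the constant `cos ε`; strictness
  -- comes from `k > 1`, for which there is room since `l < π`.
  obtain ⟨k, hk1, hkl⟩ : ∃ k : ℝ, 1 < k ∧ k * l < Real.pi := by
    refine ⟨2 * Real.pi / (Real.pi + l), ?_, ?_⟩
    · rw [lt_div_iff₀ (by positivity)]; linarith
    · rw [div_mul_eq_mul_div, div_lt_iff₀ (by positivity)]; nlinarith [Real.pi_pos]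
  have hsl : 0 ≤ Real.sin l := Real.sin_nonneg_of_nonneg_of_le_pi hl0 hxy.le
  have key := nonpos_of_local (u := fun t => Real.sin (l - t) * Real.cos (dist p x) +
      Real.sin t * Real.cos (dist p y) - Real.sin l * Real.cos (dist p (γ t))) hl0
      (by linarith) hkl ?_ ?_ ?_ ?_ t ht
  · linarith
  · have hc := hγ.continuousOn
    fun_prop
  · simp [hγ.left]
  · simp [hl, hγ.right]
  · intro t ht0 ht1
    obtain ⟨ε₀, hε₀, hh⟩ := h t ht0 ht1
    set ε := min (ε₀ / 2) (min t (l - t)) with hε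
    have hε0 : 0 < ε := by
      have : 0 < l - t := by linarith
      positivity
    have c1 : ε < ε₀ := (min_le_left _ _).trans_lt (by linarith)
    have c2 : ε ≤ t := (min_le_right _ _).trans (min_le_left _ _)
    have c3 : ε ≤ l - t := (min_le_right _ _).trans (min_le_right _ _)
    refine ⟨ε, hε0, c2, by linarith, Real.cos ε, ?_, ?_⟩
    · exact Real.cos_lt_cos_of_nonneg_of_le_pi hε0.le (by nlinarith) (by nlinarith)
    · have h1 := mul_le_mul_of_nonneg_left (hh ε hε0 c1 c2 (by linarith)) hsl
      rw [show l - (t - ε) = (l - t) + ε by ring, show l - (t + ε) = (l - t) - ε by ring]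
      rw [Real.sin_add (l - t), Real.sin_sub (l - t), Real.sin_sub t, Real.sin_add t]
      linarith

/-- Since `z` lies on the arc, `sin (a + b) • z = sin b • x + sin a • y`: the difference has norm
zero by the addition formulas. The identity is the inner product of this with `p`. -/
theorem sin_mul_cos_sphericalDist {p x y z : UnitTwoSphere} (hz : z ∈ sphericalSegment x y) :
    Real.sin (sphericalDist x y) * Real.cos (sphericalDist p z) =
      Real.sin (sphericalDist z y) * Real.cos (sphericalDist p x) +
        Real.sin (sphericalDist x z) * Real.cos (sphericalDist p y) := by
  set a := sphericalDist x z
  set b := sphericalDist z y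
  have hab : a + b = sphericalDist x y := hz
  have e1 : inner ℝ (x : EuclideanSpace ℝ (Fin 3)) (z : EuclideanSpace ℝ (Fin 3)) = Real.cos a :=
    (cos_sphericalDist _ _).symm
  have e2 : inner ℝ (y : EuclideanSpace ℝ (Fin 3)) (z : EuclideanSpace ℝ (Fin 3)) = Real.cos b := by
    rw [real_inner_comm]; exact (cos_sphericalDist _ _).symm
  have e3 : inner ℝ (x : EuclideanSpace ℝ (Fin 3)) (y : EuclideanSpace ℝ (Fin 3)) =
    Real.cos (a + b) := by rw [hab]; exact (cos_sphericalDist _ _).symm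
  have hn : ∀ v : UnitTwoSphere,
      inner ℝ (v : EuclideanSpace ℝ (Fin 3)) (v : EuclideanSpace ℝ (Fin 3)) = 1 := fun v => by
    rw [real_inner_self_eq_norm_sq, norm_eq_of_mem_sphere, one_pow]
  have h0 : Real.sin (a + b) • (z : EuclideanSpace ℝ (Fin 3)) - Real.sin b • (x : EuclideanSpace ℝ (Fin 3)) -
      Real.sin a • (y : EuclideanSpace ℝ (Fin 3)) = 0 := by
    rw [← inner_self_eq_zero (𝕜 := ℝ)]
    simp only [inner_sub_left, inner_sub_right, inner_smul_left, inner_smul_right, hn, e1, e2, e3,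
      real_inner_comm (x : EuclideanSpace ℝ (Fin 3)) (z : EuclideanSpace ℝ (Fin 3)),
      real_inner_comm (y : EuclideanSpace ℝ (Fin 3)) (z : EuclideanSpace ℝ (Fin 3)),
      real_inner_comm (x : EuclideanSpace ℝ (Fin 3)) (y : EuclideanSpace ℝ (Fin 3))]
    rw [Real.sin_add, Real.cos_add]
    simp only [conj_trivial]
    linear_combination -(Real.sin a ^ 2) * Real.sin_sq_add_cos_sq b -
      Real.sin b ^ 2 * Real.sin_sq_add_cos_sq a
  have h1 := congrArg (fun v => inner ℝ (p : EuclideanSpace ℝ (Fin 3)) v) h0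
  simp only [inner_sub_right, inner_smul_right, inner_zero_right, ← cos_sphericalDist] at h1
  rw [← hab]
  linarith

/-- In the sphere the inequality is an equality, so the cosines compare and the cosine is decreasing
on `[0, π]`. If `x = y`, the sine vanishes and both sides are read off directly. -/
theorem dist_le_sphericalDist {p x y z : U} {p' x' y' z' : UnitTwoSphere}
    (hz' : z' ∈ sphericalSegment x' y') (hpx : sphericalDist p' x' = dist p x)
    (hxy : sphericalDist x' y' = dist x y) (hyp : sphericalDist y' p' = dist y p)
    (hxz : dist x z = sphericalDist x' z') (hxypi : dist x y < Real.pi) (hpz : dist p z ≤ Real.pi)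
    (h : Real.sin (dist x y - dist x z) * Real.cos (dist p x) + Real.sin (dist x z) * Real.cos (dist p y) ≤
      Real.sin (dist x y) * Real.cos (dist p z)) : dist p z ≤ sphericalDist p' z' := by
  have hb : sphericalDist x' z' + sphericalDist z' y' = sphericalDist x' y' := hz'
  have h0 : 0 ≤ dist x y := dist_nonneg
  rcases h0.eq_or_lt with h0 | h0
  · have e1 : sphericalDist x' z' = 0 := by
      linarith [sphericalDist_nonneg x' z', sphericalDist_nonneg z' y']
    have e2 : x = z := dist_eq_zero.1 (by rw [hxz, e1])
    have e3 : x' = z' := by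
      have := cos_sphericalDist x' z'
      rw [e1, Real.cos_zero] at this
      exact Subtype.ext ((inner_eq_one_iff_of_norm_eq_one (𝕜 := ℝ) (norm_eq_of_mem_sphere _)
        (norm_eq_of_mem_sphere _)).1 this.symm)
    rw [← e2, ← e3, hpx]
  · have hs := Real.sin_pos_of_pos_of_lt_pi h0 hxypi
    have h1 := sin_mul_cos_sphericalDist (p := p') hz'
    rw [hxy, hpx, show sphericalDist z' y' = dist x y - dist x z by linarith, ← hxz,
      sphericalDist_comm p' y', hyp, dist_comm y p] at h1
    rw [← h1] at h
    have h2 := le_of_mul_le_mul_left h hs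
    exact (Real.strictAntiOn_cos.le_iff_ge ⟨sphericalDist_nonneg _ _, sphericalDist_le_pi _ _⟩
      ⟨dist_nonneg, hpz⟩).1 h2

theorem isCATOne_of_uniqueBetween [ProperSpace U] (hL : IsLengthSpace U) (hU : IsLocallyCATOne U)
    (huniq : ∀ x y : U, dist x y < Real.pi → UniqueBetween x y) : IsCATOne U := by
  have hB := hL.hasBetween
  intro p q x y p' q' x' y' hp hq z' hz'
  obtain ⟨γ, hγ⟩ := hB.exists_geodesic x y
  have hs : sphericalDist x' z' + sphericalDist z' y' = dist x y := by rw [← hp.2.2.1]; exact hz'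
  have hs0 := sphericalDist_nonneg x' z'
  have hs1 : sphericalDist x' z' ≤ dist x y := by linarith [sphericalDist_nonneg z' y']
  have key : ∀ p p', IsSphericalModel p x y p' x' y' →
      dist p (γ (sphericalDist x' z')) ≤ sphericalDist p' z' := by
    intro p p' ⟨hper, hpx, hxy, hyp⟩
    have hxypi : dist x y < Real.pi := by
      linarith [dist_triangle_left x y p, dist_comm y p]
    -- The two routes from `p` to `γ t`, through `x` and through `y`, have total length below `2 *
    -- π`, so the shorter one is below `π`. Uniqueness is thus available for every geodesic from `p`
    -- to the side.
    have hlt : ∀ t ∈ Icc 0 (dist x y), dist p (γ t) < Real.pi := fun t ht => by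
      linarith [dist_triangle p x (γ t), dist_triangle p y (γ t), hγ.dist_left ht.1 ht.2,
        hγ.dist_right ht.1 ht.2, dist_comm y p, dist_comm y (γ t)]
    refine dist_le_sphericalDist hz' hpx hxy hyp (hγ.dist_left hs0 hs1) hxypi (hlt _ ⟨hs0, hs1⟩).le
      ?_
    rw [hγ.dist_left hs0 hs1]
    exact sin_mul_cos_le_of_local hγ hxypi (fun t ht0 ht1 =>
      hU.cos_dist_local hB hγ ht0 ht1 (huniq _ _ (hlt t ⟨ht0.le, ht1.le⟩)) (hlt t ⟨ht0.le, ht1.le⟩))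
      ⟨hs0, hs1⟩
  have h1 := key p p' hp
  have h2 := key q q' hq
  rw [sphericalDist_comm q', dist_comm q] at h2
  exact (dist_triangle _ _ _).trans (add_le_add h1 h2)

end Spherical

theorem mainTheorem4 {U : Type*} [MetricSpace U] [ProperSpace U] (hU : IsLengthSpace U) :
    (SimplyConnectedSpace U → IsLocallyCATZero U → IsCATZero U) ∧
    (IsLocallyCATOne U →
      (∀ γ : C(UnitAddCircle, U), closedCurveLength γ < ENNReal.ofReal (2 * Real.pi) →
        NullHomotopicThroughShorter (2 * Real.pi) γ) →
      IsCATOne U) := by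
  refine ⟨fun _ h => isCATZero_of_simplyConnected hU h, fun h hloop =>
    isCATOne_of_uniqueBetween hU h fun x y hxy => ?_⟩
  have hB := hU.hasBetween
  exact uniqueBetween_of_geodesic hB fun _ _ h₀ h₁ => h.geodesic_unique hB hloop h₀ h₁ hxy
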